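/- Let $d\ge 1$, $0<\alpha\le 1$, $M\in\mathbb R$, $b>0$. Let $f:[0,1]^d\to\mathbb R$ and $s:[0,1]^d\to[0,\infty)$ be $(M,\alpha)$-Hölder, i.e. $|g(x)-g(y)|\le M\|x-y\|_2^\alpha$ on $[0,1]^d$ for $g\in\{f,s\}$. For $x\in[0,1]^d$ let $\nu_x$ be a probability distribution on $\mathbb R$ (depending measurably on $x$) with mean $0$ and variance $1$ such that, for all $0\le\lambda<1/b$, $$\mathbb E_{\varepsilon\sim\nu_x}\big[e^{\lambda\varepsilon}\big]\le \exp\Big(\frac{\lambda^2}{2(1-\lambda b)}\Big),\qquad \mathbb E_{\varepsilon\sim\nu_x}\big[e^{\lambda\varepsilon^2-\lambda}\big]\le \exp\Big(\frac{\lambda^2}{2(1-\lambda b)}\Big).$$ For $K=l^d$ let $\mathcal N_K$ be the partition of $[0,1]^d$ into $K$ cubes $\Omega_1,\dots,\Omega_K$ of side $1/l$. Write $w_k=|\Omega_k|=1/K$, $\mu_k=\frac1{w_k}\int_{\Omega_k}\mathbb E_{\varepsilon\sim\nu_x}[f(x)+s(x)\varepsilon]\,dx$, $\sigma_k^2=\frac1{w_k}\int_{\Omega_k}\mathbb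 E_{\varepsilon\sim\nu_x}[(f(x)+s(x)\varepsilon-\mu_k)^2]\,dx$ and $\Sigma_{\mathcal N_K}=\sum_k w_k\sigma_k$. A sample from stratum $k$ is $f(x)+s(x)\varepsilon$ with $x$ uniform on $\Omega_k$ and $\varepsilon\sim\nu_x$; all samples are independent, and $X_{k,i}$ denotes the $i$-th sample from stratum $k$. The algorithm MC-UCB with budget $n$, partition $\mathcal N_K$, and parameters $b$, $f_{\max}=\max(|f(0)|,s(0))+Md^{\alpha/2}$, $\delta=n^{-2}$ samples every stratum twice in the first $2K$ rounds; then in each round $t=2K+1,\dots,n$ it samples a stratum maximizing $$B_{k,t}=\frac{w_k}{T_{k,t-1}}\Big(\hat\sigma_{k,t-1}+A\sqrt{\tfrac1{T_{k,t-1}}}\Big),\qquad A=2\sqrt{(1+3b+4f_{\max}^2)\log(2nK/\delta)}$$ (ties broken arbitrarily), where $T_{k,t}$ is the number of samples taken from stratum $k$ in rounds $1,\dots,t$, and $\hat\sigma_{k,t}^2=\frac1{T_{k,t}}\sum_{i\le T_{k,t}}(X_{k,i}-\hat\mu_{k,t})^2$, $\hat\mu_{k,t}=\frac1{T_{k,t}}\sum_{i\le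 T_{k,t}}X_{k,i}$. Its pseudo-risk is $L_n=\sum_k w_k^2\sigma_k^2/T_{k,n}$. Choose $K=K_n=\big(\lfloor n^{1/(d+3\alpha)}\rfloor\big)^d$. Then $K_n\le n^{d/(d+3\alpha)}\le n$, and for every $n$ with $n\ge 2K_n$ (so that the initialization is possible), $$\mathbb E[L_n]-\frac1n\Big(\int_{[0,1]^d}s(x)\,dx\Big)^2\le c\,d^{\frac{2\alpha}{3d}+\frac12}\sqrt{\log n}\;n^{-\frac{d+4\alpha}{d+3\alpha}}\Big(1+d^\alpha n^{-\frac{\alpha}{d+3\alpha}}\Big),$$ where $$c=70(1+M)\,\Sigma_{\mathcal N_{K_n}}\sqrt{1+3b+4(|f(0)|+s(0)+M)^2}\,\Big(\frac{|f(0)|+s(0)+M+4}{4}\Big)^{1/3}.$$ Consequently, for fixed $d,\alpha,M,b,f,s,\nu$, the difference is $\tilde O\big(n^{-\frac{d+4\alpha}{d+3\alpha}}\big)$: there are $C$ and $q$, not depending on $n$, such that for all $n\ge 2K_n$ $$\Big|\mathbb E[L_n]-\frac1n\Big(\int_{[0,1]^d}s(x)\,dx\Big)^2\Big|\le C(\log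 n)^q\,n^{-\frac{d+4\alpha}{d+3\alpha}}.$$ -/

import Mathlib

open MeasureTheory ProbabilityTheory

universe u

namespace StratMC

noncomputable section

/-- `ℝ^d` with its Euclidean norm and Lebesgue measure. -/
abbrev Space (d : ℕ) : Type := EuclideanSpace ℝ (Fin d)

/-- The cube `[0,1]^d`. -/
def unitCube (d : ℕ) : Set (Space d) := {x | ∀ i, x i ∈ Set.Icc (0 : ℝ) 1}

/-- `g` is `(M, α)`-Hölder continuous on `[0,1]^d` for the Euclidean norm. -/
def IsHolder {d : ℕ} (M α : ℝ) (g : Space d → ℝ) : Prop :=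
  ∀ x ∈ unitCube d, ∀ y ∈ unitCube d, |g x - g y| ≤ M * ‖x - y‖ ^ α

/-- The noise distributions `ν_x`, `x ∈ [0,1]^d`: mean `0`, variance `1`, and the two exponential
moment bounds with parameter `b` (the exponential moments being finite). -/
structure NoiseAssumption {d : ℕ} (b : ℝ) (ν : Kernel (Space d) ℝ) : Prop where
  b_pos : 0 < b
  mean_zero : ∀ x ∈ unitCube d, Integrable (fun e : ℝ => e) (ν x) ∧ ∫ e, e ∂(ν x) = 0
  variance_one : ∀ x ∈ unitCube d, Integrable (fun e : ℝ => e ^ 2) (ν x) ∧ ∫ e, e ^ 2 ∂(ν x) = 1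
  exp_moment : ∀ x ∈ unitCube d, ∀ lam : ℝ, 0 ≤ lam → lam < 1 / b →
    Integrable (fun e : ℝ => Real.exp (lam * e)) (ν x) ∧
      ∫ e, Real.exp (lam * e) ∂(ν x) ≤ Real.exp (lam ^ 2 / (2 * (1 - lam * b)))
  exp_moment_sq : ∀ x ∈ unitCube d, ∀ lam : ℝ, 0 ≤ lam → lam < 1 / b →
    Integrable (fun e : ℝ => Real.exp (lam * e ^ 2 - lam)) (ν x) ∧
      ∫ e, Real.exp (lam * e ^ 2 - lam) ∂(ν x) ≤ Real.exp (lam ^ 2 / (2 * (1 - lam * b)))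

/-- The strata of the partition of `[0,1]^d` into `l^d` cubes of side `1/l`, indexed by
`j : Fin d → Fin l`. In each coordinate the intervals are `[j/l, (j+1)/l)`, except the last one,
which contains its right end point `1`. -/
def cubeStratum (d l : ℕ) (j : Fin d → Fin l) : Set (Space d) :=
  {x | x ∈ unitCube d ∧ ∀ i, ((j i : ℕ) : ℝ) ≤ l * x i ∧
    (l * x i < ((j i : ℕ) : ℝ) + 1 ∨ (j i : ℕ) + 1 = l)}

section Strata

variable {d : ℕ} {ι : Type} (f s : Space d → ℝ) (ν : Kernel (Space d) ℝ) (S : ι → Set (Space d))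

/-- The measure `w_k` of the stratum `S k`. -/
def weight (k : ι) : ℝ := volume.real (S k)

/-- The mean `μ_k` of a noisy sample taken at a uniformly distributed point of the stratum. -/
def stratumMean (k : ι) : ℝ :=
  1 / weight S k * ∫ x in S k, ∫ e, (f x + s x * e) ∂(ν x)

/-- The variance `σ_k²` of a noisy sample taken at a uniformly distributed point of the stratum. -/
def stratumVar (k : ι) : ℝ :=
  1 / weight S k * ∫ x in S k, ∫ e, (f x + s x * e - stratumMean f s ν S k) ^ 2 ∂(ν x)

/-- The standard deviation `σ_k`. -/
def stratumStd (k : ι) : ℝ := √(stratumVar f s ν S k)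

/-- `Σ = ∑_k w_k σ_k`. -/
def totalStd [Fintype ι] : ℝ := ∑ k, weight S k * stratumStd f s ν S k

/-- The pseudo-risk `∑_k w_k² σ_k² / T_k` of an allocation with `T k` samples in stratum `k`. -/
def pseudoRisk [Fintype ι] (T : ι → ℕ) : ℝ :=
  ∑ k, weight S k ^ 2 * stratumVar f s ν S k / (T k : ℝ)

/-- The joint law of `(x, ε)` with `x` uniform on the stratum `S k` and, given `x`,
`ε` of law `ν_x`. -/
def sampleLaw (k : ι) : Measure (Space d × ℝ) := (volume[|S k]) ⊗ₘ ν

end Strata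

section Algorithm

variable {ι : Type} [DecidableEq ι]

/-- `T_{k,t}`: the number of rounds `r ∈ {1, …, t}` in which `a r = k`. -/
def pulls (a : ℕ → ι) (k : ι) (t : ℕ) : ℕ := ((Finset.Icc 1 t).filter (fun r => a r = k)).card

/-- The mean of the first `m` terms of a sequence of samples. -/
def empMean (X : ℕ → ℝ) (m : ℕ) : ℝ := 1 / (m : ℝ) * ∑ i ∈ Finset.range m, X i

/-- The empirical variance of the first `m` terms of a sequence of samples. -/
def empVar (X : ℕ → ℝ) (m : ℕ) : ℝ :=
  1 / (m : ℝ) * ∑ i ∈ Finset.range m, (X i - empMean X m) ^ 2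

/-- The parameter `A` of MC-UCB, with `K` strata, budget `n` and confidence `δ`. -/
def ucbA (b fmax δ : ℝ) (n K : ℕ) : ℝ :=
  2 * √((1 + 3 * b + 4 * fmax ^ 2) * Real.log (2 * n * K / δ))

/-- The index `B_{k,t}` computed by MC-UCB at round `t` from the samples collected before. Here
`X k i` is the `i`-th sample (counted from `0`) obtained in stratum `k`. -/
def ucbIndex (w : ι → ℝ) (A : ℝ) (X : ι → ℕ → ℝ) (a : ℕ → ι) (k : ι) (t : ℕ) : ℝ :=
  w k / (pulls a k (t - 1) : ℝ) *
    (√(empVar (X k) (pulls a k (t - 1))) + A * √(1 / (pulls a k (t - 1) : ℝ)))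

/-- `a 1, …, a n` is a sequence of choices of strata made by MC-UCB on the samples `X`: every
stratum is sampled twice in the first `2K` rounds, and then each round chooses a stratum of maximal
index (ties being broken arbitrarily). -/
def IsMCUCBRun [Fintype ι] (w : ι → ℝ) (b fmax δ : ℝ) (n : ℕ) (X : ι → ℕ → ℝ) (a : ℕ → ι) : Prop :=
  (∀ k, pulls a k (2 * Fintype.card ι) = 2) ∧
  ∀ t, 2 * Fintype.card ι + 1 ≤ t → t ≤ n → ∀ k,
    ucbIndex w (ucbA b fmax δ n (Fintype.card ι)) X a k t ≤
      ucbIndex w (ucbA b fmax δ n (Fintype.card ι)) X a (a t) t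

end Algorithm

/-- MC-UCB with inputs `b`, `fmax`, `δ` and the strata `S`, run with budget `n` on a probability
space `(Ω, P)`. `U k i = (x, ε)` is the point and the noise of the `i`-th query of stratum `k`, which
returns `f x + s x * ε`; all the `U k i` are independent. `a t` is the stratum chosen at round `t`. -/
structure MCUCBModel {d : ℕ} {ι : Type} [Fintype ι] [DecidableEq ι] [MeasurableSpace ι]
    (f s : Space d → ℝ) (ν : Kernel (Space d) ℝ) (S : ι → Set (Space d)) (b fmax δ : ℝ) (n : ℕ)
    {Ω : Type u} [MeasurableSpace Ω] (P : Measure Ω)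
    (U : ι → ℕ → Ω → Space d × ℝ) (a : ℕ → Ω → ι) : Prop where
  isProbability : IsProbabilityMeasure P
  law : ∀ k i, HasLaw (U k i) (sampleLaw ν S k) P
  indep : iIndepFun (fun p : ι × ℕ => U p.1 p.2) P
  measurable_choice : ∀ t, Measurable (a t)
  run : ∀ᵐ ω ∂P, IsMCUCBRun (weight S) b fmax δ n
    (fun k i => f (U k i ω).1 + s (U k i ω).1 * (U k i ω).2) (fun t => a t ω)

/-- The number `⌊n^{1/(d+3α)}⌋` of strata per coordinate. -/
def sideCount (d : ℕ) (α : ℝ) (n : ℕ) : ℕ := ⌊(n : ℝ) ^ (1 / ((d : ℝ) + 3 * α))⌋₊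

/-- `max(|f(0)|, s(0)) + M d^{α/2}`, a bound on `|f|` and `s` for `(M, α)`-Hölder `f` and `s`. -/
def holderBound {d : ℕ} (f s : Space d → ℝ) (M α : ℝ) : ℝ :=
  max |f 0| (s 0) + M * (d : ℝ) ^ (α / 2)

/-- The constant `c`, where `Sig` stands for `∑_k w_k σ_k`. -/
def tradeoffConst {d : ℕ} (f s : Space d → ℝ) (M b Sig : ℝ) : ℝ :=
  70 * (1 + M) * Sig * √(1 + 3 * b + 4 * (|f 0| + s 0 + M) ^ 2) *
    ((|f 0| + s 0 + M + 4) / 4) ^ ((1 : ℝ) / 3)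

end

end StratMC

open StratMC

/-! Write `Σ = ∑ w_k σ_k`, `q = n^{-α/(d+3α)}`, and `F` for `holderBound`. The target rate is `q /
n`, and the difference splits into a bias `(Σ² - (∫ s)²) / n` and a regret `E[L_n] - Σ² / n`.

Bias. By the law of total variance, `σ_k²` is the average over the cube of `(f - μ_k)² + s²`. If `R`
bounds the oscillation of `f` and `s` in a cube, then `σ_k` lies between the average of `s` and that
average plus `R`. Hence `0 ≤ Σ - ∫ s ≤ R`, and `R` is of order `q` because the side of a cube is
about `n^{-1/(d+3α)}`.

Regret. On a fixed path, the maximal final index value is compared with the index of every stratum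
at its last pull. Summing over strata, with `∑ T_k = n`, bounds `w_k σ_k / T_k` by `(Σ + O(A c)) /
(n - 2K)`, where `c = (K / (n - 2K))^{1/3}` is of order `q` (`ratio_le_of_run`). Multiplying by `w_k
σ_k` and summing gives a regret of order `Σ A q / n`. The choice of `K` makes the two orders
`K^{-α/d}` and `(K/n)^{1/3}` agree.

Random fluctuations are treated asymmetrically. Underestimating `σ_k` must be very unlikely, as such
a stratum may keep its two initial samples only. The empirical variance is a nonnegative
U-statistic, so its lower tail is exponential under a fourth moment bound
(`measureReal_failEvent_le`). Overestimating `σ_k` only wastes samples: it is controlled in `L²`,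
uniformly over sample sizes, by a maximal inequality (`exists_dominating_overestimate`), and enters
the expected risk through a second moment. Both need `E Y⁴ ≤ 9 F² σ_k²` for the centred samples `Y`,
which follows from `E ε⁴ ≤ 2`, the second order content at `λ = 0` of the moment condition on `ε²`.

The lower bound for the absolute value is Cauchy–Schwarz: `L_n ≥ Σ² / n ≥ (∫ s)² / n` for every
allocation. -/

set_option linter.unusedSectionVars false

/-! ### Independence of functions of disjoint blocks of variables. -/

section Independence

variable {Ω : Type*} [MeasurableSpace Ω] {P : Measure Ω} {ι : Type*} {Y : ι → Ω → ℝ}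

/-- The `σ`-algebra generated by the variables `Y i`, `i ∈ S`. -/
abbrev sigmaOf (Y : ι → Ω → ℝ) (S : Set ι) : MeasurableSpace Ω :=
  ⨆ i ∈ S, MeasurableSpace.comap (Y i) inferInstance

theorem measurable_sigmaOf {S : Set ι} {i : ι} (hi : i ∈ S) : Measurable[sigmaOf Y S] (Y i) :=
  measurable_iff_comap_le.2 (le_iSup₂_of_le (f := fun j (_ : j ∈ S) =>
    MeasurableSpace.comap (Y j) inferInstance) i hi le_rfl)

theorem indepFun_of_sigmaOf (hY : iIndepFun Y P) (hm : ∀ i, Measurable (Y i)) {S T : Set ι}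
    (hST : Disjoint S T) {f g : Ω → ℝ} (hf : Measurable[sigmaOf Y S] f)
    (hg : Measurable[sigmaOf Y T] g) : IndepFun f g P := by
  have h := indep_iSup_of_disjoint (fun i => (hm i).comap_le) hY.iIndep hST
  rw [IndepFun_iff_Indep]
  exact indep_of_indep_of_le_right (indep_of_indep_of_le_left h
    (measurable_iff_comap_le.1 hf)) (measurable_iff_comap_le.1 hg)

theorem sigmaOf_le (hm : ∀ i, Measurable (Y i)) (S : Set ι) :
    sigmaOf Y S ≤ (inferInstance : MeasurableSpace Ω) :=
  iSup₂_le fun i _ => (hm i).comap_le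

theorem integral_mul_of_sigmaOf (hY : iIndepFun Y P) (hm : ∀ i, Measurable (Y i)) {S T : Set ι}
    (hST : Disjoint S T) {f g : Ω → ℝ} (hf : Measurable[sigmaOf Y S] f)
    (hg : Measurable[sigmaOf Y T] g) : ∫ ω, f ω * g ω ∂P = (∫ ω, f ω ∂P) * ∫ ω, g ω ∂P :=
  (indepFun_of_sigmaOf hY hm hST hf hg).integral_fun_mul_eq_mul_integral
    (hf.mono (sigmaOf_le hm S) le_rfl).aestronglyMeasurable
    (hg.mono (sigmaOf_le hm T) le_rfl).aestronglyMeasurable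

end Independence

/-! ### A maximal inequality for `S_t² / t`, uniform in `t`. -/

section Maximal

/-- The partial sums `x 0 + ⋯ + x (t - 1)`. -/
noncomputable def partSum (x : ℕ → ℝ) (t : ℕ) : ℝ := ∑ i ∈ Finset.range t, x i

/-- The running maximum of the absolute values of the partial sums. -/
noncomputable def runMax (x : ℕ → ℝ) : ℕ → ℝ
  | 0 => 0
  | t + 1 => max (runMax x t) |partSum x (t + 1)|

theorem runMax_nonneg (x : ℕ → ℝ) (t : ℕ) : 0 ≤ runMax x t := by
  cases t with
  | zero => exact le_rfl
  | succ t => exact (abs_nonneg _).trans (le_max_right _ _)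

theorem abs_partSum_le_runMax (x : ℕ → ℝ) (t : ℕ) : |partSum x t| ≤ runMax x t := by
  cases t with
  | zero => simp [partSum, runMax]
  | succ t => exact le_max_right _ _

theorem runMax_le_succ (x : ℕ → ℝ) (t : ℕ) : runMax x t ≤ runMax x (t + 1) := le_max_left _ _

theorem abs_add_sign_mul_le (a c : ℝ) : |a| + SignType.sign a * c ≤ |a + c| := by
  rcases lt_trichotomy a 0 with h | h | h
  · simp only [sign_neg h, abs_of_neg h]
    have := neg_abs_le (a + c)
    simp only [SignType.coe_neg_one]
    linarith
  · simp [h]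
  · simp only [sign_pos h, abs_of_pos h]
    have := le_abs_self (a + c)
    simp only [SignType.coe_one]
    linarith

/-- Summation by parts: the running maximum moves only when it equals `|partSum x (t + 1)|`, so half
the increment of its square is at most its increment times that value, while `|partSum|` grows at
least by the sign transform. -/
theorem runMax_sq_aux (x : ℕ → ℝ) (t : ℕ) :
    runMax x t ^ 2 / 2 + ∑ i ∈ Finset.range t,
      runMax x i * (SignType.sign (partSum x i) * x i) ≤ runMax x t * |partSum x t| := by
  induction t with
  | zero => simp [runMax]
  | succ t ih =>
    rw [Finset.sum_range_succ]
    have h1 : |partSum x t| + SignType.sign (partSum x t) * x t ≤ |partSum x (t + 1)| := by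
      have := abs_add_sign_mul_le (partSum x t) (x t)
      rwa [show partSum x t + x t = partSum x (t + 1) from (Finset.sum_range_succ _ _).symm] at this
    have h2 := mul_le_mul_of_nonneg_left h1 (runMax_nonneg x t)
    have h3 : (runMax x (t + 1) ^ 2 - runMax x t ^ 2) / 2 ≤
        (runMax x (t + 1) - runMax x t) * |partSum x (t + 1)| := by
      rcases le_total |partSum x (t + 1)| (runMax x t) with h | h
      · have : runMax x (t + 1) = runMax x t := max_eq_left h
        simp [this]
      · have : runMax x (t + 1) = |partSum x (t + 1)| := max_eq_right h
        rw [this]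
        nlinarith [sq_nonneg (|partSum x (t + 1)| - runMax x t)]
    nlinarith

/-- A pathwise form of Doob's `L²` maximal inequality. -/
theorem runMax_sq_le (x : ℕ → ℝ) (t : ℕ) :
    runMax x t ^ 2 ≤ 4 * partSum x t ^ 2 -
      4 * ∑ i ∈ Finset.range t, runMax x i * (SignType.sign (partSum x i) * x i) := by
  have := runMax_sq_aux x t
  have h2 := sq_abs (partSum x t)
  nlinarith [sq_nonneg (runMax x t - 2 * |partSum x t|)]

theorem sq_partSum_div_le (x : ℕ → ℝ) (t : ℕ) :
    runMax x (t + 1) ^ 2 / (t + 1 : ℕ) ≤ runMax x (t + 1) ^ 2 / (t + 1 : ℕ) +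
      ∑ i ∈ Finset.range t, runMax x (i + 1) ^ 2 * (1 / (i + 1 : ℕ) - 1 / (i + 2 : ℕ)) := by
  have : 0 ≤ ∑ i ∈ Finset.range t, runMax x (i + 1) ^ 2 *
      (1 / ((i + 1 : ℕ) : ℝ) - 1 / ((i + 2 : ℕ) : ℝ)) := by
    refine Finset.sum_nonneg fun i _ => mul_nonneg (sq_nonneg _) (sub_nonneg.2 ?_)
    exact one_div_le_one_div_of_le (by positivity) (by push_cast; linarith)
  linarith

/-- An upper bound for `S_t² / t`, `1 ≤ t ≤ m + 1`, which is linear in the squares of the running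
maxima. -/
noncomputable def weightedMax (x : ℕ → ℝ) (m : ℕ) : ℝ :=
  runMax x (m + 1) ^ 2 / (m + 1 : ℕ) +
    ∑ i ∈ Finset.range m, runMax x (i + 1) ^ 2 * (1 / (i + 1 : ℕ) - 1 / (i + 2 : ℕ))

/-- By Abel summation `weightedMax x m` is `∑ (runMax x (i+1) ^ 2 - runMax x i ^ 2) / (i+1)` over `i
≤ m`, a sum of nonnegative terms. -/
theorem weightedMax_le_succ (x : ℕ → ℝ) (m : ℕ) : weightedMax x m ≤ weightedMax x (m + 1) := by
  unfold weightedMax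
  rw [Finset.sum_range_succ]
  have h := pow_le_pow_left₀ (runMax_nonneg x _) (runMax_le_succ x (m + 1)) 2
  have : runMax x (m + 1) ^ 2 / ((m + 1 + 1 : ℕ) : ℝ) ≤
      runMax x (m + 1 + 1) ^ 2 / ((m + 1 + 1 : ℕ) : ℝ) := by gcongr
  have e : runMax x (m + 1) ^ 2 * (1 / ((m + 1 : ℕ) : ℝ) - 1 / ((m + 2 : ℕ) : ℝ)) =
     runMax x (m + 1) ^ 2 / ((m + 1 : ℕ) : ℝ) - runMax x (m + 1) ^ 2 / ((m + 1 + 1 : ℕ) : ℝ) := by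
    rw [show m + 2 = m + 1 + 1 from rfl]; ring
  rw [e]
  linarith

theorem sq_partSum_div_le_weightedMax (x : ℕ → ℝ) {t m : ℕ} (ht : 1 ≤ t) (htm : t ≤ m + 1) :
    partSum x t ^ 2 / t ≤ weightedMax x m := by
  obtain ⟨t, rfl⟩ := Nat.exists_eq_add_of_le' ht
  have h0 : partSum x (t + 1) ^ 2 / ((t + 1 : ℕ) : ℝ) ≤
      runMax x (t + 1) ^ 2 / ((t + 1 : ℕ) : ℝ) := by
    gcongr ?_ / _
    rw [← sq_abs]
    exact pow_le_pow_left₀ (abs_nonneg _) (abs_partSum_le_runMax x _) 2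
  exact (h0.trans (sq_partSum_div_le x t)).trans
    (monotone_nat_of_le_succ (weightedMax_le_succ x) (by omega : t ≤ m))

variable {Ω : Type*} [MeasurableSpace Ω] {P : Measure Ω} [IsProbabilityMeasure P]
  {x : ℕ → Ω → ℝ}

theorem measurable_partSum {m : MeasurableSpace Ω} {n : ℕ}
    (h : ∀ i < n, Measurable[m] (x i)) : Measurable[m] fun ω => partSum (fun i => x i ω) n :=
  Finset.measurable_fun_sum _ fun i hi => h i (Finset.mem_range.1 hi)

theorem measurable_runMax {m : MeasurableSpace Ω} {n : ℕ}
    (h : ∀ i < n, Measurable[m] (x i)) : Measurable[m] fun ω => runMax (fun i => x i ω) n := by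
  induction n with
  | zero => exact measurable_const
  | succ n ih =>
    have h1 := measurable_partSum h
    have h2 := ih fun i hi => h i (by omega)
    exact h2.max (measurable_norm.comp h1)

theorem measurable_sign_real : Measurable fun r : ℝ => ((SignType.sign r : SignType) : ℝ) := by
  have : (fun r : ℝ => ((SignType.sign r : SignType) : ℝ)) =
      fun r => if 0 < r then 1 else if r < 0 then -1 else 0 := by
    funext r
    rcases lt_trichotomy r 0 with h | h | h
    · simp [sign_neg h, h, h.le]
    · simp [h]
    · simp [sign_pos h, h]
  rw [this]
  exact Measurable.ite measurableSet_Ioi measurable_const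
    (Measurable.ite measurableSet_Iio measurable_const measurable_const)

variable (hx : iIndepFun x P) (hm : ∀ i, Measurable (x i)) (h2 : ∀ i, MemLp (x i) 2 P)
include hm h2

theorem memLp_partSum (t : ℕ) : MemLp (fun ω => partSum (fun i => x i ω) t) 2 P :=
  memLp_finsetSum _ fun i _ => h2 i

theorem memLp_runMax (t : ℕ) : MemLp (fun ω => runMax (fun i => x i ω) t) 2 P := by
  induction t with
  | zero => exact MemLp.zero'
  | succ t ih => exact ih.sup (memLp_partSum hm h2 (t + 1)).abs

include hx

/-- The factor in front of `x i` is a function of `x 0, …, x (i-1)`, hence independent of the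
centred variable `x i`: the correction term in `runMax_sq_le` is a martingale transform. -/
theorem integral_runMax_mul_sign (h0 : ∀ i, ∫ ω, x i ω ∂P = 0) (i : ℕ) :
    Integrable (fun ω => runMax (fun j => x j ω) i *
      (SignType.sign (partSum (fun j => x j ω) i) * x i ω)) P ∧
    ∫ ω, runMax (fun j => x j ω) i * (SignType.sign (partSum (fun j => x j ω) i) * x i ω) ∂P = 0 := by
  have hS : ∀ j < i, Measurable[sigmaOf x (Set.Iio i)] (x j) := fun j hj => measurable_sigmaOf hj
  have hf : Measurable[sigmaOf x (Set.Iio i)] fun ω => runMax (fun j => x j ω) i *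
      SignType.sign (partSum (fun j => x j ω) i) :=
    (measurable_runMax hS).mul (measurable_sign_real.comp (measurable_partSum hS))
  have hg : Measurable[sigmaOf x {i}] (x i) := measurable_sigmaOf rfl
  have hd : Disjoint (Set.Iio i) {i} := by simp
  constructor
  · have hi : Integrable (fun ω => runMax (fun j => x j ω) i * |x i ω|) P :=
      (memLp_runMax hm h2 i).integrable_mul (h2 i).abs
    refine hi.mono ?_ (.of_forall fun ω => ?_)
    · exact ((measurable_runMax fun j _ => hm j).mul ((measurable_sign_real.comp
        (measurable_partSum fun j _ => hm j)).mul (hm i))).aestronglyMeasurable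
    · simp only [norm_mul, Real.norm_eq_abs, abs_abs]
      have : |((SignType.sign (partSum (fun j => x j ω) i) : SignType) : ℝ)| ≤ 1 := by
        rcases (SignType.sign (partSum (fun j => x j ω) i)) <;> simp
      gcongr
      nlinarith [abs_nonneg (x i ω)]
  · simp only [← mul_assoc]
    rw [integral_mul_of_sigmaOf hx hm hd hf hg, h0, mul_zero]

theorem integral_sq_partSum {v : ℝ} (h0 : ∀ i, ∫ ω, x i ω ∂P = 0)
    (hv : ∀ i, ∫ ω, x i ω ^ 2 ∂P ≤ v) (t : ℕ) :
    ∫ ω, partSum (fun i => x i ω) t ^ 2 ∂P ≤ t * v := by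
  induction t with
  | zero => simp [partSum]
  | succ t ih =>
    have e : ∀ ω, partSum (fun i => x i ω) (t + 1) ^ 2 =
        partSum (fun i => x i ω) t ^ 2 + (2 * (partSum (fun i => x i ω) t * x t ω) + x t ω ^ 2) := by
      intro ω
      rw [show partSum (fun i => x i ω) (t + 1) = partSum (fun i => x i ω) t + x t ω from
        Finset.sum_range_succ _ _]
      ring
    have hi : Integrable (fun ω => partSum (fun i => x i ω) t * x t ω) P :=
      (memLp_partSum hm h2 t).integrable_mul (h2 t)
    have hz : ∫ ω, partSum (fun i => x i ω) t * x t ω ∂P = 0 := by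
      rw [integral_mul_of_sigmaOf (S := Set.Iio t) (T := {t}) hx hm (by simp)
        (measurable_partSum fun j hj => measurable_sigmaOf hj) (measurable_sigmaOf rfl), h0, mul_zero]
    simp only [e]
    rw [integral_add (f := fun ω => partSum (fun i => x i ω) t ^ 2)
        (g := fun ω => 2 * (partSum (fun i => x i ω) t * x t ω) + x t ω ^ 2)
        (memLp_partSum hm h2 t).integrable_sq ((hi.const_mul 2).add (h2 t).integrable_sq),
      integral_add (f := fun ω => 2 * (partSum (fun i => x i ω) t * x t ω)) (hi.const_mul 2)
        (h2 t).integrable_sq, integral_const_mul, hz]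
    have := hv t
    push_cast
    linarith

/-- Doob's `L²` maximal inequality for sums of independent centred variables. -/
theorem integral_sq_runMax {v : ℝ} (h0 : ∀ i, ∫ ω, x i ω ∂P = 0)
    (hv : ∀ i, ∫ ω, x i ω ^ 2 ∂P ≤ v) (t : ℕ) :
    ∫ ω, runMax (fun i => x i ω) t ^ 2 ∂P ≤ 4 * (t * v) := by
  have hI := fun i => integral_runMax_mul_sign hx hm h2 h0 i
  have hs := integrable_finsetSum (Finset.range t) fun i _ => (hI i).1
  calc ∫ ω, runMax (fun i => x i ω) t ^ 2 ∂P
      ≤ ∫ ω, (4 * partSum (fun i => x i ω) t ^ 2 - 4 * ∑ i ∈ Finset.range t,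
        runMax (fun j => x j ω) i * (SignType.sign (partSum (fun j => x j ω) i) * x i ω)) ∂P :=
        integral_mono (memLp_runMax hm h2 t).integrable_sq
          (((memLp_partSum hm h2 t).integrable_sq.const_mul 4).sub (hs.const_mul 4))
          fun ω => runMax_sq_le _ t
    _ = 4 * ∫ ω, partSum (fun i => x i ω) t ^ 2 ∂P := by
        rw [integral_sub ((memLp_partSum hm h2 t).integrable_sq.const_mul 4) (hs.const_mul 4),
          integral_const_mul, integral_const_mul, integral_finsetSum _ fun i _ => (hI i).1]
        simp [fun i => (hI i).2]
    _ ≤ 4 * (t * v) := by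
        have := integral_sq_partSum hx hm h2 h0 hv t
        linarith

theorem integrable_weightedMax (m : ℕ) :
    Integrable (fun ω => weightedMax (fun i => x i ω) m) P :=
  ((memLp_runMax hm h2 _).integrable_sq.div_const _).add
    (integrable_finsetSum _ fun _ _ => (memLp_runMax hm h2 _).integrable_sq.mul_const _)

/-- Doob's bound `4 (i+1) v` against the weight `1 / ((i+1)(i+2))` leaves `4 v / (i+2)`, a harmonic
sum. Uniformity over the sample size thus costs only a logarithm. -/
theorem integral_weightedMax_le {v : ℝ} (h0 : ∀ i, ∫ ω, x i ω ∂P = 0)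
    (hv : ∀ i, ∫ ω, x i ω ^ 2 ∂P ≤ v) (m : ℕ) :
    ∫ ω, weightedMax (fun i => x i ω) m ∂P ≤ 4 * v * (1 + Real.log (m + 1 : ℕ)) := by
  have hv0 : 0 ≤ v := (integral_nonneg fun ω => sq_nonneg _).trans (hv 0)
  have hd := integral_sq_runMax hx hm h2 h0 hv
  unfold weightedMax
  rw [integral_add ((memLp_runMax hm h2 _).integrable_sq.div_const _)
    (integrable_finsetSum _ fun _ _ => (memLp_runMax hm h2 _).integrable_sq.mul_const _),
    integral_finsetSum _ fun _ _ => (memLp_runMax hm h2 _).integrable_sq.mul_const _,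
    integral_div]
  simp only [integral_mul_const]
  have h1 : (∫ ω, runMax (fun i => x i ω) (m + 1) ^ 2 ∂P) / ((m + 1 : ℕ) : ℝ) ≤ 4 * v := by
    rw [div_le_iff₀ (by positivity)]
    linarith [hd (m + 1)]
  have h3 : ∀ i ∈ Finset.range m, (∫ ω, runMax (fun i => x i ω) (i + 1) ^ 2 ∂P) *
      (1 / ((i + 1 : ℕ) : ℝ) - 1 / ((i + 2 : ℕ) : ℝ)) ≤ 4 * v * (1 / ((i + 2 : ℕ) : ℝ)) := by
    intro i _
    have e : (1 / ((i + 1 : ℕ) : ℝ) - 1 / ((i + 2 : ℕ) : ℝ)) =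
        (1 / ((i + 1 : ℕ) : ℝ)) * (1 / ((i + 2 : ℕ) : ℝ)) := by
      push_cast
      field_simp
      ring
    rw [e]
    calc _ ≤ (4 * (((i + 1 : ℕ) : ℝ) * v)) * ((1 / ((i + 1 : ℕ) : ℝ)) * (1 / ((i + 2 : ℕ) : ℝ))) := by
          gcongr
          exact hd (i + 1)
      _ = _ := by
          push_cast
          field_simp
  have h4 := Finset.sum_le_sum h3
  rw [← Finset.mul_sum] at h4
  have h5 : 1 + ∑ i ∈ Finset.range m, (1 / ((i + 2 : ℕ) : ℝ)) ≤ 1 + Real.log (m + 1 : ℕ) := by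
    have := harmonic_le_one_add_log (m + 1)
    rw [harmonic, Finset.sum_range_succ'] at this
    push_cast at this ⊢
    simp only [one_div]
    have e : ∀ i : ℕ, ((i : ℝ) + 1 + 1)⁻¹ = ((i : ℝ) + 2)⁻¹ := fun i => by ring_nf
    simp only [e] at this
    norm_num at this
    linarith
  have h6 := mul_le_mul_of_nonneg_left h5 (by positivity : 0 ≤ 4 * v)
  linarith

end Maximal

/-! ### The empirical variance as an average of sums over disjoint pairs. -/

section EmpiricalVariance

theorem empVar_nonneg (X : ℕ → ℝ) (m : ℕ) : 0 ≤ empVar X m :=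
  mul_nonneg (by positivity) (Finset.sum_nonneg fun _ _ => sq_nonneg _)

theorem empVar_sub_const (X : ℕ → ℝ) (c : ℝ) {m : ℕ} (hm : m ≠ 0) :
    empVar (fun i => X i - c) m = empVar X m := by
  have : empMean (fun i => X i - c) m = empMean X m - c := by
    have : (m : ℝ) ≠ 0 := by exact_mod_cast hm
    unfold empMean
    rw [Finset.sum_sub_distrib]
    simp
    field_simp
  unfold empVar
  rw [this]
  simp

theorem empVar_eq_sub (X : ℕ → ℝ) {m : ℕ} (hm : m ≠ 0) :
    empVar X m = 1 / (m : ℝ) * ∑ i ∈ Finset.range m, X i ^ 2 - empMean X m ^ 2 := by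
  have hm' : (m : ℝ) ≠ 0 := by exact_mod_cast hm
  have e : ∑ i ∈ Finset.range m, X i = m * empMean X m := by
    unfold empMean; field_simp
  unfold empVar
  simp only [sub_sq]
  rw [Finset.sum_add_distrib, Finset.sum_sub_distrib, ← Finset.sum_mul, ← Finset.mul_sum, e]
  simp
  field_simp
  ring

theorem empVar_le (X : ℕ → ℝ) {m : ℕ} (hm : m ≠ 0) :
    empVar X m ≤ 1 / (m : ℝ) * ∑ i ∈ Finset.range m, X i ^ 2 := by
  rw [empVar_eq_sub X hm]
  linarith [sq_nonneg (empMean X m)]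

/-- The empirical variance is `1 / (2 m²)` times the sum of all squared differences. Substituting `j
= c - i` in the cyclic group `Fin m` groups them by `c = i + j`; for fixed `c` the map `i ↦ c - i`
is an involution, so the pairs of a group are disjoint. -/
theorem empVar_eq_pairs (X : ℕ → ℝ) {m : ℕ} [NeZero m] :
    empVar X m = ∑ c : Fin m, (1 / (m : ℝ)) *
      (1 / (2 * (m : ℝ)) * ∑ i : Fin m, (X i - X (c - i : Fin m)) ^ 2) := by
  have hm' : (m : ℝ) ≠ 0 := by exact_mod_cast (NeZero.ne m)
  rw [empVar_eq_sub X (NeZero.ne m), ← Finset.mul_sum, ← Finset.mul_sum, Finset.sum_comm]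
  have h1 : ∀ i : Fin m, ∑ c : Fin m, (X i - X (c - i : Fin m)) ^ 2 =
      ∑ j : Fin m, (X i - X j) ^ 2 := fun i =>
    (Equiv.subRight i).sum_comp fun j : Fin m => (X i - X j) ^ 2
  simp only [h1]
  unfold empMean
  rw [← Fin.sum_univ_eq_sum_range X, ← Fin.sum_univ_eq_sum_range (fun i => X i ^ 2)]
  simp only [sub_sq, Finset.sum_add_distrib, Finset.sum_sub_distrib, ← Finset.mul_sum,
    ← Finset.sum_mul]
  have h2 : ∑ i : Fin m, (m : ℝ) * X i ^ 2 = m * ∑ i : Fin m, X i ^ 2 := (Finset.mul_sum ..).symm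
  simp
  field_simp
  linear_combination -h2

/-- The pairs `i, c - i` of elements of `Fin m` with sum `c`, represented by their smaller
elements. -/
def sumPairs {m : ℕ} [NeZero m] (c : Fin m) : Finset (Fin m) :=
  Finset.univ.filter fun i => i < c - i

/-- The involution `i ↦ c - i` has at most two fixed points, as `2 i = c` has at most two solutions
modulo `m`. -/
theorem card_sumPairs {m : ℕ} [NeZero m] (c : Fin m) : m ≤ 2 * (sumPairs c).card + 2 := by
  have hrefl : (Finset.univ.filter fun i : Fin m => c - i < i).card = (sumPairs c).card := by
    refine Finset.card_bij' (fun i _ => c - i) (fun i _ => c - i) ?_ ?_ ?_ ?_ <;>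
      simp [sumPairs]
  have hfix : (Finset.univ.filter fun i : Fin m => c - i = i).card ≤ 2 := by
    have : (Finset.univ.filter fun i : Fin m => c - i = i).card ≤ (Finset.range 2).card := by
      -- As integers, a fixed point satisfies `2 i = c` or `2 i = c + m`; the label records which.
      refine Finset.card_le_card_of_injOn (fun i => if 2 * (i : ℕ) < m then 0 else 1) ?_ ?_
      · intro i _
        simp only [Finset.coe_range, Set.mem_Iio]
        split_ifs <;> simp
      · intro i hi j hj hij
        have key : ∀ i : Fin m, c - i = i → (2 * (i : ℕ)) % m = c := by
          intro i h
          rw [sub_eq_iff_eq_add] at h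
          rw [h, Fin.val_add, two_mul]
        simp only [Finset.coe_filter, Finset.mem_univ, true_and, Set.mem_ofPred_eq] at hi hj
        have h1 := key i hi
        have h2 := key j hj
        have hi2 := i.2
        have hj2 := j.2
        have hlt : ∀ i : Fin m, ¬ 2 * (i : ℕ) < m → (2 * (i : ℕ)) % m = 2 * i - m := by
          intro i h
          rw [Nat.mod_eq_sub_mod (by omega), Nat.mod_eq_of_lt (by omega)]
        ext
        dsimp only at hij
        by_cases ha : 2 * (i : ℕ) < m <;> by_cases hb : 2 * (j : ℕ) < m
        · rw [Nat.mod_eq_of_lt ha] at h1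
          rw [Nat.mod_eq_of_lt hb] at h2
          omega
        · simp [ha, hb] at hij
        · simp [ha, hb] at hij
        · rw [hlt i ha] at h1
          rw [hlt j hb] at h2
          omega
    simpa using this
  have hcov : (Finset.univ : Finset (Fin m)) = sumPairs c ∪
      ((Finset.univ.filter fun i : Fin m => c - i < i) ∪
        Finset.univ.filter fun i : Fin m => c - i = i) := by
    ext i
    rcases lt_trichotomy i (c - i) with h | h | h
    · simp [sumPairs, h]
    · simp [← h]
    · simp [h]
  have := congrArg Finset.card hcov
  rw [Finset.card_univ, Fintype.card_fin] at this
  have h1 := Finset.card_union_le (sumPairs c) ((Finset.univ.filter fun i : Fin m => c - i < i) ∪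
        Finset.univ.filter fun i : Fin m => c - i = i)
  have h2 := Finset.card_union_le (Finset.univ.filter fun i : Fin m => c - i < i)
        (Finset.univ.filter fun i : Fin m => c - i = i)
  omega

theorem sum_sumPairs_le (X : ℕ → ℝ) {m : ℕ} [NeZero m] (c : Fin m) :
    2 * ∑ i ∈ sumPairs c, (X i - X (c - i : Fin m)) ^ 2 ≤
      ∑ i : Fin m, (X i - X (c - i : Fin m)) ^ 2 := by
  have hrefl : ∑ i ∈ Finset.univ.filter (fun i : Fin m => c - i < i),
      (X i - X (c - i : Fin m)) ^ 2 = ∑ i ∈ sumPairs c, (X i - X (c - i : Fin m)) ^ 2 := by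
    refine Finset.sum_bij' (fun i _ => c - i) (fun i _ => c - i) ?_ ?_ ?_ ?_ ?_ <;>
      simp [sumPairs]
    intro i _
    ring
  have hd : Disjoint (sumPairs c) (Finset.univ.filter fun i : Fin m => c - i < i) := by
    rw [Finset.disjoint_left]
    intro i hi hj
    simp only [sumPairs, Finset.mem_filter, Finset.mem_univ, true_and] at hi hj
    exact lt_asymm hi hj
  calc _ = ∑ i ∈ sumPairs c ∪ Finset.univ.filter (fun i : Fin m => c - i < i),
      (X i - X (c - i : Fin m)) ^ 2 := by
        rw [Finset.sum_union hd, hrefl]; ring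
    _ ≤ _ := Finset.sum_le_sum_of_subset_of_nonneg (Finset.subset_univ _)
        fun _ _ _ => sq_nonneg _

/-- Hoeffding's device for U-statistics: Jensen's inequality moves the average over `c` outside the
exponential, and each remaining product has independent factors when the `X i` are independent. The
scaling `θ m / 2` makes every pair appear with parameter `θ`. -/
theorem exp_neg_empVar_le (X : ℕ → ℝ) {m : ℕ} [NeZero m] {θ : ℝ} (hθ : 0 ≤ θ) :
    Real.exp (-(θ * m / 2) * empVar X m) ≤ ∑ c : Fin m, (1 / (m : ℝ)) *
      ∏ i ∈ sumPairs c, Real.exp (-θ * ((X i - X (c - i : Fin m)) ^ 2 / 2)) := by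
  have hm' : (m : ℝ) ≠ 0 := by exact_mod_cast (NeZero.ne m)
  have hmp : (0 : ℝ) < m := by positivity
  have hj := convexOn_exp.map_sum_le (t := Finset.univ) (w := fun _ : Fin m => 1 / (m : ℝ))
    (p := fun c : Fin m => -(θ * m / 2) *
      (1 / (2 * (m : ℝ)) * ∑ i : Fin m, (X i - X (c - i : Fin m)) ^ 2))
    (fun _ _ => by positivity) (by simp [hm']) (fun _ _ => Set.mem_univ _)
  simp only [smul_eq_mul] at hj
  have e : ∑ c : Fin m, (1 / (m : ℝ)) * (-(θ * m / 2) *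
      (1 / (2 * (m : ℝ)) * ∑ i : Fin m, (X i - X (c - i : Fin m)) ^ 2)) =
      -(θ * m / 2) * empVar X m := by
    rw [empVar_eq_pairs X, Finset.mul_sum]
    exact Finset.sum_congr rfl fun _ _ => by ring
  rw [e] at hj
  refine hj.trans (Finset.sum_le_sum fun c _ => ?_)
  rw [← Real.exp_sum]
  refine mul_le_mul_of_nonneg_left (Real.exp_le_exp.2 ?_) (by positivity)
  rw [← Finset.mul_sum, ← Finset.sum_div]
  have := sum_sumPairs_le X c
  have e2 : -(θ * m / 2) * (1 / (2 * (m : ℝ)) * ∑ i : Fin m, (X i - X (c - i : Fin m)) ^ 2) =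
     -θ / 4 * ∑ i : Fin m, (X i - X (c - i : Fin m)) ^ 2 := by
    field_simp
    ring
  rw [e2]
  nlinarith

end EmpiricalVariance

/-! ### Chernoff bound for the lower tail of the empirical variance. -/

section LowerTail

theorem exp_neg_le_quadratic_half {y : ℝ} (hy : 0 ≤ y) :
    Real.exp (-y) ≤ 1 - 1 * y + 1 / 2 * y ^ 2 := by
  have h1 := Real.sum_le_exp_of_nonneg hy 4
  simp only [Finset.sum_range_succ, Finset.sum_range_zero, Nat.factorial] at h1
  rw [Real.exp_neg]
  refine inv_le_of_inv_le₀ (by nlinarith [sq_nonneg (y - 1)]) ?_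
  refine le_trans ?_ h1
  rw [inv_le_iff_one_le_mul₀ (by nlinarith [sq_nonneg (y - 1)])]
  norm_num
  nlinarith [pow_nonneg hy 3, pow_nonneg hy 4, pow_nonneg hy 5]

/-- A smaller quadratic coefficient, paid for in the linear one: this variant serves the large
deviations, `exp_neg_le_quadratic_half` the small ones. Both compare the reciprocal with the cubic
Taylor polynomial of `exp y`. -/
theorem exp_neg_le_quadratic_sixth {y : ℝ} (hy : 0 ≤ y) :
    Real.exp (-y) ≤ 1 - 3 / 4 * y + 1 / 6 * y ^ 2 := by
  have h1 := Real.sum_le_exp_of_nonneg hy 4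
  simp only [Finset.sum_range_succ, Finset.sum_range_zero, Nat.factorial] at h1
  have h0 : 0 < 1 - 3 / 4 * y + 1 / 6 * y ^ 2 := by nlinarith [sq_nonneg (y - 9 / 4)]
  rw [Real.exp_neg]
  refine inv_le_of_inv_le₀ h0 ?_
  refine le_trans ?_ h1
  rw [inv_le_iff_one_le_mul₀ h0]
  norm_num
  have : 0 ≤ y * (1 / 4 - 1 / 12 * y - 1 / 24 * y ^ 2 - 1 / 24 * y ^ 3 + 1 / 36 * y ^ 4) := by
    refine mul_nonneg hy ?_
    nlinarith [sq_nonneg (y ^ 2 - 3 / 4 * y - 29 / 16), sq_nonneg (y - 9 / 5), sq_nonneg y]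
  nlinarith

theorem measurable_empVar {Ω : Type*} [MeasurableSpace Ω] {Y : ℕ → Ω → ℝ}
    (hm : ∀ i, Measurable (Y i)) (t : ℕ) :
    Measurable fun ω => empVar (fun i => Y i ω) t := by
  unfold empVar empMean
  fun_prop

theorem integrable_prod_exp_neg_sq_diff {Ω : Type*} [MeasurableSpace Ω] {P : Measure Ω}
    [IsProbabilityMeasure P] {Y : ℕ → Ω → ℝ} (hm : ∀ i, Measurable (Y i)) {θ : ℝ} (hθ : 0 ≤ θ)
    {κ : Type*} (f g : κ → ℕ) (H : Finset κ) :
    Integrable (fun ω => ∏ i ∈ H, Real.exp (-θ * ((Y (f i) ω - Y (g i) ω) ^ 2 / 2))) P := by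
  have hmeas : Measurable fun ω =>
      ∏ i ∈ H, Real.exp (-θ * ((Y (f i) ω - Y (g i) ω) ^ 2 / 2)) :=
    Finset.measurable_fun_prod _ fun i _ => by fun_prop
  refine Integrable.of_bound (C := 1) hmeas.aestronglyMeasurable (.of_forall fun ω => ?_)
  rw [Real.norm_of_nonneg (Finset.prod_nonneg fun _ _ => (Real.exp_pos _).le)]
  refine Finset.prod_le_one (fun _ _ => (Real.exp_pos _).le) fun i _ => ?_
  rw [Real.exp_le_one_iff]
  have : 0 ≤ θ * ((Y (f i) ω - Y (g i) ω) ^ 2 / 2) := by positivity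
  linarith

theorem integrable_pow_of_memLp_four {Ω : Type*} [MeasurableSpace Ω] {P : Measure Ω}
    [IsProbabilityMeasure P] {X : Ω → ℝ} (h : MemLp X 4 P) {p : ℕ} (hp : p ≤ 4) :
    Integrable (fun ω => X ω ^ p) P := by
  have := (h.mono_exponent (p := (p : ENNReal)) (by exact_mod_cast hp)).integrable_norm_pow'
  refine this.mono (h.1.pow p) (.of_forall fun ω => ?_)
  simp

variable {Ω : Type*} [MeasurableSpace Ω] {P : Measure Ω} [IsProbabilityMeasure P]
  {Y : ℕ → Ω → ℝ} {s2 V : ℝ}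
  (hY : iIndepFun Y P) (hm : ∀ i, Measurable (Y i)) (h4 : ∀ i, MemLp (Y i) 4 P)
  (hE : ∀ i, ∫ ω, Y i ω ∂P = 0) (hE2 : ∀ i, ∫ ω, Y i ω ^ 2 ∂P = s2)
  (hE4 : ∀ i, (∫ ω, Y i ω ^ 4 ∂P) + 3 * s2 ^ 2 ≤ 2 * V)
include hY hm h4 hE hE2 

theorem integral_sq_diff {i j : ℕ} (hij : i ≠ j) : ∫ ω, (Y i ω - Y j ω) ^ 2 / 2 ∂P = s2 := by
  have hI := fun i (p : ℕ) (hp : p ≤ 4) => integrable_pow_of_memLp_four (h4 i) hp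
  have hind : ∀ p q : ℕ, IndepFun (fun ω => Y i ω ^ p) (fun ω => Y j ω ^ q) P := fun p q =>
    (hY.indepFun hij).comp (measurable_id.pow_const p) (measurable_id.pow_const q)
  have hp : Integrable (fun ω => Y i ω ^ 1 * Y j ω ^ 1) P :=
    (hind 1 1).integrable_mul (hI i 1 (by norm_num)) (hI j 1 (by norm_num))
  have hz : ∫ ω, Y i ω ^ 1 * Y j ω ^ 1 ∂P = 0 := by
    rw [(hind 1 1).integral_fun_mul_eq_mul_integral (hI i 1 (by norm_num)).1
      (hI j 1 (by norm_num)).1]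
    simp [hE]
  have e : ∀ ω, (Y i ω - Y j ω) ^ 2 / 2 =
      1 / 2 * Y i ω ^ 2 + 1 / 2 * Y j ω ^ 2 - Y i ω ^ 1 * Y j ω ^ 1 := fun ω => by ring
  simp only [e]
  have a := (hI i 2 (by norm_num)).const_mul (1 / 2)
  have b := (hI j 2 (by norm_num)).const_mul (1 / 2)
  rw [integral_sub (f := fun ω => 1 / 2 * Y i ω ^ 2 + 1 / 2 * Y j ω ^ 2) (a.add b) hp,
    integral_add a b, integral_const_mul, integral_const_mul, hz, hE2, hE2]
  ring

theorem integral_pow_four_diff {i j : ℕ} (hij : i ≠ j) :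
    Integrable (fun ω => ((Y i ω - Y j ω) ^ 2 / 2) ^ 2) P ∧
    ∫ ω, ((Y i ω - Y j ω) ^ 2 / 2) ^ 2 ∂P =
      (∫ ω, Y i ω ^ 4 ∂P) / 4 + (∫ ω, Y j ω ^ 4 ∂P) / 4 + 3 / 2 * s2 ^ 2 := by
  have hI := fun i (p : ℕ) (hp : p ≤ 4) => integrable_pow_of_memLp_four (h4 i) hp
  have hind : ∀ p q : ℕ, IndepFun (fun ω => Y i ω ^ p) (fun ω => Y j ω ^ q) P := fun p q =>
    (hY.indepFun hij).comp (measurable_id.pow_const p) (measurable_id.pow_const q)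
  have hp : ∀ p q : ℕ, p ≤ 4 → q ≤ 4 → Integrable (fun ω => Y i ω ^ p * Y j ω ^ q) P :=
    fun p q h1 h2 => (hind p q).integrable_mul (hI i p h1) (hI j q h2)
  have hz : ∀ p q : ℕ, p ≤ 4 → q ≤ 4 →
      ∫ ω, Y i ω ^ p * Y j ω ^ q ∂P = (∫ ω, Y i ω ^ p ∂P) * ∫ ω, Y j ω ^ q ∂P :=
    fun p q h1 h2 => (hind p q).integral_fun_mul_eq_mul_integral (hI i p h1).1 (hI j q h2).1
  have e : ∀ ω, ((Y i ω - Y j ω) ^ 2 / 2) ^ 2 =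
      1 / 4 * (Y i ω ^ 4 * Y j ω ^ 0) - Y i ω ^ 3 * Y j ω ^ 1 + 3 / 2 * (Y i ω ^ 2 * Y j ω ^ 2)
        - Y i ω ^ 1 * Y j ω ^ 3 + 1 / 4 * (Y i ω ^ 0 * Y j ω ^ 4) := fun ω => by ring
  have i1 := (hp 4 0 (by norm_num) (by norm_num)).const_mul (1 / 4)
  have i2 := i1.sub (hp 3 1 (by norm_num) (by norm_num))
  have i3 := i2.add ((hp 2 2 (by norm_num) (by norm_num)).const_mul (3 / 2))
  have i4 := i3.sub (hp 1 3 (by norm_num) (by norm_num))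
  have i5' := (hp 0 4 (by norm_num) (by norm_num)).const_mul (1 / 4)
  have i5 := i4.add i5'
  simp only [e]
  refine ⟨i5, ?_⟩
  refine (integral_add' i4 i5').trans ?_
  rw [integral_sub' i3 (hp 1 3 (by norm_num) (by norm_num)),
    integral_add' i2 ((hp 2 2 (by norm_num) (by norm_num)).const_mul (3 / 2)),
    integral_sub' i1 (hp 3 1 (by norm_num) (by norm_num)), integral_const_mul, integral_const_mul,
    integral_const_mul, hz 4 0 (by norm_num) (by norm_num), hz 3 1 (by norm_num) (by norm_num),
    hz 2 2 (by norm_num) (by norm_num), hz 1 3 (by norm_num) (by norm_num),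
    hz 0 4 (by norm_num) (by norm_num)]
  simp [hE, hE2]
  ring

include hE4

/-- The variable `(Y i - Y j) ^ 2 / 2` is nonnegative with mean `s2`, and `hE4` says exactly that
its second moment is at most `V`. For a nonnegative variable two moments suffice to bound the
Laplace transform. -/
theorem integral_exp_neg_sq_diff {α β θ : ℝ} (hβ : 0 ≤ β) (hθ : 0 ≤ θ)
    (hq : ∀ y : ℝ, 0 ≤ y → Real.exp (-y) ≤ 1 - α * y + β * y ^ 2) {i j : ℕ} (hij : i ≠ j) :
    ∫ ω, Real.exp (-θ * ((Y i ω - Y j ω) ^ 2 / 2)) ∂P ≤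
      Real.exp (-(α * θ * s2 - β * θ ^ 2 * V)) := by
  have h1 := integral_sq_diff hY hm h4 hE hE2 hij
  obtain ⟨hi, h2⟩ := integral_pow_four_diff hY hm h4 hE hE2 hij
  have hd : MemLp (fun ω => Y i ω - Y j ω) 4 P := (h4 i).sub (h4 j)
  have hi1 : Integrable (fun ω => (Y i ω - Y j ω) ^ 2 / 2) P :=
    (integrable_pow_of_memLp_four hd (by norm_num)).div_const 2
  have a := (integrable_const (1 : ℝ)).sub (hi1.const_mul (α * θ))
  have b := hi.const_mul (β * θ ^ 2)
  calc _ ≤ ∫ ω, (1 - α * θ * ((Y i ω - Y j ω) ^ 2 / 2) +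
        β * θ ^ 2 * ((Y i ω - Y j ω) ^ 2 / 2) ^ 2) ∂P := by
        refine integral_mono_of_nonneg (.of_forall fun ω => (Real.exp_pos _).le) (a.add b)
          (.of_forall fun ω => ?_)
        have := hq (θ * ((Y i ω - Y j ω) ^ 2 / 2)) (by positivity)
        dsimp only
        rw [neg_mul]
        linarith
    _ = 1 - α * θ * s2 + β * θ ^ 2 * ((∫ ω, Y i ω ^ 4 ∂P) / 4 + (∫ ω, Y j ω ^ 4 ∂P) / 4
          + 3 / 2 * s2 ^ 2) := by
        rw [integral_add (f := fun ω => 1 - α * θ * ((Y i ω - Y j ω) ^ 2 / 2)) a b,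
          integral_sub (integrable_const _) (hi1.const_mul (α * θ)), integral_const_mul,
          integral_const_mul, h1, h2]
        simp
    _ ≤ 1 - α * θ * s2 + β * θ ^ 2 * V := by
        have h3 := hE4 i
        have h5 := hE4 j
        gcongr
        linarith
    _ ≤ _ := by
        have := Real.add_one_le_exp (-(α * θ * s2 - β * θ ^ 2 * V))
        linarith

/-- Distinct factors involve disjoint sets of indices, so the expectation factorises by peeling off
one pair at a time. -/
theorem integral_prod_exp_neg_sq_diff {α β θ : ℝ} (hβ : 0 ≤ β) (hθ : 0 ≤ θ)
    (hq : ∀ y : ℝ, 0 ≤ y → Real.exp (-y) ≤ 1 - α * y + β * y ^ 2) {κ : Type*} [DecidableEq κ]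
    (f g : κ → ℕ) (hf : f.Injective) (hg : g.Injective) (H : Finset κ)
    (hfg : ∀ i ∈ H, ∀ j ∈ H, f i ≠ g j) :
    ∫ ω, ∏ i ∈ H, Real.exp (-θ * ((Y (f i) ω - Y (g i) ω) ^ 2 / 2)) ∂P ≤
      Real.exp (-(α * θ * s2 - β * θ ^ 2 * V)) ^ H.card := by
  induction H using Finset.induction_on with
  | empty => simp
  | insert a H ha ih =>
    simp only [Finset.prod_insert ha]
    have hS : ∀ i j : ℕ, ∀ S : Set ℕ, i ∈ S → j ∈ S → Measurable[sigmaOf Y S] fun ω =>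
        Real.exp (-θ * ((Y i ω - Y j ω) ^ 2 / 2)) := fun i j S hi hj =>
      Real.measurable_exp.comp (((((measurable_sigmaOf hi).sub
        (measurable_sigmaOf hj)).pow_const 2).div_const 2).const_mul (-θ))
    have hd : Disjoint ({f a, g a} : Set ℕ) (f '' H ∪ g '' H) := by
      rw [Set.disjoint_left]
      rintro x (rfl | rfl) (⟨y, hy, hxy⟩ | ⟨y, hy, hxy⟩)
      · exact ha (hf hxy ▸ hy)
      · exact hfg a (Finset.mem_insert_self _ _) y (Finset.mem_insert_of_mem hy) hxy.symm
      · exact hfg y (Finset.mem_insert_of_mem hy) a (Finset.mem_insert_self _ _) hxy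
      · exact ha (hg hxy ▸ hy)
    rw [integral_mul_of_sigmaOf hY hm hd (hS _ _ _ (by simp) (by simp))
      (Finset.measurable_fun_prod _ fun i hi => hS _ _ _ (Or.inl ⟨i, hi, rfl⟩)
        (Or.inr ⟨i, hi, rfl⟩)), Finset.card_insert_of_notMem ha, pow_succ']
    refine mul_le_mul (integral_exp_neg_sq_diff hY hm h4 hE hE2 hE4 hβ hθ hq
        (hfg a (Finset.mem_insert_self _ _) a (Finset.mem_insert_self _ _))) ?_ ?_ (Real.exp_pos _).le
    · exact ih fun i hi j hj => hfg i (Finset.mem_insert_of_mem hi) j (Finset.mem_insert_of_mem hj)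
    · exact integral_nonneg fun ω => Finset.prod_nonneg fun i _ => (Real.exp_pos _).le

theorem integral_prod_sumPairs {α β θ : ℝ} (hβ : 0 ≤ β) (hθ : 0 ≤ θ)
    (hq : ∀ y : ℝ, 0 ≤ y → Real.exp (-y) ≤ 1 - α * y + β * y ^ 2)
    (hB : 0 ≤ α * θ * s2 - β * θ ^ 2 * V) {t : ℕ} [NeZero t] (c : Fin t) :
    ∫ ω, ∏ i ∈ sumPairs c, Real.exp (-θ * ((Y i ω - Y (c - i : Fin t) ω) ^ 2 / 2)) ∂P ≤
      Real.exp (-(α * θ * s2 - β * θ ^ 2 * V) * ((t : ℝ) - 2) / 2) := by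
  have hfg : ∀ i ∈ sumPairs c, ∀ j ∈ sumPairs c, (i : ℕ) ≠ ((c - j : Fin t) : ℕ) := by
    intro i hi j hj h
    simp only [sumPairs, Finset.mem_filter, Finset.mem_univ, true_and] at hi hj
    have h' : i = c - j := Fin.val_injective h
    have : c - i = j := by rw [h', sub_sub_cancel]
    rw [this] at hi
    rw [← h'] at hj
    exact lt_asymm hi hj
  have hinj : Function.Injective fun i : Fin t => ((c - i : Fin t) : ℕ) := fun i j h =>
    sub_right_injective (Fin.val_injective h)
  have h1 := integral_prod_exp_neg_sq_diff hY hm h4 hE hE2 hE4 hβ hθ hq (fun i : Fin t => (i : ℕ))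
    (fun i : Fin t => ((c - i : Fin t) : ℕ)) Fin.val_injective hinj (sumPairs c) hfg
  refine h1.trans ?_
  rw [← Real.exp_nat_mul, Real.exp_le_exp]
  have : ((t : ℝ) - 2) / 2 ≤ (sumPairs c).card := by
    have h : (t : ℝ) ≤ 2 * (sumPairs c).card + 2 := by exact_mod_cast card_sumPairs c
    linarith
  nlinarith

theorem integral_exp_neg_empVar {α β θ : ℝ} (hβ : 0 ≤ β) (hθ : 0 ≤ θ)
    (hq : ∀ y : ℝ, 0 ≤ y → Real.exp (-y) ≤ 1 - α * y + β * y ^ 2)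
    (hB : 0 ≤ α * θ * s2 - β * θ ^ 2 * V) {t : ℕ} [NeZero t] :
    ∫ ω, Real.exp (-(θ * t / 2) * empVar (fun i => Y i ω) t) ∂P ≤
      Real.exp (-(α * θ * s2 - β * θ ^ 2 * V) * ((t : ℝ) - 2) / 2) := by
  have ht : (t : ℝ) ≠ 0 := by exact_mod_cast (NeZero.ne t)
  have hint : ∀ c : Fin t, Integrable (fun ω => ∏ i ∈ sumPairs c,
      Real.exp (-θ * ((Y i ω - Y (c - i : Fin t) ω) ^ 2 / 2))) P := fun c =>
    integrable_prod_exp_neg_sq_diff hm hθ _ _ _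
  calc ∫ ω, Real.exp (-(θ * t / 2) * empVar (fun i => Y i ω) t) ∂P
      ≤ ∫ ω, ∑ c : Fin t, (1 / (t : ℝ)) * ∏ i ∈ sumPairs c,
        Real.exp (-θ * ((Y i ω - Y (c - i : Fin t) ω) ^ 2 / 2)) ∂P :=
        integral_mono_of_nonneg (.of_forall fun ω => (Real.exp_pos _).le)
          (integrable_finsetSum _ fun c _ => (hint c).const_mul _)
          (.of_forall fun ω => exp_neg_empVar_le _ hθ)
    _ = ∑ c : Fin t, (1 / (t : ℝ)) * ∫ ω, ∏ i ∈ sumPairs c,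
        Real.exp (-θ * ((Y i ω - Y (c - i : Fin t) ω) ^ 2 / 2)) ∂P := by
        rw [integral_finsetSum _ fun c _ => (hint c).const_mul _]
        simp only [integral_const_mul]
    _ ≤ ∑ c : Fin t, (1 / (t : ℝ)) *
        Real.exp (-(α * θ * s2 - β * θ ^ 2 * V) * ((t : ℝ) - 2) / 2) := by
        refine Finset.sum_le_sum fun c _ => mul_le_mul_of_nonneg_left ?_ (by positivity)
        exact integral_prod_sumPairs hY hm h4 hE hE2 hE4 hβ hθ hq hB c
    _ = _ := by
        simp [ht]

theorem measureReal_empVar_le {α β θ : ℝ} (hβ : 0 ≤ β) (hθ : 0 ≤ θ)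
    (hq : ∀ y : ℝ, 0 ≤ y → Real.exp (-y) ≤ 1 - α * y + β * y ^ 2)
    (hB : 0 ≤ α * θ * s2 - β * θ ^ 2 * V) {t : ℕ} (ht : t ≠ 0) (z : ℝ) :
    P.real {ω | empVar (fun i => Y i ω) t ≤ z} ≤
      Real.exp (θ * t / 2 * z - (α * θ * s2 - β * θ ^ 2 * V) * ((t : ℝ) - 2) / 2) := by
  have : NeZero t := ⟨ht⟩
  have hneg : -(θ * t / 2) ≤ 0 := by
    have : 0 ≤ θ * t / 2 := by positivity
    linarith
  have := measure_le_le_exp_mul_mgf (μ := P) (X := fun ω => empVar (fun i => Y i ω) t) z hneg ?_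
  · refine this.trans ?_
    have h := integral_exp_neg_empVar hY hm h4 hE hE2 hE4 hβ hθ hq hB (t := t)
    unfold mgf
    refine (mul_le_mul_of_nonneg_left h (Real.exp_pos _).le).trans_eq ?_
    rw [← Real.exp_add]
    ring_nf
  · refine Integrable.of_bound (C := 1) (Real.measurable_exp.comp
      ((measurable_empVar hm t).const_mul _)).aestronglyMeasurable (.of_forall fun ω => ?_)
    rw [Real.norm_of_nonneg (Real.exp_pos _).le, Real.exp_le_one_iff]
    exact mul_nonpos_of_nonpos_of_nonneg hneg (empVar_nonneg _ _)

end LowerTail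

/-! ### Under- and overestimation of a standard deviation. -/

section StdTail

variable {Ω : Type*} [MeasurableSpace Ω] {P : Measure Ω} [IsProbabilityMeasure P]
  {Y : ℕ → Ω → ℝ} {s2 F : ℝ}
  (hY : iIndepFun Y P) (hm : ∀ i, Measurable (Y i)) (h4 : ∀ i, MemLp (Y i) 4 P)
  (hE : ∀ i, ∫ ω, Y i ω ∂P = 0) (hE2 : ∀ i, ∫ ω, Y i ω ^ 2 ∂P = s2)
  (hE4 : ∀ i, ∫ ω, Y i ω ^ 4 ∂P ≤ 9 * F ^ 2 * s2) (hs2 : s2 ≤ 2 * F ^ 2)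
include hY hm h4 hE hE2 hE4 hs2

/-- The Chernoff bound with optimised `θ`. With `(1 - ρ) ^ 2 = α - γ`, the gap between the mean term
`α s2` and the threshold is `γ s2`, which yields the exponent `γ² s2² / (4 β V)` per unit of `t /
2`. -/
theorem measureReal_empVar_le_of_quadratic {α β γ ρ Λ : ℝ} {t : ℕ} (hs0 : 0 < s2) (hβ : 0 < β)
    (hq : ∀ y : ℝ, 0 ≤ y → Real.exp (-y) ≤ 1 - α * y + β * y ^ 2)
    (hγ : 0 ≤ γ) (hδ : α - γ = (1 - ρ) ^ 2) (hγρ : 16 / 5 * ρ ^ 2 * β ≤ γ ^ 2)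
    (hαγ : α * γ ≤ 4 * β) (ht : t ≠ 0) (hΛ : 16 * F ^ 2 * Λ ≤ ρ ^ 2 * s2 * t) :
    P.real {ω | empVar (fun i => Y i ω) t ≤ (1 - ρ) ^ 2 * s2} ≤ 3 * Real.exp (-(3 / 4 * Λ)) := by
  have hF : 0 < F ^ 2 := by nlinarith
  -- From `9 F² s2 + 3 s2²` and `s2 ≤ 2 F²`, which add up to at most `15 F² s2 = 2 V`.
  set V := 15 / 2 * F ^ 2 * s2 with hV
  have hV0 : 0 < V := by positivity
  have hE4' : ∀ i, (∫ ω, Y i ω ^ 4 ∂P) + 3 * s2 ^ 2 ≤ 2 * V := fun i => by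
    have := hE4 i
    nlinarith
  -- The minimiser of `β θ² V - γ θ s2`.
  set θ := γ * s2 / (2 * β * V) with hθ
  have hθ0 : 0 ≤ θ := by positivity
  have hB : α * θ * s2 - β * θ ^ 2 * V - (α - γ) * θ * s2 = γ ^ 2 * s2 ^ 2 / (4 * β * V) := by
    rw [hθ]
    field_simp
    ring
  set B := α * θ * s2 - β * θ ^ 2 * V with hBdef
  have hB0 : 0 ≤ B := by
    have h1 : 0 ≤ γ ^ 2 * s2 ^ 2 / (4 * β * V) := by positivity
    have h2 : 0 ≤ (α - γ) * θ * s2 := by rw [hδ]; positivity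
    linarith
  -- There are only about `(t - 2) / 2` disjoint pairs instead of `t / 2`. This loses a factor `exp
  -- B ≤ e ≤ 3`, the prefactor of the conclusion.
  have hB1 : B ≤ 1 := by
    have h1 : 0 ≤ β * θ ^ 2 * V := by positivity
    have h2 : α * θ * s2 ≤ 1 := by
      rw [hθ, show α * (γ * s2 / (2 * β * V)) * s2 = α * γ * s2 ^ 2 / (2 * β * V) by ring,
        div_le_one (by positivity), hV]
      calc α * γ * s2 ^ 2 ≤ 4 * β * s2 ^ 2 := by gcongr
        _ = 4 * β * s2 * s2 := by ring
        _ ≤ 4 * β * s2 * (2 * F ^ 2) := by gcongr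
        _ ≤ 2 * β * (15 / 2 * F ^ 2 * s2) := by
          have : 0 ≤ β * s2 * F ^ 2 := by positivity
          nlinarith
    linarith
  refine (measureReal_empVar_le hY hm h4 hE hE2 hE4' hβ.le hθ0 hq hB0 ht _).trans ?_
  have hmain : 3 / 4 * Λ ≤ t / 2 * (γ ^ 2 * s2 ^ 2 / (4 * β * V)) := by
    have e : (t : ℝ) / 2 * (γ ^ 2 * s2 ^ 2 / (4 * β * V)) = t * γ ^ 2 * s2 / (60 * β * F ^ 2) := by
      rw [hV]; field_simp; ring
    rw [e, le_div_iff₀ (by positivity)]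
    have h1 : (t * s2) * (16 / 5 * ρ ^ 2 * β) ≤ (t * s2) * γ ^ 2 := by gcongr
    have h2 : (16 * F ^ 2 * Λ) * β ≤ (ρ ^ 2 * s2 * t) * β := by gcongr
    have h3 : 0 ≤ ρ ^ 2 * s2 * t * β := by positivity
    nlinarith
  have hexp : θ * t / 2 * ((1 - ρ) ^ 2 * s2) - B * ((t : ℝ) - 2) / 2 ≤ 1 + -(3 / 4 * Λ) := by
    rw [← hδ]
    have : θ * t / 2 * ((α - γ) * s2) - B * ((t : ℝ) - 2) / 2 =
        B - t / 2 * (B - (α - γ) * θ * s2) := by ring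
    rw [this, hB]
    linarith
  refine (Real.exp_le_exp.2 hexp).trans ?_
  rw [Real.exp_add]
  have := Real.exp_one_lt_d9
  gcongr
  linarith

/-- Lower deviations of the empirical standard deviation, under a fourth moment assumption. -/
theorem measureReal_sqrt_empVar_add_lt {A Λ : ℝ} {t : ℕ} (hA : 0 ≤ A) (ht : t ≠ 0)
    (hΛ : 16 * F ^ 2 * Λ ≤ A ^ 2) :
    P.real {ω | √(empVar (fun i => Y i ω) t) + A * √(1 / (t : ℝ)) < √s2} ≤
      3 * Real.exp (-(3 / 4 * Λ)) := by
  have ht0 : (0 : ℝ) < t := by positivity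
  -- If the confidence width alone reaches the standard deviation, the event is empty.
  by_cases hlt : A * √(1 / (t : ℝ)) < √s2
  swap
  · have : {ω | √(empVar (fun i => Y i ω) t) + A * √(1 / (t : ℝ)) < √s2} = ∅ := by
      ext ω
      simp only [Set.mem_ofPred_eq, Set.mem_empty_iff_false, iff_false, not_lt]
      linarith [Real.sqrt_nonneg (empVar (fun i => Y i ω) t)]
    rw [this]
    simp only [measureReal_empty]
    positivity
  have hσ : 0 < √s2 := lt_of_le_of_lt (by positivity) hlt
  have hs0 : 0 < s2 := Real.sqrt_pos.1 hσ
  set ρ := A * √(1 / (t : ℝ)) / √s2 with hρ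
  have hρ0 : 0 ≤ ρ := by positivity
  have hρ1 : ρ ≤ 1 := by rw [hρ, div_le_one hσ]; exact hlt.le
  have hρA : ρ ^ 2 * s2 * t = A ^ 2 := by
    rw [hρ, div_pow, mul_pow, Real.sq_sqrt (by positivity), Real.sq_sqrt hs0.le]
    field_simp
  have hsub : {ω | √(empVar (fun i => Y i ω) t) + A * √(1 / (t : ℝ)) < √s2} ⊆
      {ω | empVar (fun i => Y i ω) t ≤ (1 - ρ) ^ 2 * s2} := by
    intro ω hω
    simp only [Set.mem_ofPred_eq] at hω ⊢
    have h1 : √(empVar (fun i => Y i ω) t) ≤ (1 - ρ) * √s2 := by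
      have : ρ * √s2 = A * √(1 / (t : ℝ)) := by rw [hρ]; field_simp
      linarith
    have h2 := pow_le_pow_left₀ (Real.sqrt_nonneg _) h1 2
    rwa [Real.sq_sqrt (empVar_nonneg _ _), mul_pow, Real.sq_sqrt hs0.le] at h2
  refine (measureReal_mono hsub).trans ?_
  rw [← hρA] at hΛ
  -- Neither quadratic bound covers all `ρ`: the first is too weak for `ρ` near `1`, and the second
  -- has `γ < 0` for small `ρ`.
  rcases le_total ρ (1 / 2) with h | h
  · refine measureReal_empVar_le_of_quadratic hY hm h4 hE hE2 hE4 hs2 (α := 1) (β := 1 / 2)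
      (γ := 1 - (1 - ρ) ^ 2) hs0 (by norm_num) (fun y hy => exp_neg_le_quadratic_half hy)
      (by nlinarith) (by ring) ?_ (by nlinarith) ht hΛ
    have : 3 / 2 * ρ ≤ 1 - (1 - ρ) ^ 2 := by nlinarith
    nlinarith [pow_le_pow_left₀ (by positivity) this 2]
  · have h3 : 3 / 4 * ρ ≤ 3 / 4 - (1 - ρ) ^ 2 := by nlinarith
    refine measureReal_empVar_le_of_quadratic hY hm h4 hE hE2 hE4 hs2 (α := 3 / 4) (β := 1 / 6)
      (γ := 3 / 4 - (1 - ρ) ^ 2) hs0 (by norm_num) (fun y hy => exp_neg_le_quadratic_sixth hy)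
      (by linarith) (by ring) ?_ (by nlinarith [sq_nonneg (1 - ρ)]) ht hΛ
    nlinarith [pow_le_pow_left₀ (by positivity) h3 2]

/-- The event that the empirical standard deviation plus its confidence width is below the standard
deviation for some sample size `2 ≤ t ≤ n`. -/
def failEvent (Y : ℕ → Ω → ℝ) (s2 A : ℝ) (n : ℕ) : Set Ω :=
  {ω | ∃ t ∈ Finset.Icc 2 n, √(empVar (fun i => Y i ω) t) + A * √(1 / (t : ℝ)) < √s2}

theorem measurableSet_failEvent (A : ℝ) (n : ℕ) : MeasurableSet (failEvent Y s2 A n) := by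
  have : failEvent Y s2 A n = ⋃ t ∈ Finset.Icc 2 n,
      {ω | √(empVar (fun i => Y i ω) t) + A * √(1 / (t : ℝ)) < √s2} := by
    ext ω; simp [failEvent]
  rw [this]
  refine Finset.measurableSet_biUnion _ fun t _ => measurableSet_lt ?_ measurable_const
  exact ((measurable_empVar hm t).sqrt).add_const _

theorem measureReal_failEvent_le {A Λ : ℝ} {n : ℕ} (hA : 0 ≤ A) (hΛ : 16 * F ^ 2 * Λ ≤ A ^ 2) :
    P.real (failEvent Y s2 A n) ≤ n * (3 * Real.exp (-(3 / 4 * Λ))) := by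
  have : failEvent Y s2 A n = ⋃ t ∈ Finset.Icc 2 n,
      {ω | √(empVar (fun i => Y i ω) t) + A * √(1 / (t : ℝ)) < √s2} := by
    ext ω; simp [failEvent]
  rw [this]
  refine (measureReal_biUnion_finset_le _ _).trans ?_
  refine (Finset.sum_le_card_nsmul _ _ (3 * Real.exp (-(3 / 4 * Λ))) fun t ht =>
    measureReal_sqrt_empVar_add_lt hY hm h4 hE hE2 hE4 hs2 hA
      (by have := (Finset.mem_Icc.1 ht).1; omega) hΛ).trans ?_
  rw [nsmul_eq_mul]
  gcongr
  simp

/-- A square integrable variable which dominates the overestimation of the standard deviation,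
see `exists_dominating_overestimate`. -/
theorem exists_dominating_overestimate {n : ℕ} (hn : 1 ≤ n) :
    ∃ Z : Ω → ℝ, Measurable Z ∧ (∀ ω, 0 ≤ Z ω) ∧ MemLp Z 2 P ∧
      ∫ ω, Z ω ^ 2 ∂P ≤ 9 * F ^ 2 * (1 + Real.log n) ∧
      ∀ᵐ ω ∂P, ∀ t : ℕ, 1 ≤ t → t ≤ n →
        √(empVar (fun i => Y i ω) t) ≤ √s2 + Z ω / √t := by
  have hI := fun i (p : ℕ) (hp : p ≤ 4) => integrable_pow_of_memLp_four (h4 i) hp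
  have hs0 : 0 ≤ s2 := hE2 0 ▸ integral_nonneg fun ω => sq_nonneg _
  have hlog : 0 ≤ Real.log n := Real.log_natCast_nonneg n
  -- Zero variance must be separated because `Z` is defined by dividing by `√s2`; in that case all
  -- samples vanish almost surely.
  rcases hs0.eq_or_lt with h0 | hs0
  · refine ⟨fun _ => 0, measurable_const, fun _ => le_rfl, MemLp.zero', by simp; positivity, ?_⟩
    have hz : ∀ i, ∀ᵐ ω ∂P, Y i ω = 0 := by
      intro i
      have := (integral_eq_zero_iff_of_nonneg (fun ω => sq_nonneg (Y i ω))
        (hI i 2 (by norm_num))).1 (by rw [hE2, h0])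
      filter_upwards [this] with ω hω
      simpa using hω
    filter_upwards [ae_all_iff.2 hz] with ω hω t _ _
    simp [empVar, empMean, hω]
  have hσ : 0 < √s2 := Real.sqrt_pos.2 hs0
  set x : ℕ → Ω → ℝ := fun i ω => Y i ω ^ 2 - s2 with hx
  have hxm : ∀ i, Measurable (x i) := fun i => ((hm i).pow_const 2).sub_const _
  have hxi : iIndepFun x P := hY.comp (fun _ y => y ^ 2 - s2) fun _ => by fun_prop
  have hx2 : ∀ i, MemLp (x i) 2 P := fun i => by
    have : MemLp (fun ω => Y i ω ^ 2) 2 P := by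
      rw [memLp_two_iff_integrable_sq ((hm i).pow_const 2).aestronglyMeasurable]
      simpa [← pow_mul] using hI i 4 le_rfl
    exact this.sub (memLp_const s2)
  have hx0 : ∀ i, ∫ ω, x i ω ∂P = 0 := fun i => by
    rw [hx, integral_sub (hI i 2 (by norm_num)) (integrable_const _), hE2]
    simp
  have hxv : ∀ i, ∫ ω, x i ω ^ 2 ∂P ≤ 9 * F ^ 2 * s2 := fun i => by
    have e : ∀ ω, x i ω ^ 2 = Y i ω ^ 4 - 2 * s2 * Y i ω ^ 2 + s2 ^ 2 := fun ω => by
      simp only [hx]; ring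
    simp only [e]
    have a := (hI i 2 (by norm_num)).const_mul (2 * s2)
    rw [integral_add (f := fun ω => Y i ω ^ 4 - 2 * s2 * Y i ω ^ 2) ((hI i 4 le_rfl).sub a)
      (integrable_const _), integral_sub (hI i 4 le_rfl) a, integral_const_mul, hE2]
    simp
    nlinarith [hE4 i]
  obtain ⟨m, rfl⟩ := Nat.exists_eq_add_of_le' hn
  have hW := integrable_weightedMax hxi hxm hx2 m
  have hW0 : ∀ ω, 0 ≤ weightedMax (fun i => x i ω) m := fun ω =>
    le_trans (by positivity) (sq_partSum_div_le_weightedMax (fun i => x i ω) le_rfl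
      (by omega : 1 ≤ m + 1))
  have hWm : Measurable fun ω => weightedMax (fun i => x i ω) m := by
    unfold weightedMax
    exact (((measurable_runMax fun i _ => hxm i).pow_const 2).div_const _).add
      (Finset.measurable_fun_sum _ fun _ _ =>
        ((measurable_runMax fun i _ => hxm i).pow_const 2).mul_const _)
  -- From `√(σ² + D) ≤ σ + D / (2σ)`, where `D` is the mean of the `Y i ^ 2 - s2`. Since these have
  -- second moment at most `9 F² s2`, dividing by `4 s2` leaves a bound on `E Z²` free of `σ`.
  set Z : Ω → ℝ := fun ω => √(weightedMax (fun i => x i ω) m) / (2 * √s2) with hZ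
  have hZm : Measurable Z := hWm.sqrt.div_const _
  have hZ2 : ∀ ω, Z ω ^ 2 = weightedMax (fun i => x i ω) m / (4 * s2) := fun ω => by
    rw [hZ, div_pow, mul_pow, Real.sq_sqrt (hW0 ω), Real.sq_sqrt hs0.le]
    norm_num
  refine ⟨Z, hZm, fun ω => by positivity, ?_, ?_, .of_forall fun ω t ht1 htn => ?_⟩
  · rw [memLp_two_iff_integrable_sq hZm.aestronglyMeasurable]
    simp only [hZ2]
    exact hW.div_const _
  · simp only [hZ2]
    rw [integral_div, div_le_iff₀ (by positivity)]
    have := integral_weightedMax_le hxi hxm hx2 hx0 hxv m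
    linarith
  · have ht0 : (0 : ℝ) < t := by exact_mod_cast ht1
    have htne : t ≠ 0 := by omega
    have h1 := sq_partSum_div_le_weightedMax (fun i => x i ω) ht1 htn
    have h2 : partSum (fun i => x i ω) t ≤ √t * √(weightedMax (fun i => x i ω) m) := by
      rw [← Real.sqrt_mul ht0.le]
      refine Real.le_sqrt_of_sq_le ?_
      rwa [div_le_iff₀' ht0] at h1
    have h3 : empVar (fun i => Y i ω) t ≤ s2 + partSum (fun i => x i ω) t / t := by
      refine (empVar_le _ htne).trans_eq ?_
      simp only [partSum, hx, Finset.sum_sub_distrib]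
      simp
      field_simp
      ring
    have hst : 0 < √(t : ℝ) := Real.sqrt_pos.2 ht0
    rw [Real.sqrt_le_left (by positivity)]
    refine h3.trans ?_
    have h4' : partSum (fun i => x i ω) t / t ≤ √(weightedMax (fun i => x i ω) m) / √t := by
      rw [div_le_div_iff₀ ht0 hst]
      calc partSum (fun i => x i ω) t * √t ≤ √t * √(weightedMax (fun i => x i ω) m) * √t := by gcongr
        _ = _ := by
          rw [mul_assoc, mul_comm √(t : ℝ), mul_assoc, Real.mul_self_sqrt ht0.le]
    have e : (√s2 + Z ω / √t) ^ 2 = s2 + √(weightedMax (fun i => x i ω) m) / √t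
        + (Z ω / √t) ^ 2 := by
      rw [add_sq, Real.sq_sqrt hs0.le, hZ]
      field_simp
    rw [e]
    nlinarith [sq_nonneg (Z ω / √t)]

end StdTail

/-! ### Counting the samples of a stratum. -/

section Pulls

variable {ι : Type} [DecidableEq ι]

theorem pulls_succ (a : ℕ → ι) (k : ι) (t : ℕ) :
    pulls a k (t + 1) = pulls a k t + if a (t + 1) = k then 1 else 0 := by
  unfold pulls
  rw [← Finset.insert_Icc_right_eq_Icc_add_one (by omega), Finset.filter_insert]
  split_ifs with h
  · rw [Finset.card_insert_of_notMem (by simp)]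
  · rfl

theorem pulls_mono (a : ℕ → ι) (k : ι) : Monotone (pulls a k) :=
  monotone_nat_of_le_succ fun t => by rw [pulls_succ]; omega

theorem sum_pulls [Fintype ι] (a : ℕ → ι) (t : ℕ) : ∑ k, pulls a k t = t := by
  have := Finset.card_eq_sum_card_fiberwise (f := a) (s := Finset.Icc 1 t) (t := Finset.univ)
    (by simp [Set.MapsTo])
  rw [Nat.card_Icc] at this
  unfold pulls
  omega

/-- Take the last round up to `n` that chooses `q`. The index used there is computed from one sample
fewer than the final count. -/
theorem exists_last_pull {a : ℕ → ι} {q : ι} {m n : ℕ} (h : pulls a q m < pulls a q n) :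
    ∃ r, m + 1 ≤ r ∧ r ≤ n ∧ a r = q ∧ pulls a q (r - 1) + 1 = pulls a q n := by
  induction n with
  | zero => exact absurd ((pulls_mono a q) (Nat.zero_le m)) (not_le.2 h)
  | succ n ih =>
    have hs := pulls_succ a q n
    split_ifs at hs with hq
    · refine ⟨n + 1, ?_, le_rfl, hq, by simp [hs]⟩
      by_contra hlt
      exact absurd ((pulls_mono a q) (by omega : n + 1 ≤ m)) (not_le.2 h)
    · rw [add_zero] at hs
      rw [hs] at h ⊢
      obtain ⟨r, h1, h2, h3⟩ := ih h
      exact ⟨r, h1, by omega, h3⟩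

end Pulls

/-! ### The deterministic analysis of the allocation on one path. -/

section Pathwise

theorem exists_cube_root {u : ℝ} (hu : 0 ≤ u) : ∃ c : ℝ, 0 ≤ c ∧ c ^ 3 = u :=
  ⟨u ^ ((1 : ℝ) / 3), by positivity, by
    rw [← Real.rpow_natCast, ← Real.rpow_mul hu]; norm_num⟩

/-- Solves the self-consistent inequality produced by summing over strata. For `z ≤ 1` it is
immediate. For `z ≥ 1`, `s` is absorbed in a quarter of `z ^ 3`, so `z ≤ z ^ 2 ≤ 5/3 W c`, and `5/4
· 5/3 < 9/4`. -/
theorem cube_le_of_cube_le_add {z s W c : ℝ} (hz : 0 ≤ z) (hs : s ≤ 1 / 4) (hW : 1 ≤ W)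
    (hc : 0 ≤ c) (hc1 : c ≤ 1) (h : z ^ 3 ≤ s + 5 / 4 * W * c * z) :
    z ^ 3 ≤ s + 9 / 4 * W ^ 2 * c := by
  have hWc : 0 ≤ W * c := by positivity
  rcases le_total z 1 with h1 | h1
  · have h2 : W * c * z ≤ W * c := mul_le_of_le_one_right hWc h1
    have h3 : W * c ≤ W ^ 2 * c := by nlinarith
    linarith
  · have h2 : 1 ≤ z ^ 3 := one_le_pow₀ h1
    have h3 : 3 / 4 * z ^ 3 ≤ 5 / 4 * (W * c) * z := by linarith
    have h4 : 3 / 4 * z ^ 2 ≤ 5 / 4 * (W * c) := by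
      by_contra! hlt
      nlinarith
    have h5 : z ≤ z ^ 2 := by nlinarith
    have h6 : (W * c) * z ≤ (W * c) * (5 / 3 * (W * c)) := by gcongr; linarith
    have h7 : (W * c) * (W * c) ≤ W ^ 2 * c := by nlinarith [mul_nonneg hWc (by positivity : 0 ≤ W)]
    linarith

/-- Passes from the count `T - 1` before the last pull to the final count `T`; a stratum chosen
after the initialization has `T ≥ 3`. -/
theorem inv_sqrt_pred_le {T : ℝ} (hT : 3 ≤ T) : 1 / √(T - 1) ≤ 5 / 4 * √(1 / T) := by
  have h1 : 0 < √(T - 1) := Real.sqrt_pos.2 (by linarith)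
  have h2 : 0 < √T := Real.sqrt_pos.2 (by linarith)
  rw [Real.sqrt_div (by norm_num), Real.sqrt_one, mul_one_div, div_le_div_iff₀ h1 h2, one_mul]
  rw [show (5 / 4 : ℝ) * √(T - 1) = √((5 / 4) ^ 2 * (T - 1)) by
    rw [Real.sqrt_mul (by norm_num), Real.sqrt_sq (by norm_num)]]
  exact Real.sqrt_le_sqrt (by linarith)

variable {ι : Type} [DecidableEq ι] [Fintype ι]

/-- The allocation of MC-UCB with equal weights balances the ratios `σ_k / T_k`, on a path on which
the empirical standard deviations are not underestimated in the strata `k ∈ G` and are overestimated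
by at most `Z k / √t`. -/
theorem ratio_le_of_run {w : ι → ℝ} {A : ℝ} {n K : ℕ} {X : ι → ℕ → ℝ} {a : ℕ → ι} {σ Z : ι → ℝ}
    {G : Set ι} {c : ℝ} (hK : K = Fintype.card ι) (hw : ∀ k, w k = 1 / K) (hA : 0 < A)
    (hσ : ∀ k, 0 ≤ σ k) (hZ : ∀ k, 0 ≤ Z k)
    (hgood : ∀ k ∈ G, ∀ t : ℕ, 2 ≤ t → t ≤ n → σ k ≤ √(empVar (X k) t) + A * √(1 / (t : ℝ)))
    (hover : ∀ k, ∀ t : ℕ, 1 ≤ t → t ≤ n → √(empVar (X k) t) ≤ σ k + Z k / √t)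
    (hinit : ∀ k, pulls a k (2 * K) = 2)
    (hrun : ∀ t, 2 * K + 1 ≤ t → t ≤ n → ∀ k, ucbIndex w A X a k t ≤ ucbIndex w A X a (a t) t)
    (hS : ∑ k, w k * σ k ≤ A / 4) (hn : 2 * K < n) (hc : 0 ≤ c) (hc1 : c ≤ 1)
    (hcK : c ^ 3 = K / ((n : ℝ) - 2 * K)) {k : ι} (hk : k ∈ G) :
    w k * σ k / pulls a k n ≤
      (∑ k, w k * σ k + 9 / 4 * A * (1 + (∑ k, w k * Z k) / A) ^ 2 * c) / ((n : ℝ) - 2 * K) := by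
  classical
  have hne : Nonempty ι := ⟨k⟩
  have hK0 : 0 < K := hK ▸ Fintype.card_pos
  have hKr : (0 : ℝ) < K := by exact_mod_cast hK0
  have hN : (0 : ℝ) < (n : ℝ) - 2 * K := by
    have : ((2 * K : ℕ) : ℝ) < n := by exact_mod_cast hn
    push_cast at this
    linarith
  have hw0 : ∀ k, 0 < w k := fun k => by rw [hw]; positivity
  have hT2 : ∀ k, 2 ≤ pulls a k n := fun k => hinit k ▸ pulls_mono a k hn.le
  have hTr : ∀ k, (2 : ℝ) ≤ pulls a k n := fun k => by exact_mod_cast hT2 k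
  have hTn : ∀ k, pulls a k n ≤ n := fun k =>
    (Finset.single_le_sum (f := fun k => pulls a k n) (fun _ _ => Nat.zero_le _)
      (Finset.mem_univ k)).trans_eq (sum_pulls a n)
  -- A lower bound, valid in every round after the initialization, for the index of `p`: the index
  -- dominates its exploration term always and `σ p` when `p ∈ G`, and the count only grows. Its
  -- maximum `x` is the quantity to bound.
  set V : ι → ℝ := fun p => w p / pulls a p n *
    max (A * √(1 / (pulls a p n : ℝ))) (if p ∈ G then σ p else 0) with hV
  obtain ⟨p, -, hp⟩ := Finset.exists_max_image Finset.univ V ⟨k, Finset.mem_univ k⟩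
  set x := V p with hx
  have hxV : ∀ q, V q ≤ x := fun q => hp q (Finset.mem_univ q)
  have hx0 : 0 ≤ x := by
    have h1 : 0 ≤ A * √(1 / (pulls a p n : ℝ)) := by positivity
    exact mul_nonneg (div_nonneg (hw0 p).le (Nat.cast_nonneg _)) (h1.trans (le_max_left _ _))
  -- the maximal value is a lower bound for the index of the strata pulled last
  have hidx : ∀ r, 2 * K + 1 ≤ r → r ≤ n → x ≤ ucbIndex w A X a (a r) r := by
    intro r hr1 hr2
    refine le_trans ?_ (hrun r hr1 hr2 p)
    have hm : pulls a p (r - 1) ≤ pulls a p n := pulls_mono a p (by omega)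
    have hm2 : 2 ≤ pulls a p (r - 1) := hinit p ▸ pulls_mono a p (by omega)
    have hm0 : (0 : ℝ) < pulls a p (r - 1) := by exact_mod_cast (by omega : 0 < pulls a p (r - 1))
    have hmr : (pulls a p (r - 1) : ℝ) ≤ pulls a p n := by exact_mod_cast hm
    unfold ucbIndex
    change w p / pulls a p n * max (A * √(1 / (pulls a p n : ℝ))) (if p ∈ G then σ p else 0) ≤ _
    have h1 := hw0 p
    gcongr
    refine max_le ?_ ?_
    · have : A * √(1 / (pulls a p n : ℝ)) ≤ A * √(1 / (pulls a p (r - 1) : ℝ)) := by gcongr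
      linarith [Real.sqrt_nonneg (empVar (X p) (pulls a p (r - 1)))]
    · split_ifs with hG
      · exact hgood p hG _ hm2 (hm.trans (hTn p))
      · positivity
  -- The unknown `x` is rescaled as `z ^ 3 = x (n - 2K) / A`. The exploration term alone gives `A w
  -- T^{-3/2} ≤ x`, hence `T^{-1/2} ≤ z c` for every stratum, whatever its variance.
  obtain ⟨z, hz0, hz⟩ := exists_cube_root (div_nonneg (mul_nonneg hx0 hN.le) hA.le)
  have hroot : ∀ q, √(1 / (pulls a q n : ℝ)) ≤ z * c := by
    intro q
    have h1 : w q / pulls a q n * (A * √(1 / (pulls a q n : ℝ))) ≤ x := by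
      refine le_trans ?_ (hxV q)
      have := hw0 q
      change _ ≤ w q / pulls a q n * max (A * √(1 / (pulls a q n : ℝ))) (if q ∈ G then σ q else 0)
      gcongr
      exact le_max_left _ _
    refine le_of_pow_le_pow_left₀ (n := 3) (by norm_num) (by positivity) ?_
    rw [mul_pow, hz, hcK, pow_succ, Real.sq_sqrt (by positivity)]
    have e : x * ((n : ℝ) - 2 * K) / A * (K / ((n : ℝ) - 2 * K)) = x * K / A := by
      field_simp
    rw [e, le_div_iff₀ hA]
    rw [hw] at h1
    calc _ = K * (1 / K / pulls a q n * (A * √(1 / (pulls a q n : ℝ)))) := by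
          field_simp
      _ ≤ K * x := by gcongr
      _ = x * K := mul_comm _ _
  -- `x` is at most the index of `q` at its last pull, which the overestimation bound controls from
  -- above. Subtracting the two initial samples makes the inequality trivial for strata never chosen
  -- afterwards.
  have hq : ∀ q, x * ((pulls a q n : ℝ) - 2) ≤
      w q * σ q + w q * (A + Z q) * (5 / 4 * (z * c)) := by
    intro q
    have hr0 : 0 ≤ w q * σ q + w q * (A + Z q) * (5 / 4 * (z * c)) := by
      have := hw0 q; have := hσ q; have := hZ q
      positivity
    rcases (hT2 q).eq_or_lt with h | h
    · rw [← h]; simpa using hr0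
    obtain ⟨r, hr1, hr2, hr3, hr4⟩ := exists_last_pull (m := 2 * K) (n := n) (by rw [hinit q]; exact h)
    have hx1 := hidx r hr1 hr2
    rw [hr3] at hx1
    unfold ucbIndex at hx1
    have hm2 : 2 ≤ pulls a q (r - 1) := by omega
    have hmn : pulls a q (r - 1) ≤ n := by have := hTn q; omega
    have hTm : (pulls a q n : ℝ) = pulls a q (r - 1) + 1 := by exact_mod_cast hr4.symm
    have hT3 : (3 : ℝ) ≤ pulls a q n := by exact_mod_cast h
    set m := (pulls a q (r - 1) : ℝ) with hm
    have hm0 : 0 < m := by linarith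
    have hover' := hover q _ (by omega) hmn
    have hsq : 1 / √m ≤ 5 / 4 * (z * c) := by
      have := inv_sqrt_pred_le hT3
      rw [hTm] at this
      rw [add_sub_cancel_right] at this
      refine this.trans ?_
      rw [← hTm]
      gcongr
      exact hroot q
    have h1 : √(empVar (X q) (pulls a q (r - 1))) + A * √(1 / m) ≤
        σ q + (A + Z q) * (5 / 4 * (z * c)) := by
      have e : √(1 / m) = 1 / √m := by rw [Real.sqrt_div (by norm_num), Real.sqrt_one]
      rw [e]
      have : Z q / √m + A * (1 / √m) = (A + Z q) * (1 / √m) := by ring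
      have h2 : (A + Z q) * (1 / √m) ≤ (A + Z q) * (5 / 4 * (z * c)) :=
        mul_le_mul_of_nonneg_left hsq (by linarith [hZ q])
      linarith
    have h2 : x * m ≤ w q * (σ q + (A + Z q) * (5 / 4 * (z * c))) := by
      rw [div_mul_eq_mul_div, le_div_iff₀ hm0] at hx1
      exact hx1.trans (mul_le_mul_of_nonneg_left h1 (hw0 q).le)
    have h3 : x * ((pulls a q n : ℝ) - 2) ≤ x * m := by
      gcongr; linarith
    linarith
  have hsum := Finset.sum_le_sum fun q (_ : q ∈ Finset.univ) => hq q
  have hwsum : ∑ q, w q = 1 := by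
    simp only [hw, Finset.sum_const, Finset.card_univ, ← hK, nsmul_eq_mul]
    field_simp
  have hsumT : ∑ q, x * ((pulls a q n : ℝ) - 2) = x * ((n : ℝ) - 2 * K) := by
    rw [← Finset.mul_sum, Finset.sum_sub_distrib]
    have : ∑ q, (pulls a q n : ℝ) = n := by exact_mod_cast sum_pulls a n
    rw [this]
    simp [← hK]
    left; ring
  have hsumR : ∑ q, (w q * σ q + w q * (A + Z q) * (5 / 4 * (z * c))) =
      ∑ q, w q * σ q + (A + ∑ q, w q * Z q) * (5 / 4 * (z * c)) := by
    rw [Finset.sum_add_distrib, ← Finset.sum_mul]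
    simp only [mul_add, Finset.sum_add_distrib]
    rw [← Finset.sum_mul, hwsum, one_mul]
  rw [hsumT, hsumR] at hsum
  have hZ0 : 0 ≤ ∑ q, w q * Z q := Finset.sum_nonneg fun q _ => mul_nonneg (hw0 q).le (hZ q)
  have hW1 : 1 ≤ 1 + (∑ k, w k * Z k) / A := by
    have : 0 ≤ (∑ k, w k * Z k) / A := by positivity
    linarith
  -- Summed over strata and divided by `A`, the bounds read `z ^ 3 ≤ s + 5/4 W c z`, with `W` one
  -- plus the average overestimation relative to `A`.
  have hzle := cube_le_of_cube_le_add (z := z) (s := (∑ q, w q * σ q) / A) hz0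
    (by rw [div_le_iff₀ hA]; linarith) hW1 hc hc1 (by
      rw [hz, div_le_iff₀ hA]
      refine hsum.trans_eq ?_
      field_simp)
  rw [hz, div_le_iff₀ hA] at hzle
  have hxk : w k * σ k / pulls a k n ≤ x := by
    refine le_trans ?_ (hxV k)
    rw [hV]
    simp only [if_pos hk]
    rw [div_mul_eq_mul_div]
    have := hw0 k
    gcongr
    exact le_max_right _ _
  refine hxk.trans ?_
  rw [le_div_iff₀ hN]
  refine hzle.trans_eq ?_
  field_simp

/-- The pathwise bound for the pseudo-risk of MC-UCB. -/
theorem sum_sq_div_pulls_le {w : ι → ℝ} {A : ℝ} {n K : ℕ} {X : ι → ℕ → ℝ} {a : ℕ → ι}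
    {σ Z : ι → ℝ} {G : Set ι} [DecidablePred (· ∈ G)] {c : ℝ} (hK : K = Fintype.card ι)
    (hw : ∀ k, w k = 1 / K) (hA : 0 < A) (hσ : ∀ k, 0 ≤ σ k) (hZ : ∀ k, 0 ≤ Z k)
    (hgood : ∀ k ∈ G, ∀ t : ℕ, 2 ≤ t → t ≤ n → σ k ≤ √(empVar (X k) t) + A * √(1 / (t : ℝ)))
    (hover : ∀ k, ∀ t : ℕ, 1 ≤ t → t ≤ n → √(empVar (X k) t) ≤ σ k + Z k / √t)
    (hinit : ∀ k, pulls a k (2 * K) = 2)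
    (hrun : ∀ t, 2 * K + 1 ≤ t → t ≤ n → ∀ k, ucbIndex w A X a k t ≤ ucbIndex w A X a (a t) t)
    (hS : ∑ k, w k * σ k ≤ A / 4) (hn : 2 * K < n) (hc : 0 ≤ c) (hc1 : c ≤ 1)
    (hcK : c ^ 3 = K / ((n : ℝ) - 2 * K)) :
    ∑ k, w k ^ 2 * σ k ^ 2 / (pulls a k n : ℝ) ≤
      (∑ k, w k * σ k) * ((∑ k, w k * σ k + 9 / 4 * A * (1 + (∑ k, w k * Z k) / A) ^ 2 * c) /
        ((n : ℝ) - 2 * K)) +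
      ∑ k, w k ^ 2 * σ k ^ 2 / 2 * (if k ∈ G then 0 else 1) := by
  rw [Finset.sum_mul, ← Finset.sum_add_distrib]
  refine Finset.sum_le_sum fun k _ => ?_
  have hw0 : 0 ≤ w k := by rw [hw]; positivity
  have hN : (0 : ℝ) < (n : ℝ) - 2 * K := by
    have : ((2 * K : ℕ) : ℝ) < n := by exact_mod_cast hn
    push_cast at this
    linarith
  have hZ0 : 0 ≤ ∑ k, w k * Z k := Finset.sum_nonneg fun q _ =>
    mul_nonneg (by rw [hw]; positivity) (hZ q)
  have hσ0 : 0 ≤ ∑ k, w k * σ k := Finset.sum_nonneg fun q _ =>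
    mul_nonneg (by rw [hw]; positivity) (hσ q)
  have hT : (2 : ℝ) ≤ pulls a k n := by
    exact_mod_cast (hinit k ▸ pulls_mono a k hn.le : 2 ≤ pulls a k n)
  split_ifs with hk
  · have := ratio_le_of_run hK hw hA hσ hZ hgood hover hinit hrun hS hn hc hc1 hcK hk
    rw [mul_zero, add_zero]
    refine le_trans (le_of_eq ?_) (mul_le_mul_of_nonneg_left this (mul_nonneg hw0 (hσ k)))
    ring
  -- Outside `G` only the two initial samples are guaranteed.
  · rw [mul_one]
    have h1 : w k ^ 2 * σ k ^ 2 / (pulls a k n : ℝ) ≤ w k ^ 2 * σ k ^ 2 / 2 := by gcongr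
    have h2 := hσ k
    refine h1.trans (le_add_of_nonneg_left ?_)
    positivity

end Pathwise

/-! ### The partition of the unit cube. -/

section Geometry

variable {d l : ℕ}

theorem zero_mem_unitCube : (0 : Space d) ∈ unitCube d := fun i => by simp

theorem measurableSet_unitCube : MeasurableSet (unitCube d) := by
  have : unitCube d = ⋂ i, (fun x : Space d => x i) ⁻¹' Set.Icc 0 1 := by
    ext x; simp [unitCube]
  rw [this]
  exact MeasurableSet.iInter fun i => measurableSet_Icc.preimage (by fun_prop)

theorem cubeStratum_subset (j : Fin d → Fin l) : cubeStratum d l j ⊆ unitCube d := fun _ h => h.1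

/-- One side of a stratum of the partition into cubes of side `1 / l`. -/
def sideInterval (l j : ℕ) : Set ℝ :=
  {r | r ∈ Set.Icc (0 : ℝ) 1 ∧ (j : ℝ) ≤ l * r ∧ (l * r < (j : ℝ) + 1 ∨ j + 1 = l)}

theorem mem_cubeStratum {j : Fin d → Fin l} {x : Space d} :
    x ∈ cubeStratum d l j ↔ ∀ i, x i ∈ sideInterval l (j i) := by
  simp only [cubeStratum, unitCube, sideInterval, Set.mem_ofPred_eq]
  exact forall_and.symm

theorem sideInterval_bounds {l j : ℕ} (hl : 0 < l) {r : ℝ} (h : r ∈ sideInterval l j) :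
    (j : ℝ) / l ≤ r ∧ r ≤ ((j : ℝ) + 1) / l := by
  obtain ⟨⟨h0, h1⟩, h2, h3⟩ := h
  have hl' : (0 : ℝ) < l := by exact_mod_cast hl
  rw [div_le_iff₀' hl', le_div_iff₀' hl']
  refine ⟨h2, ?_⟩
  rcases h3 with h3 | h3
  · exact h3.le
  · have : (j : ℝ) + 1 = l := by exact_mod_cast h3
    nlinarith

theorem Ico_subset_sideInterval {l j : ℕ} (hj : j < l) :
    Set.Ico ((j : ℝ) / l) (((j : ℝ) + 1) / l) ⊆ sideInterval l j := by
  rintro r ⟨h1, h2⟩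
  have hl' : (0 : ℝ) < l := by exact_mod_cast (by omega : 0 < l)
  have hj' : (j : ℝ) + 1 ≤ l := by exact_mod_cast hj
  rw [div_le_iff₀' hl'] at h1
  rw [lt_div_iff₀' hl'] at h2
  refine ⟨⟨?_, ?_⟩, h1, Or.inl h2⟩
  · have : (0 : ℝ) ≤ j := Nat.cast_nonneg j
    by_contra! h
    nlinarith
  · by_contra! h
    nlinarith

theorem volume_sideInterval {l j : ℕ} (hj : j < l) :
    volume (sideInterval l j) = ENNReal.ofReal (1 / l) := by
  have hl' : (0 : ℝ) < l := by exact_mod_cast (by omega : 0 < l)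
  have e : ((j : ℝ) + 1) / l - j / l = 1 / l := by ring
  refine le_antisymm ?_ ?_
  · refine (measure_mono fun r hr => sideInterval_bounds (by omega) hr :
      volume (sideInterval l j) ≤ volume (Set.Icc ((j : ℝ) / l) (((j : ℝ) + 1) / l))).trans ?_
    rw [Real.volume_Icc, e]
  · refine le_trans ?_ (measure_mono (Ico_subset_sideInterval hj))
    rw [Real.volume_Ico, e]

theorem measurableSet_sideInterval (l j : ℕ) : MeasurableSet (sideInterval l j) := by
  unfold sideInterval
  refine measurableSet_Icc.inter (MeasurableSet.inter ?_ (MeasurableSet.union ?_ ?_))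
  · exact measurableSet_le measurable_const (measurable_id.const_mul (l : ℝ))
  · exact measurableSet_lt (measurable_id.const_mul (l : ℝ)) measurable_const
  · exact MeasurableSet.const _

theorem measurableSet_cubeStratum (j : Fin d → Fin l) : MeasurableSet (cubeStratum d l j) := by
  have : cubeStratum d l j = ⋂ i, (fun x : Space d => x i) ⁻¹' sideInterval l (j i) := by
    ext x; simp [mem_cubeStratum]
  rw [this]
  exact MeasurableSet.iInter fun i => (measurableSet_sideInterval _ _).preimage (by fun_prop)

theorem volume_cubeStratum (j : Fin d → Fin l) :
    volume (cubeStratum d l j) = ENNReal.ofReal (1 / l) ^ d := by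
  have h : cubeStratum d l j = (WithLp.ofLp : Space d → Fin d → ℝ) ⁻¹'
      Set.univ.pi fun i => sideInterval l (j i) := by
    ext x; simp [mem_cubeStratum]
  rw [h, (PiLp.volume_preserving_ofLp (Fin d)).measure_preimage
    (MeasurableSet.univ_pi fun i => measurableSet_sideInterval _ _).nullMeasurableSet, volume_pi_pi]
  simp [fun i => volume_sideInterval (j i).2]

theorem weight_cubeStratum (j : Fin d → Fin l) :
    weight (cubeStratum d l) j = 1 / ((l ^ d : ℕ) : ℝ) := by
  rw [weight, measureReal_def, volume_cubeStratum, ENNReal.toReal_pow,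
    ENNReal.toReal_ofReal (by positivity)]
  push_cast
  rw [one_div_pow]

theorem iUnion_cubeStratum (hl : 0 < l) : ⋃ j, cubeStratum d l j = unitCube d := by
  refine Set.Subset.antisymm (Set.iUnion_subset cubeStratum_subset) fun x hx => ?_
  have hl' : (0 : ℝ) < l := by exact_mod_cast hl
  have key : ∀ i, ∃ k : Fin l, x i ∈ sideInterval l k := by
    intro i
    obtain ⟨h0, h1⟩ := hx i
    have hp : 0 ≤ (l : ℝ) * x i := by positivity
    by_cases h : ⌊(l : ℝ) * x i⌋₊ < l
    · exact ⟨⟨_, h⟩, ⟨h0, h1⟩, Nat.floor_le hp, Or.inl (Nat.lt_floor_add_one _)⟩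
    -- The floor reaches `l` only at the right end point, which belongs to the last interval.
    · refine ⟨⟨l - 1, by omega⟩, ⟨h0, h1⟩, ?_, Or.inr (by simp; omega)⟩
      have := (Nat.le_floor_iff hp).1 (not_lt.1 h)
      refine le_trans ?_ this
      exact_mod_cast Nat.sub_le l 1
  choose k hk using key
  exact Set.mem_iUnion.2 ⟨k, mem_cubeStratum.2 hk⟩

theorem sideInterval_disjoint {j k : Fin l} {r : ℝ} (hj : r ∈ sideInterval l j)
    (hk : r ∈ sideInterval l k) : j = k := by
  obtain ⟨-, h1, h2⟩ := hj
  obtain ⟨-, h3, h4⟩ := hk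
  have aux : ∀ j k : Fin l, ((j : ℕ) : ℝ) ≤ l * r →
      (l * r < ((k : ℕ) : ℝ) + 1 ∨ (k : ℕ) + 1 = l) → (j : ℕ) ≤ k := by
    rintro j k h (h' | h')
    · have : ((j : ℕ) : ℝ) < ((k : ℕ) : ℝ) + 1 := h.trans_lt h'
      have : (j : ℕ) < k + 1 := by exact_mod_cast this
      omega
    · have := j.2
      omega
  exact Fin.ext (le_antisymm (aux j k h1 h4) (aux k j h3 h2))

theorem pairwise_disjoint_cubeStratum : Pairwise (Function.onFun Disjoint (cubeStratum d l)) := by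
  intro j k hjk
  rw [Function.onFun, Set.disjoint_left]
  intro x hj hk
  exact hjk (funext fun i => sideInterval_disjoint (mem_cubeStratum.1 hj i) (mem_cubeStratum.1 hk i))

theorem norm_sub_le_of_coord {x y : Space d} {r : ℝ} (hr : 0 ≤ r) (h : ∀ i, |x i - y i| ≤ r) :
    ‖x - y‖ ≤ √d * r := by
  rw [EuclideanSpace.norm_eq]
  calc √(∑ i, ‖(x - y) i‖ ^ 2) ≤ √(∑ _i : Fin d, r ^ 2) := by
        refine Real.sqrt_le_sqrt (Finset.sum_le_sum fun i _ => ?_)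
        refine pow_le_pow_left₀ (norm_nonneg _) ?_ 2
        simpa using h i
    _ = √d * r := by
        rw [Finset.sum_const, Finset.card_univ, Fintype.card_fin, nsmul_eq_mul,
          Real.sqrt_mul (by positivity), Real.sqrt_sq hr]

theorem norm_sub_le_of_mem_cubeStratum (hl : 0 < l) {j : Fin d → Fin l} {x y : Space d}
    (hx : x ∈ cubeStratum d l j) (hy : y ∈ cubeStratum d l j) : ‖x - y‖ ≤ √d * (1 / l) := by
  refine norm_sub_le_of_coord (by positivity) fun i => ?_
  obtain ⟨h1, h2⟩ := sideInterval_bounds hl (mem_cubeStratum.1 hx i)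
  obtain ⟨h3, h4⟩ := sideInterval_bounds hl (mem_cubeStratum.1 hy i)
  rw [add_div] at h2 h4
  rw [abs_le]
  constructor <;> linarith

theorem norm_le_of_mem_unitCube {x : Space d} (hx : x ∈ unitCube d) : ‖x - 0‖ ≤ √d * 1 :=
  norm_sub_le_of_coord zero_le_one fun i => by
    have := hx i
    simp only [PiLp.zero_apply, sub_zero]
    rw [abs_of_nonneg this.1]
    exact this.2

end Geometry

/-! ### Hölder functions on the cube. -/

section Holder

variable {d l : ℕ} {M α : ℝ} {g : Space d → ℝ}

/-- Compare the origin with the vertex `(1, …, 1)`, which differs from it because `d ≥ 1`. -/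
theorem StratMC.IsHolder.nonneg (hd : 1 ≤ d) (hg : IsHolder M α g) : 0 ≤ M := by
  set e : Space d := WithLp.toLp 2 fun _ => 1
  have he : e ∈ unitCube d := fun i => by simp [e]
  have h := (abs_nonneg _).trans (hg e he 0 zero_mem_unitCube)
  have hpos : 0 < ‖e - 0‖ := by
    rw [sub_zero, norm_pos_iff]
    intro h0
    have : e ⟨0, hd⟩ = 0 := by rw [h0]; rfl
    simp [e] at this
  exact nonneg_of_mul_nonneg_left h (Real.rpow_pos_of_pos hpos α)

theorem StratMC.IsHolder.continuousOn (hα : 0 < α) (hg : IsHolder M α g) :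
    ContinuousOn g (unitCube d) := by
  intro x hx
  rw [ContinuousWithinAt, tendsto_iff_norm_sub_tendsto_zero]
  have hc : Continuous fun y : Space d => M * ‖y - x‖ ^ α := by
    refine continuous_const.mul ((continuous_norm.comp (continuous_id.sub continuous_const)).rpow_const
      fun _ => Or.inr hα.le)
  have h0 := (hc.tendsto x).mono_left (nhdsWithin_le_nhds (s := unitCube d))
  simp only [sub_self, norm_zero, Real.zero_rpow hα.ne', mul_zero] at h0
  refine squeeze_zero' (.of_forall fun _ => norm_nonneg _) ?_ h0
  filter_upwards [self_mem_nhdsWithin] with y hy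
  exact hg y hy x hx

/-- Nothing is known about `g` outside the cube, so it is cut off there to obtain a globally
measurable function. -/
theorem StratMC.IsHolder.measurable_indicator (hα : 0 < α) (hg : IsHolder M α g) :
    Measurable ((unitCube d).indicator g) := by
  classical
  rw [← Set.piecewise_eq_indicator]
  exact (hg.continuousOn hα).measurable_piecewise continuousOn_const measurableSet_unitCube

theorem sqrt_mul_one_rpow : (√(d : ℝ) * 1) ^ α = (d : ℝ) ^ (α / 2) := by
  rw [mul_one, Real.sqrt_eq_rpow, ← Real.rpow_mul (Nat.cast_nonneg d)]
  ring_nf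

theorem StratMC.IsHolder.abs_le (hd : 1 ≤ d) (hα : 0 < α) (hg : IsHolder M α g) {x : Space d}
    (hx : x ∈ unitCube d) : |g x| ≤ |g 0| + M * (d : ℝ) ^ (α / 2) := by
  have h1 := hg x hx 0 zero_mem_unitCube
  have h2 : ‖x - 0‖ ^ α ≤ (d : ℝ) ^ (α / 2) := by
    rw [← sqrt_mul_one_rpow]
    exact Real.rpow_le_rpow (norm_nonneg _) (norm_le_of_mem_unitCube hx) hα.le
  have h3 := mul_le_mul_of_nonneg_left h2 (hg.nonneg hd)
  have h4 := abs_sub_abs_le_abs_sub (g x) (g 0)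
  linarith

/-- A bound for the oscillation of a Hölder function in a cube of side `1 / l`. -/
noncomputable def oscBound (d l : ℕ) (M α : ℝ) : ℝ := M * (√d * (1 / l)) ^ α

theorem StratMC.IsHolder.abs_sub_le (hd : 1 ≤ d) (hl : 0 < l) (hα : 0 < α) (hg : IsHolder M α g)
    {j : Fin d → Fin l} {x y : Space d} (hx : x ∈ cubeStratum d l j) (hy : y ∈ cubeStratum d l j) :
    |g x - g y| ≤ oscBound d l M α :=
  (hg x hx.1 y hy.1).trans (mul_le_mul_of_nonneg_left (Real.rpow_le_rpow (norm_nonneg _)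
    (norm_sub_le_of_mem_cubeStratum hl hx hy) hα.le) (hg.nonneg hd))

theorem oscBound_nonneg (hM : 0 ≤ M) : 0 ≤ oscBound d l M α := by
  unfold oscBound; positivity

theorem oscBound_le (hM : 0 ≤ M) (hl : 0 < l) (hα : 0 < α) :
    oscBound d l M α ≤ M * (d : ℝ) ^ (α / 2) := by
  rw [← sqrt_mul_one_rpow]
  unfold oscBound
  have : (1 : ℝ) / l ≤ 1 := by
    rw [div_le_one (by exact_mod_cast hl)]
    exact_mod_cast hl
  gcongr

theorem StratMC.IsHolder.integrableOn (hd : 1 ≤ d) (hα : 0 < α) (hg : IsHolder M α g)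
    {S : Set (Space d)} (hS : MeasurableSet S) (hSc : S ⊆ unitCube d) (hv : volume S ≠ ⊤) :
    IntegrableOn g S := by
  have : IsFiniteMeasure (volume.restrict S) := ⟨by simpa using hv.lt_top⟩
  refine Integrable.of_bound (C := |g 0| + M * (d : ℝ) ^ (α / 2)) ?_ ?_
  · exact ((hg.continuousOn hα).mono hSc).aestronglyMeasurable hS
  · filter_upwards [ae_restrict_mem hS] with x hx
    exact hg.abs_le hd hα (hSc hx)

end Holder

/-! ### The fourth moment of the noise. -/

section FourthMoment

/-- A second order lower bound with an error uniform in `u`: the Taylor remainder has the wrong sign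
only for `u < 0`, where `|l u| ≤ l`. It is applied to `u = ε² - 1`. -/
theorem one_add_add_le_exp_of_neg_le {u l : ℝ} (hl : 0 ≤ l) (hu : -1 ≤ u) :
    1 + l * u + l ^ 2 * u ^ 2 / 2 - l ^ 3 / 6 ≤ Real.exp (l * u) := by
  rcases le_total 0 u with h | h
  · have h1 := Real.quadratic_le_exp_of_nonneg (mul_nonneg hl h)
    have : 0 ≤ l ^ 3 := by positivity
    nlinarith
  · set y := -(l * u) with hy
    have hy0 : 0 ≤ y := by rw [hy]; nlinarith
    have hyl : y ≤ l := by rw [hy]; nlinarith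
    have h1 : Real.exp y * (1 - y + y ^ 2 / 2 - y ^ 3 / 6) ≤ 1 := by
      have hder : ∀ z : ℝ, HasDerivAt
          (fun z => Real.exp z * (1 - z + z ^ 2 / 2 - z ^ 3 / 6)) (-(Real.exp z * z ^ 3 / 6)) z := by
        intro z
        have h2 : HasDerivAt (fun z : ℝ => 1 - z + z ^ 2 / 2 - z ^ 3 / 6)
            (-1 + z - z ^ 2 / 2) z := by
          have h3 := (((hasDerivAt_id z).const_sub 1).add (((hasDerivAt_id z).pow 2).div_const 2)).sub
            (((hasDerivAt_id z).pow 3).div_const 6)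
          refine h3.congr_deriv ?_
          simp
          ring
        refine ((Real.hasDerivAt_exp z).mul h2).congr_deriv ?_
        ring
      have hanti : AntitoneOn (fun z => Real.exp z * (1 - z + z ^ 2 / 2 - z ^ 3 / 6))
          (Set.Ici 0) := by
        refine antitoneOn_of_deriv_nonpos (convex_Ici 0)
          (fun z _ => (hder z).continuousAt.continuousWithinAt)
          (fun z _ => (hder z).differentiableAt.differentiableWithinAt) fun z hz => ?_
        rw [interior_Ici] at hz
        have hz' : 0 < z := hz
        rw [(hder z).deriv]
        have : 0 ≤ Real.exp z * z ^ 3 / 6 := by positivity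
        linarith
      have := hanti (Set.mem_Ici.2 le_rfl) (Set.mem_Ici.2 hy0) hy0
      simpa using this
    have h2 : 1 - y + y ^ 2 / 2 - y ^ 3 / 6 ≤ Real.exp (-y) := by
      rw [Real.exp_neg, ← one_div, le_div_iff₀' (Real.exp_pos y)]
      exact h1
    have h3 : y ^ 3 ≤ l ^ 3 := pow_le_pow_left₀ hy0 hyl 3
    have e : l * u = -y := by rw [hy]; ring
    have e2 : l ^ 2 * u ^ 2 = y ^ 2 := by rw [hy]; ring
    rw [e, e2]
    linarith

/-- Both sides of the exponential moment bound are `1 + O(λ²)`, the first order term vanishing as `E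
ε² = 1`. Comparing the coefficients of `λ²` as `λ → 0` gives `E (ε² - 1)² ≤ 1`. -/
theorem integral_pow_four_le_two {m : Measure ℝ} [IsProbabilityMeasure m] {b : ℝ} (hb : 0 < b)
    (h2 : Integrable (fun e : ℝ => e ^ 2) m) (h21 : ∫ e, e ^ 2 ∂m = 1)
    (hexp : ∀ l : ℝ, 0 ≤ l → l < 1 / b → Integrable (fun e : ℝ => Real.exp (l * e ^ 2 - l)) m ∧
      ∫ e, Real.exp (l * e ^ 2 - l) ∂m ≤ Real.exp (l ^ 2 / (2 * (1 - l * b)))) :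
    Integrable (fun e : ℝ => e ^ 4) m ∧ ∫ e, e ^ 4 ∂m ≤ 2 := by
  have hpt : ∀ l e : ℝ, 0 ≤ l → l ^ 2 / 2 * (e ^ 2 - 1) ^ 2 ≤
      Real.exp (l * e ^ 2 - l) - 1 - l * (e ^ 2 - 1) + l ^ 3 / 6 := by
    intro l e hl
    have := one_add_add_le_exp_of_neg_le (u := e ^ 2 - 1) hl (by nlinarith [sq_nonneg e])
    rw [mul_sub, mul_one] at this
    linarith
  have hu1 : Integrable (fun e : ℝ => e ^ 2 - 1) m := h2.sub (integrable_const _)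
  have hu0 : ∫ e, (e ^ 2 - 1) ∂m = 0 := by
    rw [integral_sub h2 (integrable_const _), h21]; simp
  have hG : ∀ l : ℝ, 0 ≤ l → l < 1 / b → Integrable (fun e : ℝ =>
      Real.exp (l * e ^ 2 - l) - 1 - l * (e ^ 2 - 1) + l ^ 3 / 6) m := fun l h0 h1 =>
    (((hexp l h0 h1).1.sub (integrable_const _)).sub (hu1.const_mul l)).add (integrable_const _)
  have hu2 : Integrable (fun e : ℝ => (e ^ 2 - 1) ^ 2) m := by
    have hl0 : 0 < 1 / (2 * b) := by positivity
    have hl1 : 1 / (2 * b) < 1 / b := by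
      apply one_div_lt_one_div_of_lt hb; linarith
    set l := 1 / (2 * b)
    have : Integrable (fun e : ℝ => l ^ 2 / 2 * (e ^ 2 - 1) ^ 2) m := by
      refine (hG l hl0.le hl1).mono (by fun_prop) (.of_forall fun e => ?_)
      rw [Real.norm_of_nonneg (by positivity)]
      exact (hpt l e hl0.le).trans (le_abs_self _)
    have h3 := this.const_mul (2 / l ^ 2)
    refine h3.congr (.of_forall fun e => ?_)
    dsimp only
    field_simp
  have hbound : ∀ l : ℝ, 0 < l → l < 1 / b → ∫ e, (e ^ 2 - 1) ^ 2 ∂m ≤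
      2 / l ^ 2 * (Real.exp (l ^ 2 / (2 * (1 - l * b))) - 1) + l / 3 := by
    intro l h0 h1
    have h3 := integral_mono (hu2.const_mul (l ^ 2 / 2)) (hG l h0.le h1) fun e => hpt l e h0.le
    have hi1 := (hexp l h0.le h1).1
    have hi2 := hi1.sub (integrable_const (1 : ℝ))
    have hi3 := hi2.sub (hu1.const_mul l)
    have hGi : ∫ e, (Real.exp (l * e ^ 2 - l) - 1 - l * (e ^ 2 - 1) + l ^ 3 / 6) ∂m =
        (∫ e, Real.exp (l * e ^ 2 - l) ∂m) - 1 + l ^ 3 / 6 := by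
      refine (integral_add' hi3 (integrable_const (l ^ 3 / 6))).trans ?_
      rw [integral_sub' hi2 (hu1.const_mul l), integral_sub' hi1 (integrable_const _),
        integral_const_mul, hu0]
      simp
    rw [hGi, integral_const_mul] at h3
    have h4 := (hexp l h0.le h1).2
    have h5 : l ^ 2 / 2 * ∫ e, (e ^ 2 - 1) ^ 2 ∂m ≤
        Real.exp (l ^ 2 / (2 * (1 - l * b))) - 1 + l ^ 3 / 6 := by linarith
    have h6 := mul_le_mul_of_nonneg_left h5 (by positivity : 0 ≤ 2 / l ^ 2)
    have e1 : 2 / l ^ 2 * (l ^ 2 / 2 * ∫ e, (e ^ 2 - 1) ^ 2 ∂m) = ∫ e, (e ^ 2 - 1) ^ 2 ∂m := by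
      field_simp
    rw [e1] at h6
    refine h6.trans_eq ?_
    field_simp
    ring
  have hu2le : ∫ e, (e ^ 2 - 1) ^ 2 ∂m ≤ 1 := by
    have hlim : Filter.Tendsto (fun l : ℝ => 1 / (1 - l * b) + l ^ 2 / (2 * (1 - l * b) ^ 2) + l / 3)
        (nhdsWithin 0 (Set.Ioi 0)) (nhds 1) := by
      have hc : ContinuousAt
          (fun l : ℝ => 1 / (1 - l * b) + l ^ 2 / (2 * (1 - l * b) ^ 2) + l / 3) 0 := by
        refine ContinuousAt.add (ContinuousAt.add ?_ ?_) (by fun_prop)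
        · exact ContinuousAt.div (by fun_prop) (by fun_prop) (by simp)
        · exact ContinuousAt.div (by fun_prop) (by fun_prop) (by simp)
      have := hc.tendsto.mono_left (nhdsWithin_le_nhds (s := Set.Ioi 0))
      simpa using this
    refine ge_of_tendsto hlim ?_
    have hsm : 0 < min 1 (1 / (2 * b)) := by positivity
    filter_upwards [Ioo_mem_nhdsGT hsm] with l hl
    have hl0 : 0 < l := hl.1
    have hl1 : l < 1 := hl.2.trans_le (min_le_left _ _)
    have hlb : l < 1 / (2 * b) := hl.2.trans_le (min_le_right _ _)
    have hlb2 : l * b < 1 / 2 := by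
      rw [lt_div_iff₀ (by positivity)] at hlb
      linarith
    have hlb3 : l < 1 / b := by
      rw [lt_div_iff₀ hb]; linarith
    refine (hbound l hl0 hlb3).trans ?_
    set z := l ^ 2 / (2 * (1 - l * b)) with hz
    have h1b : 0 < 1 - l * b := by linarith
    have hz0 : 0 ≤ z := by positivity
    have hz1 : z ≤ 1 := by
      rw [hz, div_le_one (by positivity)]
      nlinarith
    have hexpz : Real.exp z - 1 ≤ z + z ^ 2 := by
      have := Real.abs_exp_sub_one_sub_id_le (x := z) (by rwa [abs_of_nonneg hz0])
      have := (abs_le.1 this).2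
      linarith
    have h6 : 2 / l ^ 2 * (Real.exp z - 1) ≤ 2 / l ^ 2 * (z + z ^ 2) := by gcongr
    have e : 2 / l ^ 2 * (z + z ^ 2) = 1 / (1 - l * b) + l ^ 2 / (2 * (1 - l * b) ^ 2) := by
      rw [hz]
      field_simp
    linarith
  have e4 : (fun e : ℝ => e ^ 4) = fun e => (e ^ 2 - 1) ^ 2 + 2 * e ^ 2 - 1 := by
    funext e; ring
  rw [e4]
  have hi := hu2.add (h2.const_mul 2)
  refine ⟨hi.sub (integrable_const _), ?_⟩
  rw [integral_sub (f := fun e => (e ^ 2 - 1) ^ 2 + 2 * e ^ 2) hi (integrable_const _),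
    integral_add hu2 (h2.const_mul 2), integral_const_mul, h21]
  simp
  linarith

variable {m : Measure ℝ} [IsProbabilityMeasure m]
  (h1 : Integrable (fun e : ℝ => e) m) (h10 : ∫ e, e ∂m = 0)
  (h2 : Integrable (fun e : ℝ => e ^ 2) m) (h21 : ∫ e, e ^ 2 ∂m = 1)
include h1 h10

theorem integral_affine (c t : ℝ) : ∫ e, (c + t * e) ∂m = c := by
  rw [integral_add (integrable_const _) (h1.const_mul t), integral_const_mul, h10]
  simp

include h2 h21

theorem integral_affine_sq (c t : ℝ) : ∫ e, (c + t * e) ^ 2 ∂m = c ^ 2 + t ^ 2 := by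
  have e : ∀ e : ℝ, (c + t * e) ^ 2 = c ^ 2 + 2 * c * t * e + t ^ 2 * e ^ 2 := fun e => by ring
  simp only [e]
  have a := (integrable_const (μ := m) (c ^ 2)).add (h1.const_mul (2 * c * t))
  rw [integral_add (f := fun e => c ^ 2 + 2 * c * t * e) a (h2.const_mul _),
    integral_add (integrable_const _) (h1.const_mul _), integral_const_mul, integral_const_mul,
    h10, h21]
  simp

/-- The third moment is eliminated by adding `2 t² e² (c - t e)² ≥ 0`, which cancels the cubic term
of the expansion. -/
theorem integral_affine_pow_four (h4 : Integrable (fun e : ℝ => e ^ 4) m)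
    (h42 : ∫ e, e ^ 4 ∂m ≤ 2) (c t : ℝ) :
    Integrable (fun e => (c + t * e) ^ 4) m ∧
      ∫ e, (c + t * e) ^ 4 ∂m ≤ c ^ 4 + 8 * c ^ 2 * t ^ 2 + 6 * t ^ 4 := by
  have a := (integrable_const (μ := m) (c ^ 4)).add (h1.const_mul (4 * c ^ 3 * t))
  have b := a.add (h2.const_mul (8 * c ^ 2 * t ^ 2))
  have i := b.add (h4.const_mul (3 * t ^ 4))
  have hle : ∀ e : ℝ, (c + t * e) ^ 4 ≤
      c ^ 4 + 4 * c ^ 3 * t * e + 8 * c ^ 2 * t ^ 2 * e ^ 2 + 3 * t ^ 4 * e ^ 4 := fun e => by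
    nlinarith [mul_nonneg (mul_nonneg (sq_nonneg t) (sq_nonneg e)) (sq_nonneg (c - t * e))]
  have hi : Integrable (fun e => (c + t * e) ^ 4) m := by
    refine i.mono (by fun_prop) (.of_forall fun e => ?_)
    rw [Real.norm_of_nonneg (by positivity)]
    exact (hle e).trans (le_abs_self _)
  refine ⟨hi, (integral_mono hi i hle).trans ?_⟩
  refine (integral_add' b (h4.const_mul (3 * t ^ 4))).trans_le ?_
  rw [integral_add' a (h2.const_mul _), integral_add' (integrable_const _) (h1.const_mul _),
    integral_const_mul, integral_const_mul, integral_const_mul, h10, h21]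
  simp
  have : 0 ≤ t ^ 4 := by positivity
  nlinarith

end FourthMoment

/-! ### Means and variances of the strata; the bias. -/

section Stratum

variable {d l : ℕ} {f s : Space d → ℝ} {ν : Kernel (Space d) ℝ} [IsMarkovKernel ν] {M α b : ℝ}

theorem volume_cubeStratum_ne_top (k : Fin d → Fin l) : volume (cubeStratum d l k) ≠ ⊤ := by
  rw [volume_cubeStratum]; finiteness

theorem weight_cubeStratum_pos (hl : 0 < l) (k : Fin d → Fin l) : 0 < weight (cubeStratum d l) k := by
  rw [weight_cubeStratum]; positivity

theorem volume_cubeStratum_ne_zero (hl : 0 < l) (k : Fin d → Fin l) :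
    volume (cubeStratum d l k) ≠ 0 := by
  have := (weight_cubeStratum_pos hl k).ne'
  rw [weight, measureReal_def] at this
  exact fun h => this (by rw [h]; rfl)

/-- The average over a stratum. -/
noncomputable def stratumAvg (k : Fin d → Fin l) (g : Space d → ℝ) : ℝ :=
  1 / weight (cubeStratum d l) k * ∫ x in cubeStratum d l k, g x

theorem stratumAvg_const (hl : 0 < l) (k : Fin d → Fin l) (c : ℝ) :
    stratumAvg k (fun _ => c) = c := by
  have := (weight_cubeStratum_pos hl k).ne'
  rw [stratumAvg, setIntegral_const, smul_eq_mul]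
  rw [show volume.real (cubeStratum d l k) = weight (cubeStratum d l) k from rfl]
  field_simp

theorem stratumAvg_mono (hl : 0 < l) {k : Fin d → Fin l} {g h : Space d → ℝ}
    (hg : IntegrableOn g (cubeStratum d l k)) (hh : IntegrableOn h (cubeStratum d l k))
    (hgh : ∀ x ∈ cubeStratum d l k, g x ≤ h x) : stratumAvg k g ≤ stratumAvg k h := by
  have := weight_cubeStratum_pos hl k
  exact mul_le_mul_of_nonneg_left (setIntegral_mono_on hg hh (measurableSet_cubeStratum k) hgh)
    (by positivity)

theorem stratumAvg_congr {k : Fin d → Fin l} {g h : Space d → ℝ}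
    (hgh : ∀ x ∈ cubeStratum d l k, g x = h x) : stratumAvg k g = stratumAvg k h := by
  rw [stratumAvg, stratumAvg, setIntegral_congr_fun (measurableSet_cubeStratum k) hgh]

theorem stratumAvg_add {k : Fin d → Fin l} {g h : Space d → ℝ}
    (hg : IntegrableOn g (cubeStratum d l k)) (hh : IntegrableOn h (cubeStratum d l k)) :
    stratumAvg k (fun x => g x + h x) = stratumAvg k g + stratumAvg k h := by
  rw [stratumAvg, integral_add hg hh, mul_add]; rfl

theorem stratumAvg_const_mul {k : Fin d → Fin l} (c : ℝ) (g : Space d → ℝ) :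
    stratumAvg k (fun x => c * g x) = c * stratumAvg k g := by
  rw [stratumAvg, integral_const_mul, stratumAvg]; ring

theorem stratumAvg_le (hl : 0 < l) {k : Fin d → Fin l} {g : Space d → ℝ} {c : ℝ}
    (hg : IntegrableOn g (cubeStratum d l k)) (h : ∀ x ∈ cubeStratum d l k, g x ≤ c) :
    stratumAvg k g ≤ c := by
  rw [← stratumAvg_const hl k c]
  exact stratumAvg_mono hl hg (integrableOn_const (volume_cubeStratum_ne_top k)) h

theorem le_stratumAvg (hl : 0 < l) {k : Fin d → Fin l} {g : Space d → ℝ} {c : ℝ}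
    (hg : IntegrableOn g (cubeStratum d l k)) (h : ∀ x ∈ cubeStratum d l k, c ≤ g x) :
    c ≤ stratumAvg k g := by
  rw [← stratumAvg_const hl k c]
  exact stratumAvg_mono hl (integrableOn_const (volume_cubeStratum_ne_top k)) hg h

theorem integral_cond_cubeStratum (k : Fin d → Fin l) (g : Space d → ℝ) :
    ∫ x, g x ∂(volume[|cubeStratum d l k]) = stratumAvg k g := by
  rw [ProbabilityTheory.cond, integral_smul_measure, stratumAvg, weight, measureReal_def, ENNReal.toReal_inv,
    one_div, smul_eq_mul]

theorem isProbabilityMeasure_cond_cubeStratum (hl : 0 < l) (k : Fin d → Fin l) :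
    IsProbabilityMeasure (volume[|cubeStratum d l k]) :=
  cond_isProbabilityMeasure_of_finite (volume_cubeStratum_ne_zero hl k) (volume_cubeStratum_ne_top k)

theorem integrableOn_of_continuousOn_bounded {k : Fin d → Fin l} {g : Space d → ℝ} {C : ℝ}
    (hg : ContinuousOn g (cubeStratum d l k)) (hC : ∀ x ∈ cubeStratum d l k, |g x| ≤ C) :
    IntegrableOn g (cubeStratum d l k) := by
  have : IsFiniteMeasure (volume.restrict (cubeStratum d l k)) :=
    ⟨by simpa using (volume_cubeStratum_ne_top k).lt_top⟩
  refine Integrable.of_bound (C := C) (hg.aestronglyMeasurable (measurableSet_cubeStratum k)) ?_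
  filter_upwards [ae_restrict_mem (measurableSet_cubeStratum k)] with x hx
  exact hC x hx

variable (hd : 1 ≤ d) (hl : 0 < l) (hα : 0 < α) (hs : ∀ x ∈ unitCube d, 0 ≤ s x)
  (hfM : IsHolder M α f) (hsM : IsHolder M α s) (hν : NoiseAssumption b ν) (k : Fin d → Fin l)
include hd hl hα hs hfM hsM hν

theorem stratumMean_eq : stratumMean f s ν (cubeStratum d l) k = stratumAvg k f :=
  stratumAvg_congr fun x hx => by
    have := hν.mean_zero x hx.1
    exact integral_affine this.1 this.2 _ _

theorem stratumVar_eq : stratumVar f s ν (cubeStratum d l) k =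
    stratumAvg k fun x => (f x - stratumMean f s ν (cubeStratum d l) k) ^ 2 + s x ^ 2 :=
  stratumAvg_congr fun x hx => by
    have h1 := hν.mean_zero x hx.1
    have h2 := hν.variance_one x hx.1
    have := integral_affine_sq h1.1 h1.2 h2.1 h2.2 (f x - stratumMean f s ν (cubeStratum d l) k) (s x)
    rw [← this]
    congr 1
    ext e
    ring

theorem abs_sub_stratumMean_le {x : Space d} (hx : x ∈ cubeStratum d l k) :
    |f x - stratumMean f s ν (cubeStratum d l) k| ≤ oscBound d l M α := by
  rw [stratumMean_eq hd hl hα hs hfM hsM hν]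
  have hi := hfM.integrableOn hd hα (measurableSet_cubeStratum k) (cubeStratum_subset k)
    (volume_cubeStratum_ne_top k)
  have hosc := fun y hy => abs_le.1 (hfM.abs_sub_le hd hl hα hx (y := y) hy)
  rw [abs_le]
  constructor
  · have := stratumAvg_le hl (c := f x + oscBound d l M α) hi fun y hy => by
      linarith [(hosc y hy).1]
    linarith
  · have := le_stratumAvg hl (c := f x - oscBound d l M α) hi fun y hy => by
      linarith [(hosc y hy).2]
    linarith

theorem oscBound_le_holderBound : oscBound d l M α ≤ holderBound f s M α := by
  refine (oscBound_le (hfM.nonneg hd) hl hα).trans ?_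
  unfold holderBound
  linarith [(abs_nonneg (f 0)).trans (le_max_left |f 0| (s 0))]

theorem le_holderBound {x : Space d} (hx : x ∈ unitCube d) : s x ≤ holderBound f s M α := by
  have h := hsM.abs_le hd hα hx
  have h0 := abs_of_nonneg (hs 0 zero_mem_unitCube)
  unfold holderBound
  linarith [le_max_right |f 0| (s 0), le_abs_self (s x)]

theorem continuousOn_stratum_integrand :
    ContinuousOn (fun x => (f x - stratumMean f s ν (cubeStratum d l) k) ^ 2 + s x ^ 2)
      (cubeStratum d l k) :=
  ((((hfM.continuousOn hα).mono (cubeStratum_subset k)).sub continuousOn_const).pow 2).add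
    (((hsM.continuousOn hα).mono (cubeStratum_subset k)).pow 2)

theorem stratum_integrand_bounds {x : Space d} (hx : x ∈ cubeStratum d l k) :
    (f x - stratumMean f s ν (cubeStratum d l) k) ^ 2 ≤ holderBound f s M α ^ 2 ∧
      s x ^ 2 ≤ holderBound f s M α ^ 2 := by
  have h1 := (abs_sub_stratumMean_le hd hl hα hs hfM hsM hν k hx).trans
    (oscBound_le_holderBound hd hl hα hs hfM hsM hν)
  have h2 := le_holderBound hd hl hα hs hfM hsM hν hx.1
  exact ⟨by rw [← sq_abs]; exact pow_le_pow_left₀ (abs_nonneg _) h1 2,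
    pow_le_pow_left₀ (hs x hx.1) h2 2⟩

theorem integrableOn_stratum_integrand :
    IntegrableOn (fun x => (f x - stratumMean f s ν (cubeStratum d l) k) ^ 2 + s x ^ 2)
      (cubeStratum d l k) := by
  refine integrableOn_of_continuousOn_bounded (C := 2 * holderBound f s M α ^ 2)
    (continuousOn_stratum_integrand hd hl hα hs hfM hsM hν k) fun x hx => ?_
  have := stratum_integrand_bounds hd hl hα hs hfM hsM hν k hx
  rw [abs_of_nonneg (by positivity)]
  linarith

theorem stratumVar_nonneg : 0 ≤ stratumVar f s ν (cubeStratum d l) k := by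
  rw [stratumVar_eq hd hl hα hs hfM hsM hν]
  exact le_stratumAvg hl (integrableOn_stratum_integrand hd hl hα hs hfM hsM hν k)
    fun x _ => by positivity

theorem stratumVar_le : stratumVar f s ν (cubeStratum d l) k ≤ 2 * holderBound f s M α ^ 2 := by
  rw [stratumVar_eq hd hl hα hs hfM hsM hν]
  refine stratumAvg_le hl (integrableOn_stratum_integrand hd hl hα hs hfM hsM hν k) fun x hx => ?_
  have := stratum_integrand_bounds hd hl hα hs hfM hsM hν k hx
  linarith

/-- Cauchy–Schwarz for the average of `s`, in the form of averaging `2 a s - a² ≤ s²`. -/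
theorem stratumAvg_le_stratumStd :
    0 ≤ stratumAvg k s ∧ stratumAvg k s ≤ stratumStd f s ν (cubeStratum d l) k := by
  have hi := hsM.integrableOn hd hα (measurableSet_cubeStratum k) (cubeStratum_subset k)
    (volume_cubeStratum_ne_top k)
  refine ⟨le_stratumAvg hl hi fun x hx => hs x hx.1, Real.le_sqrt_of_sq_le ?_⟩
  set a := stratumAvg k s with ha
  have h1 : stratumAvg k (fun x => (2 * a) * s x + -a ^ 2) ≤
      stratumVar f s ν (cubeStratum d l) k := by
    rw [stratumVar_eq hd hl hα hs hfM hsM hν]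
    refine stratumAvg_mono hl ((hi.const_mul _).add (integrableOn_const (volume_cubeStratum_ne_top k)))
      (integrableOn_stratum_integrand hd hl hα hs hfM hsM hν k) fun x hx => ?_
    nlinarith [sq_nonneg (s x - a), sq_nonneg (f x - stratumMean f s ν (cubeStratum d l) k)]
  rw [stratumAvg_add (hi.const_mul _) (integrableOn_const (volume_cubeStratum_ne_top k)),
    stratumAvg_const_mul, stratumAvg_const hl, ← ha] at h1
  nlinarith

/-- On the cube `s ≤ a + R` and `|f - μ| ≤ R`, so `σ² ≤ (a + R) a + R² ≤ (a + R)²`. Using `s² ≤ (a +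
R) s` keeps the excess of `σ` over the average at first order in `R`. -/
theorem stratumStd_le :
    stratumStd f s ν (cubeStratum d l) k ≤ stratumAvg k s + oscBound d l M α := by
  have hi := hsM.integrableOn hd hα (measurableSet_cubeStratum k) (cubeStratum_subset k)
    (volume_cubeStratum_ne_top k)
  have hR := oscBound_nonneg (d := d) (l := l) (α := α) (hfM.nonneg hd)
  have ha0 := (stratumAvg_le_stratumStd hd hl hα hs hfM hsM hν k).1
  set R := oscBound d l M α
  set a := stratumAvg k s with ha
  refine (Real.sqrt_le_left (by positivity)).2 ?_
  have hsa : ∀ x ∈ cubeStratum d l k, s x ≤ a + R := fun x hx => by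
    have := le_stratumAvg hl (c := s x - R) hi fun y hy => by
      linarith [(abs_le.1 (hsM.abs_sub_le hd hl hα hx hy)).2]
    linarith
  have h1 : stratumVar f s ν (cubeStratum d l) k ≤
      stratumAvg k (fun x => (a + R) * s x + R ^ 2) := by
    rw [stratumVar_eq hd hl hα hs hfM hsM hν]
    refine stratumAvg_mono hl (integrableOn_stratum_integrand hd hl hα hs hfM hsM hν k)
      ((hi.const_mul _).add (integrableOn_const (volume_cubeStratum_ne_top k))) fun x hx => ?_
    have h2 := abs_sub_stratumMean_le hd hl hα hs hfM hsM hν k hx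
    have h3 : (f x - stratumMean f s ν (cubeStratum d l) k) ^ 2 ≤ R ^ 2 := by
      rw [← sq_abs]; exact pow_le_pow_left₀ (abs_nonneg _) h2 2
    nlinarith [hs x hx.1, hsa x hx]
  rw [stratumAvg_add (hi.const_mul _) (integrableOn_const (volume_cubeStratum_ne_top k)),
    stratumAvg_const_mul, stratumAvg_const hl, ← ha] at h1
  nlinarith

omit k

theorem integral_unitCube_eq : ∫ x in unitCube d, s x =
    ∑ k, weight (cubeStratum d l) k * stratumAvg k s := by
  rw [← iUnion_cubeStratum hl, integral_iUnion_fintype (fun k => measurableSet_cubeStratum k)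
    pairwise_disjoint_cubeStratum fun k => hsM.integrableOn hd hα (measurableSet_cubeStratum k)
      (cubeStratum_subset k) (volume_cubeStratum_ne_top k)]
  refine Finset.sum_congr rfl fun k _ => ?_
  have := (weight_cubeStratum_pos hl k).ne'
  rw [stratumAvg]
  field_simp

theorem integral_le_totalStd : 0 ≤ ∫ x in unitCube d, s x ∧
    ∫ x in unitCube d, s x ≤ totalStd f s ν (cubeStratum d l) := by
  rw [integral_unitCube_eq hd hl hα hs hfM hsM hν]
  have hw := fun k => (weight_cubeStratum_pos (d := d) hl k).le
  have h := stratumAvg_le_stratumStd hd hl hα hs hfM hsM hν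
  exact ⟨Finset.sum_nonneg fun k _ => mul_nonneg (hw k) (h k).1,
    Finset.sum_le_sum fun k _ => mul_le_mul_of_nonneg_left (h k).2 (hw k)⟩

theorem sum_weight_cubeStratum : ∑ k, weight (cubeStratum d l) k = 1 := by
  simp only [weight_cubeStratum, Finset.sum_const, Finset.card_univ, Fintype.card_fun,
    Fintype.card_fin, nsmul_eq_mul]
  have : ((l ^ d : ℕ) : ℝ) ≠ 0 := by positivity
  field_simp

theorem totalStd_le : totalStd f s ν (cubeStratum d l) ≤
    (∫ x in unitCube d, s x) + oscBound d l M α := by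
  rw [integral_unitCube_eq hd hl hα hs hfM hsM hν,
    ← one_mul (oscBound d l M α), ← sum_weight_cubeStratum hd hl hα hs hfM hsM hν, Finset.sum_mul,
    ← Finset.sum_add_distrib]
  refine Finset.sum_le_sum fun k _ => ?_
  rw [← mul_add]
  exact mul_le_mul_of_nonneg_left (stratumStd_le hd hl hα hs hfM hsM hν k)
    (weight_cubeStratum_pos hl k).le

end Stratum

/-! ### Moments of a random sample of a stratum. -/

section Sample

variable {d l : ℕ} {f s : Space d → ℝ} {ν : Kernel (Space d) ℝ} [IsMarkovKernel ν] {M α b : ℝ}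

/-- The centred sample as a function of the point and the noise, set to `-μ` outside the cube. -/
noncomputable def centredSample (f s : Space d → ℝ) (μ : ℝ) (p : Space d × ℝ) : ℝ :=
  (unitCube d).indicator f p.1 + (unitCube d).indicator s p.1 * p.2 - μ

variable (hd : 1 ≤ d) (hl : 0 < l) (hα : 0 < α) (hs : ∀ x ∈ unitCube d, 0 ≤ s x)
  (hfM : IsHolder M α f) (hsM : IsHolder M α s) (hν : NoiseAssumption b ν) (k : Fin d → Fin l)
include hd hl hα hs hfM hsM hν

theorem measurable_centredSample (μ : ℝ) : Measurable (centredSample f s μ) := by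
  have h1 := hfM.measurable_indicator hα
  have h2 := hsM.measurable_indicator hα
  unfold centredSample
  fun_prop

theorem isProbabilityMeasure_sampleLaw : IsProbabilityMeasure (sampleLaw ν (cubeStratum d l) k) := by
  have := isProbabilityMeasure_cond_cubeStratum hl k
  unfold sampleLaw
  infer_instance

theorem ae_mem_sampleLaw : ∀ᵐ p ∂(sampleLaw ν (cubeStratum d l) k), p.1 ∈ unitCube d := by
  have := isProbabilityMeasure_cond_cubeStratum hl k
  unfold sampleLaw
  have h : ∀ᵐ x ∂(volume[|cubeStratum d l k]), x ∈ unitCube d := by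
    filter_upwards [ae_cond_mem (measurableSet_cubeStratum k)] with x hx using hx.1
  have hfst : Measure.map Prod.fst ((volume[|cubeStratum d l k]) ⊗ₘ ν) =
      volume[|cubeStratum d l k] := Measure.fst_compProd _ _
  rw [← hfst] at h
  exact ae_of_ae_map measurable_fst.aemeasurable h

/-- With `|f x - μ|` and `s x` at most `F`, every quartic term gives up one factor `F²`. The
remaining factor averages to `σ_k²`, so that the fourth moment is proportional to the variance. -/
theorem integral_centredSample_pow_four {x : Space d} (hx : x ∈ cubeStratum d l k) :
    Integrable (fun e => centredSample f s (stratumMean f s ν (cubeStratum d l) k) (x, e) ^ 4) (ν x) ∧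
    ∫ e, centredSample f s (stratumMean f s ν (cubeStratum d l) k) (x, e) ^ 4 ∂(ν x) ≤
      9 * holderBound f s M α ^ 2 *
        ((f x - stratumMean f s ν (cubeStratum d l) k) ^ 2 + s x ^ 2) := by
  have h1 := hν.mean_zero x hx.1
  have h2 := hν.variance_one x hx.1
  have h4 := integral_pow_four_le_two hν.b_pos h2.1 h2.2 (hν.exp_moment_sq x hx.1)
  have h := integral_affine_pow_four h1.1 h1.2 h2.1 h2.2 h4.1 h4.2
    (f x - stratumMean f s ν (cubeStratum d l) k) (s x)
  have e : ∀ e : ℝ, centredSample f s (stratumMean f s ν (cubeStratum d l) k) (x, e) =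
      (f x - stratumMean f s ν (cubeStratum d l) k) + s x * e := fun e => by
    simp only [centredSample, Set.indicator_of_mem hx.1]; ring
  simp only [e]
  refine ⟨h.1, h.2.trans ?_⟩
  obtain ⟨hb1, hb2⟩ := stratum_integrand_bounds hd hl hα hs hfM hsM hν k hx
  set g := (f x - stratumMean f s ν (cubeStratum d l) k) ^ 2 with hg
  have hg0 : 0 ≤ g := by positivity
  have hs0 : 0 ≤ s x ^ 2 := by positivity
  have e1 : (f x - stratumMean f s ν (cubeStratum d l) k) ^ 4 = g * g := by rw [hg]; ring
  have e2 : s x ^ 4 = s x ^ 2 * s x ^ 2 := by ring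
  rw [e1, e2]
  nlinarith [mul_le_mul_of_nonneg_left hb1 hg0, mul_le_mul_of_nonneg_left hb2 hg0,
    mul_le_mul_of_nonneg_left hb2 hs0, mul_nonneg (sq_nonneg (holderBound f s M α)) hs0]

theorem memLp_centredSample :
    MemLp (centredSample f s (stratumMean f s ν (cubeStratum d l) k)) 4
      (sampleLaw ν (cubeStratum d l) k) := by
  have := isProbabilityMeasure_cond_cubeStratum hl k
  have hm := measurable_centredSample hd hl hα hs hfM hsM hν (stratumMean f s ν (cubeStratum d l) k)
  set ψ := centredSample f s (stratumMean f s ν (cubeStratum d l) k) with hψ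
  have hint : Integrable (fun p => ψ p ^ 4) (sampleLaw ν (cubeStratum d l) k) := by
    refine ⟨(hm.pow_const 4).aestronglyMeasurable, ?_⟩
    rw [hasFiniteIntegral_iff_norm]
    have e : ∀ p, ENNReal.ofReal ‖ψ p ^ 4‖ = ENNReal.ofReal (ψ p ^ 4) := fun p => by
      rw [Real.norm_of_nonneg (by positivity)]
    simp only [e]
    unfold sampleLaw
    rw [Measure.lintegral_compProd (hm.pow_const 4).ennreal_ofReal]
    have hle : ∀ᵐ x ∂(volume[|cubeStratum d l k]), ∫⁻ e, ENNReal.ofReal (ψ (x, e) ^ 4) ∂(ν x) ≤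
        ENNReal.ofReal (9 * holderBound f s M α ^ 2 * (2 * holderBound f s M α ^ 2)) := by
      filter_upwards [ae_cond_mem (measurableSet_cubeStratum k)] with x hx
      obtain ⟨h1, h2⟩ := integral_centredSample_pow_four hd hl hα hs hfM hsM hν k hx
      rw [← ofReal_integral_eq_lintegral_ofReal h1 (.of_forall fun e => by positivity)]
      refine ENNReal.ofReal_le_ofReal (h2.trans ?_)
      obtain ⟨hb1, hb2⟩ := stratum_integrand_bounds hd hl hα hs hfM hsM hν k hx
      gcongr
      linarith
    refine (lintegral_mono_ae hle).trans_lt ?_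
    simp
  refine (integrable_norm_rpow_iff hm.aestronglyMeasurable (p := 4) (by norm_num)
    (by norm_num)).1 (hint.congr (.of_forall fun p => ?_))
  have : (4 : ENNReal).toReal = ((4 : ℕ) : ℝ) := by norm_num
  simp only [this, Real.rpow_natCast, Real.norm_eq_abs]
  exact ((even_two_mul 2).pow_abs _).symm

theorem integral_centredSample {p : ℕ} (hp : p ≤ 4) :
    ∫ q, centredSample f s (stratumMean f s ν (cubeStratum d l) k) q ^ p
        ∂(sampleLaw ν (cubeStratum d l) k) =
      stratumAvg k fun x => ∫ e,
        centredSample f s (stratumMean f s ν (cubeStratum d l) k) (x, e) ^ p ∂(ν x) := by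
  have := isProbabilityMeasure_cond_cubeStratum hl k
  have := isProbabilityMeasure_sampleLaw hd hl hα hs hfM hsM hν k
  have hi := integrable_pow_of_memLp_four (memLp_centredSample hd hl hα hs hfM hsM hν k) hp
  rw [← integral_cond_cubeStratum]
  exact Measure.integral_compProd hi

theorem integral_centredSample_one :
    ∫ q, centredSample f s (stratumMean f s ν (cubeStratum d l) k) q
        ∂(sampleLaw ν (cubeStratum d l) k) = 0 := by
  have h := integral_centredSample hd hl hα hs hfM hsM hν k (p := 1) (by norm_num)
  simp only [pow_one] at h
  rw [h]
  have hi := hfM.integrableOn hd hα (measurableSet_cubeStratum k) (cubeStratum_subset k)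
    (volume_cubeStratum_ne_top k)
  have e : stratumAvg k (fun x => ∫ e,
      centredSample f s (stratumMean f s ν (cubeStratum d l) k) (x, e) ∂(ν x)) =
      stratumAvg k fun x => f x + -stratumMean f s ν (cubeStratum d l) k := by
    refine stratumAvg_congr fun x hx => ?_
    have h1 := hν.mean_zero x hx.1
    rw [← integral_affine h1.1 h1.2 (f x + -stratumMean f s ν (cubeStratum d l) k) (s x)]
    congr 1
    ext e
    simp only [centredSample, Set.indicator_of_mem hx.1]
    ring
  rw [e, stratumAvg_add hi (integrableOn_const (volume_cubeStratum_ne_top k)), stratumAvg_const hl,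
    stratumMean_eq hd hl hα hs hfM hsM hν]
  ring

theorem integral_centredSample_sq :
    ∫ q, centredSample f s (stratumMean f s ν (cubeStratum d l) k) q ^ 2
        ∂(sampleLaw ν (cubeStratum d l) k) = stratumVar f s ν (cubeStratum d l) k := by
  rw [integral_centredSample hd hl hα hs hfM hsM hν k (by norm_num)]
  refine stratumAvg_congr fun x hx => ?_
  simp only [centredSample, Set.indicator_of_mem hx.1]

theorem integral_centredSample_pow_four_le :
    ∫ q, centredSample f s (stratumMean f s ν (cubeStratum d l) k) q ^ 4
        ∂(sampleLaw ν (cubeStratum d l) k) ≤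
      9 * holderBound f s M α ^ 2 * stratumVar f s ν (cubeStratum d l) k := by
  rw [integral_centredSample hd hl hα hs hfM hsM hν k le_rfl, stratumVar_eq hd hl hα hs hfM hsM hν,
    ← stratumAvg_const_mul]
  have hw := weight_cubeStratum_pos hl k
  refine mul_le_mul_of_nonneg_left (integral_mono_of_nonneg ?_
    ((integrableOn_stratum_integrand hd hl hα hs hfM hsM hν k).const_mul _) ?_) (by positivity)
  · exact .of_forall fun x => integral_nonneg fun e => by positivity
  · filter_upwards [ae_restrict_mem (measurableSet_cubeStratum k)] with x hx
    exact (integral_centredSample_pow_four hd hl hα hs hfM hsM hν k hx).2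

end Sample

/-! ### The confidence parameter `A`. -/

section Parameters

/-- The logarithm in the parameter `A` of MC-UCB, for `δ = 1 / n²`. -/
noncomputable def logTerm (n K : ℕ) : ℝ := Real.log (2 * n * K / (1 / (n : ℝ) ^ 2))

theorem three_mul_log_le_logTerm {n K : ℕ} (hn : 2 ≤ n) (hK : 1 ≤ K) :
    Real.log 2 + 3 * Real.log n ≤ logTerm n K := by
  have hn0 : (0 : ℝ) < n := by positivity
  have hK1 : (1 : ℝ) ≤ K := by exact_mod_cast hK
  have h : Real.log 2 + 3 * Real.log n = Real.log (2 * (n : ℝ) ^ 3) := by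
    rw [Real.log_mul (by norm_num) (by positivity), Real.log_pow]
    norm_num
  rw [h, logTerm]
  refine Real.log_le_log (by positivity) ?_
  rw [div_div_eq_mul_div, div_one]
  have : 0 ≤ 2 * (n : ℝ) ^ 3 := by positivity
  nlinarith

theorem logTerm_le {n K : ℕ} (hn : 2 ≤ n) (hK : 1 ≤ K) (h : 2 * K ≤ n) :
    logTerm n K ≤ 4 * Real.log n := by
  have hn0 : (0 : ℝ) < n := by positivity
  have hK1 : (1 : ℝ) ≤ K := by exact_mod_cast hK
  have h' : 2 * (K : ℝ) ≤ n := by exact_mod_cast h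
  have e : 4 * Real.log n = Real.log ((n : ℝ) ^ 4) := by
    rw [Real.log_pow]; norm_num
  rw [e, logTerm]
  refine Real.log_le_log (by positivity) ?_
  rw [div_div_eq_mul_div, div_one]
  have : 0 ≤ (n : ℝ) ^ 3 := by positivity
  nlinarith

theorem log_two_le_log {n : ℕ} (hn : 2 ≤ n) : Real.log 2 ≤ Real.log n :=
  Real.log_le_log (by norm_num) (by exact_mod_cast hn)

theorem two_le_logTerm {n K : ℕ} (hn : 2 ≤ n) (hK : 1 ≤ K) : 2 ≤ logTerm n K := by
  have h1 := three_mul_log_le_logTerm hn hK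
  have h2 := log_two_le_log hn
  have h3 := Real.log_two_gt_d9
  linarith

theorem ucbA_sq {b F : ℝ} (hb : 0 < b) {n K : ℕ} (hn : 2 ≤ n) (hK : 1 ≤ K) :
    ucbA b F (1 / (n : ℝ) ^ 2) n K ^ 2 = 4 * ((1 + 3 * b + 4 * F ^ 2) * logTerm n K) := by
  have := two_le_logTerm hn hK
  rw [ucbA, mul_pow, Real.sq_sqrt]
  · norm_num [logTerm]
  · exact mul_nonneg (by positivity) (le_trans (by norm_num) this)

theorem ucbA_pos {b F : ℝ} (hb : 0 < b) {n K : ℕ} (hn : 2 ≤ n) (hK : 1 ≤ K) :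
    0 < ucbA b F (1 / (n : ℝ) ^ 2) n K := by
  have := two_le_logTerm hn hK
  refine mul_pos two_pos (Real.sqrt_pos.2 (mul_pos (by positivity) ?_))
  exact lt_of_lt_of_le two_pos this

/-- The part `4 F²` of the factor under the root in `A` is exactly what the lower tail bound
requires. -/
theorem le_ucbA_sq {b F : ℝ} (hb : 0 < b) {n K : ℕ} (hn : 2 ≤ n) (hK : 1 ≤ K) :
    16 * F ^ 2 * logTerm n K ≤ ucbA b F (1 / (n : ℝ) ^ 2) n K ^ 2 := by
  have := two_le_logTerm hn hK
  rw [ucbA_sq hb hn hK]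
  nlinarith

theorem ucbA_le {b F : ℝ} (hb : 0 < b) {n K : ℕ} (hn : 2 ≤ n) (hK : 1 ≤ K) (h : 2 * K ≤ n) :
    ucbA b F (1 / (n : ℝ) ^ 2) n K ≤ 4 * (√(1 + 3 * b + 4 * F ^ 2) * √(Real.log n)) := by
  have h1 : 0 ≤ 1 + 3 * b + 4 * F ^ 2 := by positivity
  have e : 4 * (√(1 + 3 * b + 4 * F ^ 2) * √(Real.log n)) =
      2 * √((1 + 3 * b + 4 * F ^ 2) * (4 * Real.log n)) := by
    rw [Real.sqrt_mul h1, Real.sqrt_mul (by norm_num), show √(4 : ℝ) = 2 by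
      rw [show (4 : ℝ) = 2 ^ 2 by norm_num, Real.sqrt_sq (by norm_num)]]
    ring
  rw [e, ucbA]
  gcongr
  exact logTerm_le hn hK h

end Parameters

/-! ### From pathwise bounds to expectations. -/

section Integration

variable {Ω : Type*} [MeasurableSpace Ω] {P : Measure Ω} [IsProbabilityMeasure P]
  {ι : Type*} [Fintype ι] {w : ι → ℝ}

theorem integrable_sq_one_add_weighted_sum {Z : ι → Ω → ℝ} (hZ : ∀ k, MemLp (Z k) 2 P) (A : ℝ) :
    Integrable (fun ω => (1 + (∑ k, w k * Z k ω) / A) ^ 2) P := by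
  have h1 : MemLp (fun ω => ∑ k, w k * Z k ω) 2 P :=
    memLp_finsetSum Finset.univ fun k _ => (hZ k).const_mul (w k)
  have h2 : MemLp (fun ω => (∑ k, w k * Z k ω) / A) 2 P := by
    simpa only [div_eq_mul_inv] using h1.mul_const A⁻¹
  have h3 : MemLp (fun ω => 1 + (∑ k, w k * Z k ω) / A) 2 P := (memLp_const (1 : ℝ)).add h2
  exact h3.integrable_sq

/-- Combines `(1 + u)² ≤ 2 + 2 u²` with convexity of the square for the weights `w`; no independence
between strata enters. -/
theorem integral_sq_one_add_weighted_sum_le {Z : ι → Ω → ℝ} (hw0 : ∀ k, 0 ≤ w k)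
    (hw1 : ∑ k, w k = 1) (hZ : ∀ k, MemLp (Z k) 2 P) {A v : ℝ} (hA : 0 < A)
    (hv : ∀ k, ∫ ω, Z k ω ^ 2 ∂P ≤ v) (hvA : v ≤ A ^ 2 / 2) :
    ∫ ω, (1 + (∑ k, w k * Z k ω) / A) ^ 2 ∂P ≤ 3 := by
  have hI : ∀ k, Integrable (fun ω => w k * Z k ω ^ 2) P := fun k =>
    (hZ k).integrable_sq.const_mul _
  have hIs : Integrable (fun ω => ∑ k, w k * Z k ω ^ 2) P := integrable_finsetSum _ fun k _ => hI k
  have h1 : ∀ ω, (∑ k, w k * Z k ω) ^ 2 ≤ ∑ k, w k * Z k ω ^ 2 := fun ω =>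
    (even_two.convexOn_pow (𝕜 := ℝ)).map_sum_le (fun k _ => hw0 k) hw1 fun _ _ => Set.mem_univ _
  have hi := (integrable_const (μ := P) (2 : ℝ)).add (hIs.const_mul (2 / A ^ 2))
  calc ∫ ω, (1 + (∑ k, w k * Z k ω) / A) ^ 2 ∂P
      ≤ ∫ ω, (2 + 2 / A ^ 2 * ∑ k, w k * Z k ω ^ 2) ∂P := by
        refine integral_mono (integrable_sq_one_add_weighted_sum hZ A) hi fun ω => ?_
        have h2 := mul_le_mul_of_nonneg_left (h1 ω) (by positivity : 0 ≤ 2 / A ^ 2)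
        have e : 2 / A ^ 2 * (∑ k, w k * Z k ω) ^ 2 = 2 * ((∑ k, w k * Z k ω) / A) ^ 2 := by ring
        rw [e] at h2
        dsimp only
        nlinarith [sq_nonneg (1 - (∑ k, w k * Z k ω) / A)]
    _ = 2 + 2 / A ^ 2 * ∑ k, w k * ∫ ω, Z k ω ^ 2 ∂P := by
        rw [integral_add (integrable_const _) (hIs.const_mul _), integral_const_mul,
          integral_finsetSum _ fun k _ => hI k]
        simp only [integral_const_mul]
        simp
    _ ≤ 2 + 2 / A ^ 2 * ∑ k, w k * (A ^ 2 / 2) := by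
        gcongr with k _
        · exact hw0 k
        · exact (hv k).trans hvA
    _ = 3 := by
        rw [← Finset.sum_mul, hw1]
        field_simp
        norm_num

theorem integral_le_of_ae_le {L W : Ω → ℝ} {C D p : ℝ} {B : ι → Set Ω} {c : ι → ℝ}
    (hL : Integrable L P) (hW : Integrable W P) (hW3 : ∫ ω, W ω ∂P ≤ 3) (hD : 0 ≤ D)
    (hB : ∀ k, MeasurableSet (B k)) (hBp : ∀ k, P.real (B k) ≤ p) (hc : ∀ k, 0 ≤ c k)
    (h : ∀ᵐ ω ∂P, L ω ≤ C + D * W ω + ∑ k, c k * (B k).indicator 1 ω) :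
    ∫ ω, L ω ∂P ≤ C + D * 3 + (∑ k, c k) * p := by
  have hi1 : Integrable (fun ω => C + D * W ω) P := (integrable_const _).add (hW.const_mul _)
  have hi2 : ∀ k, Integrable (fun ω => c k * (B k).indicator 1 ω) P := fun k =>
    ((integrable_const (1 : ℝ)).indicator (hB k)).const_mul _
  have hi3 : Integrable (fun ω => ∑ k, c k * (B k).indicator 1 ω) P :=
    integrable_finsetSum Finset.univ fun k _ => hi2 k
  calc ∫ ω, L ω ∂P ≤ ∫ ω, (C + D * W ω + ∑ k, c k * (B k).indicator 1 ω) ∂P :=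
        integral_mono_ae hL (hi1.add hi3) h
    _ = C + D * ∫ ω, W ω ∂P + ∑ k, c k * P.real (B k) := by
        rw [integral_add hi1 hi3, integral_add (integrable_const _) (hW.const_mul _),
          integral_const_mul, integral_finsetSum _ fun k _ => hi2 k]
        simp only [integral_const_mul]
        congr 1
        · simp
        · exact Finset.sum_congr rfl fun k _ => by rw [integral_indicator_one (hB k)]
    _ ≤ C + D * 3 + ∑ k, c k * p := by
        gcongr with k _
        · exact hc k
        · exact hBp k
    _ = _ := by rw [Finset.sum_mul]

end Integration

/-! ### The expected pseudo-risk on a partition into `l ^ d` cubes. -/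

section Expectation

variable {d l : ℕ} {f s : Space d → ℝ} {ν : Kernel (Space d) ℝ} [IsMarkovKernel ν] {M α b : ℝ}
  (hd : 1 ≤ d) (hl : 0 < l) (hα : 0 < α) (hs : ∀ x ∈ unitCube d, 0 ≤ s x)
  (hfM : IsHolder M α f) (hsM : IsHolder M α s) (hν : NoiseAssumption b ν)
include hd hl hα hs hfM hsM hν

theorem sq_stratumStd (k : Fin d → Fin l) :
    stratumStd f s ν (cubeStratum d l) k ^ 2 = stratumVar f s ν (cubeStratum d l) k :=
  Real.sq_sqrt (stratumVar_nonneg hd hl hα hs hfM hsM hν k)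

theorem holderBound_nonneg : 0 ≤ holderBound f s M α :=
  (oscBound_nonneg (d := d) (l := l) (α := α) (hfM.nonneg hd)).trans
    (oscBound_le_holderBound hd hl hα hs hfM hsM hν)

theorem stratumStd_le_holderBound (k : Fin d → Fin l) :
    stratumStd f s ν (cubeStratum d l) k ≤ 3 / 2 * holderBound f s M α := by
  have hF := holderBound_nonneg hd hl hα hs hfM hsM hν
  refine (Real.sqrt_le_left (by positivity)).2
    ((stratumVar_le hd hl hα hs hfM hsM hν k).trans ?_)
  nlinarith [sq_nonneg (holderBound f s M α)]

theorem totalStd_le_holderBound :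
    totalStd f s ν (cubeStratum d l) ≤ 3 / 2 * holderBound f s M α := by
  rw [← one_mul (3 / 2 * holderBound f s M α), ← sum_weight_cubeStratum hd hl hα hs hfM hsM hν,
    Finset.sum_mul]
  exact Finset.sum_le_sum fun k _ => mul_le_mul_of_nonneg_left
    (stratumStd_le_holderBound hd hl hα hs hfM hsM hν k) (weight_cubeStratum_pos hl k).le

/-- This is the smallness condition `s ≤ 1/4` needed to solve the cubic inequality of the pathwise
analysis. -/
theorem totalStd_le_ucbA {n : ℕ} (hn : 2 ≤ n) :
    totalStd f s ν (cubeStratum d l) ≤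
      ucbA b (holderBound f s M α) (1 / (n : ℝ) ^ 2) n (l ^ d) / 4 := by
  have hK : 1 ≤ l ^ d := Nat.one_le_pow _ _ hl
  set A := ucbA b (holderBound f s M α) (1 / (n : ℝ) ^ 2) n (l ^ d)
  have hA : 0 < A := ucbA_pos hν.b_pos hn hK
  have h1 : 16 * holderBound f s M α ^ 2 * logTerm n (l ^ d) ≤ A ^ 2 := le_ucbA_sq hν.b_pos hn hK
  have h2 : Real.log 2 * 4 ≤ logTerm n (l ^ d) := by
    linarith [three_mul_log_le_logTerm hn hK, log_two_le_log hn]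
  have h3 := Real.log_two_gt_d9
  have hF := holderBound_nonneg hd hl hα hs hfM hsM hν
  refine (totalStd_le_holderBound hd hl hα hs hfM hsM hν).trans ?_
  refine le_of_sq_le_sq ?_ (by positivity)
  have h4 : 9 / 4 * holderBound f s M α ^ 2 ≤ logTerm n (l ^ d) * holderBound f s M α ^ 2 := by
    gcongr
    linarith
  nlinarith

variable {Ω : Type u} [MeasurableSpace Ω] {P : Measure Ω} {n : ℕ}
  {U : (Fin d → Fin l) → ℕ → Ω → Space d × ℝ} {a : ℕ → Ω → (Fin d → Fin l)}
  (hmod : MCUCBModel f s ν (cubeStratum d l) b (holderBound f s M α) (1 / (n : ℝ) ^ 2) n P U a)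
include hmod

/-- The centred samples, up to null sets, as measurable independent variables. -/
theorem exists_centred_samples :
    ∃ Y : (Fin d → Fin l) → ℕ → Ω → ℝ, (∀ k i, Measurable (Y k i)) ∧ (∀ k, iIndepFun (Y k) P) ∧
      (∀ k i, MemLp (Y k i) 4 P) ∧ (∀ k i, ∫ ω, Y k i ω ∂P = 0) ∧
      (∀ k i, ∫ ω, Y k i ω ^ 2 ∂P = stratumVar f s ν (cubeStratum d l) k) ∧
      (∀ k i, ∫ ω, Y k i ω ^ 4 ∂P ≤
        9 * holderBound f s M α ^ 2 * stratumVar f s ν (cubeStratum d l) k) ∧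
      ∀ᵐ ω ∂P, ∀ k i, f (U k i ω).1 + s (U k i ω).1 * (U k i ω).2 -
        stratumMean f s ν (cubeStratum d l) k = Y k i ω := by
  -- `HasLaw` gives almost everywhere measurability only, hence the passage to measurable versions.
  set U' : (Fin d → Fin l) → ℕ → Ω → Space d × ℝ := fun k i => (hmod.law k i).aemeasurable.mk with hU'
  have hae : ∀ k i, U k i =ᵐ[P] U' k i := fun k i => (hmod.law k i).aemeasurable.ae_eq_mk
  have hUm : ∀ k i, Measurable (U' k i) := fun k i => (hmod.law k i).aemeasurable.measurable_mk
  have hlaw : ∀ k i, MeasurePreserving (U' k i) P (sampleLaw ν (cubeStratum d l) k) := fun k i =>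
    ⟨hUm k i, by rw [← (hmod.law k i).map_eq]; exact Measure.map_congr (hae k i).symm⟩
  have hψ := fun k => measurable_centredSample hd hl hα hs hfM hsM hν
    (stratumMean f s ν (cubeStratum d l) k)
  have hint : ∀ k i (p : ℕ), ∫ ω, centredSample f s (stratumMean f s ν (cubeStratum d l) k)
      (U' k i ω) ^ p ∂P = ∫ q, centredSample f s (stratumMean f s ν (cubeStratum d l) k) q ^ p
        ∂(sampleLaw ν (cubeStratum d l) k) := by
    intro k i p
    rw [← (hlaw k i).map_eq, integral_map (hUm k i).aemeasurable
      ((hψ k).pow_const p).aestronglyMeasurable]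
  refine ⟨fun k i ω => centredSample f s (stratumMean f s ν (cubeStratum d l) k) (U' k i ω),
    fun k i => (hψ k).comp (hUm k i), fun k => ?_, fun k i => ?_, fun k i => ?_, fun k i => ?_,
    fun k i => ?_, ?_⟩
  · have h1 : iIndepFun (fun p : (Fin d → Fin l) × ℕ => U' p.1 p.2) P :=
      hmod.indep.congr fun p => hae p.1 p.2
    have h2 : iIndepFun (fun i => U' k i) P :=
      h1.precomp (g := fun i : ℕ => (k, i)) fun i j h => by simpa using h
    exact h2.comp (fun _ => centredSample f s (stratumMean f s ν (cubeStratum d l) k)) fun _ => hψ k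
  · exact (memLp_centredSample hd hl hα hs hfM hsM hν k).comp_measurePreserving (hlaw k i)
  · have := hint k i 1
    simp only [pow_one] at this
    rw [this, integral_centredSample_one hd hl hα hs hfM hsM hν k]
  · rw [hint k i 2, integral_centredSample_sq hd hl hα hs hfM hsM hν k]
  · rw [hint k i 4]
    exact integral_centredSample_pow_four_le hd hl hα hs hfM hsM hν k
  · refine ae_all_iff.2 fun k => ae_all_iff.2 fun i => ?_
    have h1 : ∀ᵐ ω ∂P, (U' k i ω).1 ∈ unitCube d :=
      (hlaw k i).quasiMeasurePreserving.ae (ae_mem_sampleLaw hd hl hα hs hfM hsM hν k)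
    filter_upwards [h1, hae k i] with ω hω1 hω2
    rw [hω2, centredSample, Set.indicator_of_mem hω1, Set.indicator_of_mem hω1]

theorem measurable_pulls (k : Fin d → Fin l) (t : ℕ) :
    Measurable fun ω => pulls (fun r => a r ω) k t := by
  induction t with
  | zero => exact measurable_const
  | succ t ih =>
    simp only [pulls_succ]
    refine ih.add (Measurable.ite ?_ measurable_const measurable_const)
    exact (hmod.measurable_choice (t + 1)) (measurableSet_singleton k)

theorem measurable_pseudoRisk :
    Measurable fun ω => pseudoRisk f s ν (cubeStratum d l) fun k => pulls (fun t => a t ω) k n := by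
  unfold pseudoRisk
  refine Finset.measurable_fun_sum _ fun k _ => measurable_const.div ?_
  exact measurable_from_nat.comp (measurable_pulls hd hl hα hs hfM hsM hν hmod k n)

theorem ae_two_le_pulls (hn : 2 * l ^ d ≤ n) :
    ∀ᵐ ω ∂P, ∀ k, 2 ≤ pulls (fun t => a t ω) k n := by
  filter_upwards [hmod.run] with ω hω k
  have := hω.1 k
  simp only [Fintype.card_fun, Fintype.card_fin] at this
  exact this ▸ pulls_mono _ k hn

theorem ae_pseudoRisk_le (hn : 2 * l ^ d ≤ n) :
    ∀ᵐ ω ∂P, pseudoRisk f s ν (cubeStratum d l) (fun k => pulls (fun t => a t ω) k n) ≤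
      ∑ k, weight (cubeStratum d l) k ^ 2 * stratumVar f s ν (cubeStratum d l) k / 2 := by
  filter_upwards [ae_two_le_pulls hd hl hα hs hfM hsM hν hmod hn] with ω hω
  refine Finset.sum_le_sum fun k _ => ?_
  have h0 := stratumVar_nonneg hd hl hα hs hfM hsM hν k
  have h2 : (2 : ℝ) ≤ pulls (fun t => a t ω) k n := by exact_mod_cast hω k
  gcongr

theorem pseudoRisk_nonneg (ω : Ω) :
    0 ≤ pseudoRisk f s ν (cubeStratum d l) fun k => pulls (fun t => a t ω) k n :=
  Finset.sum_nonneg fun k _ => div_nonneg (mul_nonneg (sq_nonneg _)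
    (stratumVar_nonneg hd hl hα hs hfM hsM hν k)) (Nat.cast_nonneg _)

theorem integrable_pseudoRisk (hn : 2 * l ^ d ≤ n) :
    Integrable (fun ω => pseudoRisk f s ν (cubeStratum d l) fun k => pulls (fun t => a t ω) k n)
      P := by
  have := hmod.isProbability
  refine Integrable.of_bound (measurable_pseudoRisk hd hl hα hs hfM hsM hν hmod).aestronglyMeasurable
    (C := ∑ k, weight (cubeStratum d l) k ^ 2 * stratumVar f s ν (cubeStratum d l) k / 2) ?_
  filter_upwards [ae_pseudoRisk_le hd hl hα hs hfM hsM hν hmod hn] with ω hω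
  rwa [Real.norm_of_nonneg (pseudoRisk_nonneg hd hl hα hs hfM hsM hν hmod ω)]

/-- No allocation of `n` samples has a pseudo-risk below `(∑ w_k σ_k)² / n`. -/
theorem sq_totalStd_div_le (hn : 2 * l ^ d ≤ n) :
    totalStd f s ν (cubeStratum d l) ^ 2 / n ≤
      ∫ ω, pseudoRisk f s ν (cubeStratum d l) (fun k => pulls (fun t => a t ω) k n) ∂P := by
  have := hmod.isProbability
  have hK : 1 ≤ l ^ d := Nat.one_le_pow _ _ hl
  have hn0 : (0 : ℝ) < n := by exact_mod_cast (by omega : 0 < n)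
  have hle : ∀ᵐ ω ∂P, totalStd f s ν (cubeStratum d l) ^ 2 / n ≤
      pseudoRisk f s ν (cubeStratum d l) fun k => pulls (fun t => a t ω) k n := by
    filter_upwards [ae_two_le_pulls hd hl hα hs hfM hsM hν hmod hn] with ω hω
    -- Cauchy–Schwarz in Sedrakyan's form, the counts summing to `n`.
    have h := Finset.sq_sum_div_le_sum_sq_div Finset.univ
      (fun k => weight (cubeStratum d l) k * stratumStd f s ν (cubeStratum d l) k)
      (g := fun k => (pulls (fun t => a t ω) k n : ℝ))
      fun k _ => by exact_mod_cast (by have := hω k; omega : 0 < pulls (fun t => a t ω) k n)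
    rw [show ∑ k, (pulls (fun t => a t ω) k n : ℝ) = n by
      exact_mod_cast sum_pulls (fun t => a t ω) n] at h
    refine h.trans_eq (Finset.sum_congr rfl fun k _ => ?_)
    rw [mul_pow, sq_stratumStd hd hl hα hs hfM hsM hν]
  have h := integral_mono_ae (integrable_const _)
    (integrable_pseudoRisk hd hl hα hs hfM hsM hν hmod hn) hle
  simpa using h

/-- The expected pseudo-risk of MC-UCB on the partition into `K = l ^ d` cubes. -/
theorem integral_pseudoRisk_le (hn : 3 * l ^ d ≤ n) {c : ℝ} (hc : 0 ≤ c)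
    (hcK : c ^ 3 = (l ^ d : ℕ) / ((n : ℝ) - 2 * (l ^ d : ℕ))) :
    ∫ ω, pseudoRisk f s ν (cubeStratum d l) (fun k => pulls (fun t => a t ω) k n) ∂P ≤
      totalStd f s ν (cubeStratum d l) * ((totalStd f s ν (cubeStratum d l) + 27 / 4 *
        ucbA b (holderBound f s M α) (1 / (n : ℝ) ^ 2) n (l ^ d) * c) /
          ((n : ℝ) - 2 * (l ^ d : ℕ))) +
      (∑ k, weight (cubeStratum d l) k ^ 2 * stratumVar f s ν (cubeStratum d l) k / 2) *
        (n * (3 * Real.exp (-(3 / 4 * logTerm n (l ^ d))))) := by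
  classical
  have := hmod.isProbability
  obtain ⟨Y, hm, hY, h4, hE, hE2, hE4, hXY⟩ := exists_centred_samples hd hl hα hs hfM hsM hν hmod
  have hs2 := stratumVar_le hd hl hα hs hfM hsM hν
  have hK : 1 ≤ l ^ d := Nat.one_le_pow _ _ hl
  have hn2 : 2 ≤ n := by omega
  have hN : (0 : ℝ) < (n : ℝ) - 2 * (l ^ d : ℕ) := by
    have : ((2 * l ^ d : ℕ) : ℝ) < n := by exact_mod_cast (by omega : 2 * l ^ d < n)
    push_cast at this ⊢
    linarith
  have hc1 : c ≤ 1 := by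
    by_contra! h
    have h1 : 1 < c ^ 3 := one_lt_pow₀ h (by norm_num)
    rw [hcK, one_lt_div hN] at h1
    have : ((3 * l ^ d : ℕ) : ℝ) ≤ n := by exact_mod_cast hn
    push_cast at this h1
    linarith
  set F := holderBound f s M α with hF
  set A := ucbA b F (1 / (n : ℝ) ^ 2) n (l ^ d) with hAdef
  set σ := stratumStd f s ν (cubeStratum d l) with hσ
  set w := weight (cubeStratum d l) with hw
  set V := stratumVar f s ν (cubeStratum d l) with hV
  set S := totalStd f s ν (cubeStratum d l) with hS
  have hA : 0 < A := ucbA_pos hν.b_pos hn2 hK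
  have hAF : 16 * F ^ 2 * logTerm n (l ^ d) ≤ A ^ 2 := le_ucbA_sq hν.b_pos hn2 hK
  have hw0 : ∀ k, 0 ≤ w k := fun k => (weight_cubeStratum_pos hl k).le
  have hw1 : ∑ k, w k = 1 := sum_weight_cubeStratum hd hl hα hs hfM hsM hν
  have hV0 : ∀ k, 0 ≤ V k := stratumVar_nonneg hd hl hα hs hfM hsM hν
  have hσV : ∀ k, σ k ^ 2 = V k := sq_stratumStd hd hl hα hs hfM hsM hν
  choose Z hZm hZ0 hZ2 hZE hZle using fun k => exists_dominating_overestimate (hY k) (hm k) (h4 k)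
    (hE k) (hE2 k) (hE4 k) (hs2 k) (n := n) (by omega)
  set B := fun k => failEvent (Y k) (V k) A n with hB
  have hBm : ∀ k, MeasurableSet (B k) := fun k =>
    measurableSet_failEvent (hY k) (hm k) (h4 k) (hE k) (hE2 k) (hE4 k) (hs2 k) A n
  have hBP : ∀ k, P.real (B k) ≤ n * (3 * Real.exp (-(3 / 4 * logTerm n (l ^ d)))) := fun k =>
    measureReal_failEvent_le (hY k) (hm k) (h4 k) (hE k) (hE2 k) (hE4 k) (hs2 k) hA.le hAF
  -- The logarithm in `A²` pays for the one in the `L²` bound on the overestimation, so the averaged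
  -- overestimation is of order `A`.
  have hvA : 9 * F ^ 2 * (1 + Real.log n) ≤ A ^ 2 / 2 := by
    have h2 := three_mul_log_le_logTerm hn2 hK
    have h3 := log_two_le_log hn2
    have h5 := Real.log_two_gt_d9
    have h6 : (9 * (1 + Real.log n)) * F ^ 2 ≤ (8 * logTerm n (l ^ d)) * F ^ 2 :=
      mul_le_mul_of_nonneg_right (by linarith) (sq_nonneg F)
    linarith
  have hpath : ∀ᵐ ω ∂P,
      pseudoRisk f s ν (cubeStratum d l) (fun k => pulls (fun t => a t ω) k n) ≤
      S / ((n : ℝ) - 2 * (l ^ d : ℕ)) * S +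
        S / ((n : ℝ) - 2 * (l ^ d : ℕ)) * (9 / 4 * A * c) * (1 + (∑ k, w k * Z k ω) / A) ^ 2 +
      ∑ k, w k ^ 2 * V k / 2 * (B k).indicator 1 ω := by
    filter_upwards [hXY, hmod.run, ae_all_iff.2 hZle] with ω hX hrun hZω
    have hemp : ∀ k (t : ℕ), t ≠ 0 → empVar (fun i => f (U k i ω).1 + s (U k i ω).1 * (U k i ω).2) t =
        empVar (fun i => Y k i ω) t := fun k t ht => by
      rw [← empVar_sub_const _ (stratumMean f s ν (cubeStratum d l) k) ht]
      simp only [hX]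
    have hcard : l ^ d = Fintype.card (Fin d → Fin l) := by simp
    obtain ⟨hr1, hr2⟩ := hrun
    rw [← hcard] at hr1 hr2
    -- The good set is random: it consists of the strata whose failure event does not occur at `ω`.
    -- A failure in one stratum thus costs only that stratum's two-sample risk.
    have h := sum_sq_div_pulls_le (w := w) (A := A) (n := n) (K := l ^ d)
      (X := fun k i => f (U k i ω).1 + s (U k i ω).1 * (U k i ω).2) (a := fun t => a t ω) (σ := σ)
      (Z := fun k => Z k ω) (G := {k | ω ∉ B k}) hcard (fun k => weight_cubeStratum k) hA
      (fun k => Real.sqrt_nonneg _) (fun k => hZ0 k ω)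
      (fun k hk t ht1 ht2 => by
        rw [hemp k t (by omega)]
        by_contra! hlt
        exact hk ⟨t, Finset.mem_Icc.2 ⟨ht1, ht2⟩, hlt⟩)
      (fun k t ht1 ht2 => by
        rw [hemp k t (by omega)]
        exact hZω k t ht1 ht2)
      hr1 hr2 (totalStd_le_ucbA hd hl hα hs hfM hsM hν hn2) (by omega) hc hc1 hcK
    simp only [hσV] at h
    refine h.trans_eq ?_
    congr 1
    · change S * ((S + 9 / 4 * A * (1 + (∑ k, w k * Z k ω) / A) ^ 2 * c) / _) = _
      ring
    · refine Finset.sum_congr rfl fun k _ => ?_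
      congr 1
      by_cases hk : ω ∈ B k
      · simp [hk]
      · simp [hk]
  have hS0 : 0 ≤ S := Finset.sum_nonneg fun k _ => mul_nonneg (hw0 k) (Real.sqrt_nonneg _)
  refine (integral_le_of_ae_le (integrable_pseudoRisk hd hl hα hs hfM hsM hν hmod (by omega))
    (integrable_sq_one_add_weighted_sum hZ2 A)
    (integral_sq_one_add_weighted_sum_le hw0 hw1 hZ2 hA hZE hvA) (by positivity) hBm hBP
    (fun k => by have := hV0 k; positivity) hpath).trans_eq ?_
  ring

end Expectation

/-! ### Exponents and numerical constants. -/

section Rates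

/-- Here `G` is the root `√(1 + 3b + 4F²)`, `T = √(log n)`, `Q` the two-sample risk and `e` the
failure exponential. The exploration term gives `27/4 · 4 · 16/9 = 48`; replacing `n - 2K` by `n`
and the failures add at most `4`. -/
theorem risk_numerics {S F G T A c e q n K Q : ℝ} (hS : 0 ≤ S) (hF : 0 ≤ F) (hFG : 2 * F ≤ G)
    (hT : 4 / 5 ≤ T) (hA : A ≤ 4 * (G * T)) (hn : 0 < n) (hK : 1 ≤ K) (hKn : 8 * K ≤ n) (hq : 0 < q)
    (hq1 : q ≤ 1) (hKq : K ≤ n * q ^ 3) (hc : 0 ≤ c) (hcK : c ^ 3 = K / (n - 2 * K))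
    (he : n * e ≤ q / n) (hSF : S ≤ 3 / 2 * F) (hQ : Q ≤ S * (3 / 4 * F)) (hQ0 : 0 ≤ Q) :
    S * ((S + 27 / 4 * A * c) / (n - 2 * K)) + Q * (n * (3 * e)) ≤
      S ^ 2 / n + 52 * (S * (G * T)) * (q / n) := by
  have hN : 3 / 4 * n ≤ n - 2 * K := by linarith
  have hN0 : 0 < n - 2 * K := by linarith
  set p := q / n with hp
  have hp0 : 0 < p := by positivity
  have hG0 : 0 ≤ G := by linarith
  have hinv : 1 / (n - 2 * K) ≤ 4 / 3 * (1 / n) := by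
    rw [show 4 / 3 * (1 / n) = 1 / (3 / 4 * n) by field_simp]
    exact one_div_le_one_div_of_le (by positivity) hN
  have hcq : c ≤ 4 / 3 * q := by
    refine le_of_pow_le_pow_left₀ (n := 3) (by norm_num) (by positivity) ?_
    rw [hcK, div_le_iff₀ hN0]
    have h1 : q ^ 3 * (3 / 4 * n) ≤ q ^ 3 * (n - 2 * K) := by gcongr
    have h2 : 0 ≤ q ^ 3 * n := by positivity
    nlinarith
  have h1 : c / (n - 2 * K) ≤ 16 / 9 * p := by
    calc c / (n - 2 * K) = c * (1 / (n - 2 * K)) := by ring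
      _ ≤ 4 / 3 * q * (4 / 3 * (1 / n)) := by gcongr
      _ = 16 / 9 * p := by rw [hp]; ring
  have h2 : 1 / (n - 2 * K) ≤ 1 / n + 8 / 3 * p := by
    have e1 : 1 / (n - 2 * K) = 1 / n + 2 * (K / n) * (1 / (n - 2 * K)) := by
      field_simp
      ring
    have h3 : K / n ≤ q ^ 3 := by rw [div_le_iff₀ hn]; linarith
    have h4 : q ^ 3 ≤ q := pow_le_of_le_one hq.le hq1 (by norm_num)
    have h5 : 2 * (K / n) * (1 / (n - 2 * K)) ≤ 2 * q * (4 / 3 * (1 / n)) := by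
      gcongr
      linarith
    have e2 : 2 * q * (4 / 3 * (1 / n)) = 8 / 3 * p := by rw [hp]; ring
    linarith
  have hA2 : 27 / 4 * A * (c / (n - 2 * K)) ≤ 27 / 4 * (4 * (G * T)) * (16 / 9 * p) := by
    have h0 : 0 ≤ c / (n - 2 * K) := by positivity
    have hGT : 0 ≤ G * T := by positivity
    exact (mul_le_mul_of_nonneg_right (by linarith) h0).trans
      (mul_le_mul_of_nonneg_left h1 (by positivity))
  have hS2 : S * (1 / (n - 2 * K)) ≤ S * (1 / n + 8 / 3 * p) := by gcongr
  have hfail : Q * (n * (3 * e)) ≤ S * (3 / 4 * F) * (3 * p) := by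
    have : n * (3 * e) ≤ 3 * p := by linarith
    exact (mul_le_mul_of_nonneg_left this hQ0).trans (mul_le_mul_of_nonneg_right hQ (by positivity))
  have hSp : 0 ≤ S * p := by positivity
  have hGT : G ≤ 5 / 4 * (G * T) := by nlinarith
  have e0 : S * ((S + 27 / 4 * A * c) / (n - 2 * K)) =
      S * (S * (1 / (n - 2 * K)) + 27 / 4 * A * (c / (n - 2 * K))) := by ring
  rw [e0]
  have h6 : S * (S * (1 / (n - 2 * K)) + 27 / 4 * A * (c / (n - 2 * K))) ≤
      S * (S * (1 / n + 8 / 3 * p) + 27 / 4 * (4 * (G * T)) * (16 / 9 * p)) := by gcongr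
  have h7 : (S * p) * (8 / 3 * S + 9 / 4 * F) ≤ (S * p) * (4 * (G * T)) := by
    gcongr
    linarith
  have e3 : S * (S * (1 / n + 8 / 3 * p) + 27 / 4 * (4 * (G * T)) * (16 / 9 * p)) =
      S ^ 2 / n + (S * p) * (8 / 3 * S) + 48 * (S * (G * T)) * p := by ring
  nlinarith

/-- When `n ≤ 8 K`, the bound `K ≤ n q³` forces `q ≥ 1/2`, and then `1 / K ≤ 16 q / n`: the risk
after two samples per stratum already has the right order. -/
theorem small_budget_numerics {S F G T q n K Q : ℝ} (hS : 0 ≤ S) (hF : 0 ≤ F) (hFG : 2 * F ≤ G)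
    (hT : 4 / 5 ≤ T) (hn : 0 < n) (hK : 1 ≤ K) (hKn : n ≤ 8 * K) (hq : 0 < q)
    (hKq : K ≤ n * q ^ 3) (hQ : Q ≤ S * (3 / 4 * F) / K) :
    Q ≤ 52 * (S * (G * T)) * (q / n) := by
  have hq2 : 1 / 2 ≤ q := by
    by_contra! h
    have : q ^ 3 < (1 / 2) ^ 3 := pow_lt_pow_left₀ h hq.le (by norm_num)
    nlinarith
  have h1 : S * (3 / 4 * F) / K ≤ S * (3 / 4 * F) * (16 * q / n) := by
    rw [div_eq_mul_one_div]
    refine mul_le_mul_of_nonneg_left ?_ (by positivity)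
    rw [div_le_div_iff₀ (by linarith) hn]
    nlinarith
  refine hQ.trans (h1.trans ?_)
  have h2 : F ≤ G * T := by nlinarith
  have h3 : 0 ≤ S * (q / n) := by positivity
  have h4 : S * (q / n) * (12 * F) ≤ S * (q / n) * (52 * (G * T)) := by
    gcongr
    linarith
  calc S * (3 / 4 * F) * (16 * q / n) = S * (q / n) * (12 * F) := by ring
    _ ≤ S * (q / n) * (52 * (G * T)) := h4
    _ = _ := by ring

variable {d n : ℕ} {α : ℝ}

theorem sideCount_pow_le :
    ((sideCount d α n ^ d : ℕ) : ℝ) ≤ (n : ℝ) ^ ((d : ℝ) / (d + 3 * α)) := by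
  have h : (sideCount d α n : ℝ) ≤ (n : ℝ) ^ (1 / ((d : ℝ) + 3 * α)) :=
    Nat.floor_le (by positivity)
  push_cast
  refine (pow_le_pow_left₀ (Nat.cast_nonneg _) h d).trans_eq ?_
  rw [← Real.rpow_natCast, ← Real.rpow_mul (Nat.cast_nonneg n)]
  ring_nf

theorem rpow_div_le_self (hd : 1 ≤ d) (hα : 0 < α) :
    (n : ℝ) ^ ((d : ℝ) / (d + 3 * α)) ≤ n := by
  have hd0 : (0 : ℝ) < d := by exact_mod_cast hd
  rcases Nat.eq_zero_or_pos n with rfl | hn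
  · rw [Nat.cast_zero, Real.zero_rpow (by positivity)]
  · have h1 : (1 : ℝ) ≤ n := by exact_mod_cast hn
    refine (Real.rpow_le_rpow_of_exponent_le h1 ?_).trans_eq (Real.rpow_one _)
    rw [div_le_one (by positivity)]
    linarith

variable (hd : 1 ≤ d) (hα : 0 < α) (hn : 1 ≤ n)
include hd hα hn

theorem rpow_eq_mul_cube : (n : ℝ) ^ ((d : ℝ) / (d + 3 * α)) =
    n * ((n : ℝ) ^ (-(α / ((d : ℝ) + 3 * α)))) ^ 3 := by
  have hd0 : (0 : ℝ) < d := by exact_mod_cast hd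
  have hn0 : (0 : ℝ) < n := by exact_mod_cast hn
  rw [← Real.rpow_natCast, ← Real.rpow_mul hn0.le]
  nth_rewrite 2 [← Real.rpow_one (n : ℝ)]
  rw [← Real.rpow_add hn0]
  congr 1
  field_simp
  push_cast
  ring

theorem rate_eq : (n : ℝ) ^ (-(((d : ℝ) + 4 * α) / (d + 3 * α))) =
    (n : ℝ) ^ (-(α / ((d : ℝ) + 3 * α))) / n := by
  have hd0 : (0 : ℝ) < d := by exact_mod_cast hd
  have hn0 : (0 : ℝ) < n := by exact_mod_cast hn
  rw [← Real.rpow_sub_one hn0.ne']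
  congr 1
  field_simp
  ring

theorem rpow_neg_le_one : (n : ℝ) ^ (-(α / ((d : ℝ) + 3 * α))) ≤ 1 :=
  Real.rpow_le_one_of_one_le_of_nonpos (by exact_mod_cast hn)
    (by rw [neg_nonpos]; positivity)

theorem rpow_neg_quarter_le (hα1 : α ≤ 1) :
    (n : ℝ) ^ (-(1 / 4 : ℝ)) ≤ (n : ℝ) ^ (-(α / ((d : ℝ) + 3 * α))) := by
  have hd1 : (1 : ℝ) ≤ d := by exact_mod_cast hd
  refine Real.rpow_le_rpow_of_exponent_le (by exact_mod_cast hn) ?_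
  rw [neg_le_neg_iff, div_le_iff₀ (by positivity)]
  linarith

theorem one_le_rpow_side : (1 : ℝ) ≤ (n : ℝ) ^ (1 / ((d : ℝ) + 3 * α)) :=
  Real.one_le_rpow (by exact_mod_cast hn) (by positivity)

theorem sideCount_pos : 0 < sideCount d α n :=
  Nat.floor_pos.2 (one_le_rpow_side hd hα hn)

/-- Rounding down a number that is at least `1` loses at most a factor `2`, and `α ≤ 1` bounds `2 ^
α` and `√d ^ α` by `2` and `√d`. -/
theorem oscBound_sideCount_le (hα1 : α ≤ 1) {M : ℝ} (hM : 0 ≤ M) :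
    oscBound d (sideCount d α n) M α ≤
      M * √d * (2 * (n : ℝ) ^ (-(α / ((d : ℝ) + 3 * α)))) := by
  have hd1 : (1 : ℝ) ≤ d := by exact_mod_cast hd
  have hn0 : (0 : ℝ) < n := by exact_mod_cast hn
  have hl := sideCount_pos hd hα hn
  have hl1 : (1 : ℝ) ≤ sideCount d α n := by exact_mod_cast hl
  set y := (n : ℝ) ^ (1 / ((d : ℝ) + 3 * α)) with hy
  have hy0 : 0 < y := by positivity
  have hly : y ≤ 2 * sideCount d α n := by
    have : y < sideCount d α n + 1 := Nat.lt_floor_add_one y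
    linarith
  have h1 : (1 : ℝ) / sideCount d α n ≤ 2 * y⁻¹ := by
    rw [← div_eq_mul_inv, div_le_div_iff₀ (by positivity) hy0]
    linarith
  have h2 : (√d * (1 / (sideCount d α n : ℝ))) ^ α ≤ √d * (2 * y ^ (-α)) := by
    rw [Real.mul_rpow (by positivity) (by positivity)]
    have h3 : √(d : ℝ) ^ α ≤ √d := by
      refine (Real.rpow_le_rpow_of_exponent_le ?_ hα1).trans_eq (Real.rpow_one _)
      exact Real.one_le_sqrt.2 hd1
    have h4 : (1 / (sideCount d α n : ℝ)) ^ α ≤ 2 * y ^ (-α) := by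
      refine (Real.rpow_le_rpow (by positivity) h1 hα.le).trans ?_
      rw [Real.mul_rpow (by norm_num) (by positivity), Real.inv_rpow hy0.le, Real.rpow_neg hy0.le]
      gcongr
      exact (Real.rpow_le_rpow_of_exponent_le (by norm_num) hα1).trans_eq (Real.rpow_one _)
    gcongr
  have h5 : y ^ (-α) = (n : ℝ) ^ (-(α / ((d : ℝ) + 3 * α))) := by
    rw [hy, ← Real.rpow_mul hn0.le]
    congr 1
    ring
  rw [h5] at h2
  unfold oscBound
  rw [mul_assoc]
  gcongr

/-- With `δ = n⁻²` the exponential is at most `n^{-9/4}`; after the union over sample sizes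
`n^{-1/4} / n` remains, and `α / (d + 3α) ≤ 1/4`. -/
theorem mul_exp_neg_logTerm_le (hα1 : α ≤ 1) (hn2 : 2 ≤ n) {K : ℕ} (hK : 1 ≤ K) :
    (n : ℝ) * Real.exp (-(3 / 4 * logTerm n K)) ≤ (n : ℝ) ^ (-(α / ((d : ℝ) + 3 * α))) / n := by
  have hn0 : (0 : ℝ) < n := by exact_mod_cast hn
  have h1 := three_mul_log_le_logTerm hn2 hK
  have h2 : 0 < Real.log 2 := Real.log_pos (by norm_num)
  have h3 : Real.exp (-(3 / 4 * logTerm n K)) ≤ (n : ℝ) ^ (-(1 / 4 : ℝ) - 1 - 1) := by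
    rw [Real.rpow_def_of_pos hn0]
    refine Real.exp_le_exp.2 ?_
    linarith
  have h4 := rpow_neg_quarter_le hd hα hn hα1
  rw [Real.rpow_sub_one hn0.ne', Real.rpow_sub_one hn0.ne'] at h3
  calc (n : ℝ) * Real.exp (-(3 / 4 * logTerm n K)) ≤ n * ((n : ℝ) ^ (-(1 / 4 : ℝ)) / n / n) := by
        gcongr
    _ = (n : ℝ) ^ (-(1 / 4 : ℝ)) / n := by field_simp
    _ ≤ _ := by gcongr

end Rates

/-! ### Combining regret and bias. -/

section Tradeoff

variable {d : ℕ} {f s : Space d → ℝ} {ν : Kernel (Space d) ℝ} [IsMarkovKernel ν] {M α b : ℝ}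
  (hd : 1 ≤ d) (hα : 0 < α) (hα1 : α ≤ 1) (hs : ∀ x ∈ unitCube d, 0 ≤ s x)
  (hfM : IsHolder M α f) (hsM : IsHolder M α s) (hν : NoiseAssumption b ν)
include hd hα hs hfM hsM hν

theorem sum_sq_weight_mul_var_le {l : ℕ} (hl : 0 < l) :
    0 ≤ ∑ k, weight (cubeStratum d l) k ^ 2 * stratumVar f s ν (cubeStratum d l) k / 2 ∧
    ∑ k, weight (cubeStratum d l) k ^ 2 * stratumVar f s ν (cubeStratum d l) k / 2 ≤
      totalStd f s ν (cubeStratum d l) * (3 / 4 * holderBound f s M α) / ((l ^ d : ℕ) : ℝ) := by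
  constructor
  · refine Finset.sum_nonneg fun k _ => ?_
    have := stratumVar_nonneg hd hl hα hs hfM hsM hν k
    positivity
  · rw [totalStd, Finset.sum_mul, Finset.sum_div]
    refine Finset.sum_le_sum fun k _ => ?_
    have h1 := stratumStd_le_holderBound hd hl hα hs hfM hsM hν k
    have h0 : 0 ≤ stratumStd f s ν (cubeStratum d l) k := Real.sqrt_nonneg _
    have hw := weight_cubeStratum_pos hl k
    rw [← sq_stratumStd hd hl hα hs hfM hsM hν]
    calc _ = (weight (cubeStratum d l) k * stratumStd f s ν (cubeStratum d l) k) *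
          (stratumStd f s ν (cubeStratum d l) k / 2) * weight (cubeStratum d l) k := by ring
      _ ≤ (weight (cubeStratum d l) k * stratumStd f s ν (cubeStratum d l) k) *
          (3 / 4 * holderBound f s M α) * weight (cubeStratum d l) k := by
        gcongr
        linarith
      _ = _ := by rw [weight_cubeStratum]; ring

theorem two_mul_holderBound_le_sqrt :
    2 * holderBound f s M α ≤ √(1 + 3 * b + 4 * holderBound f s M α ^ 2) := by
  have := hν.b_pos
  refine Real.le_sqrt_of_sq_le ?_
  nlinarith

include hα1

theorem holderBound_le_sqrt_mul :
    holderBound f s M α ≤ √d * (|f 0| + s 0 + M) := by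
  have hM := hfM.nonneg hd
  have hs0 := hs 0 zero_mem_unitCube
  have hd1 : (1 : ℝ) ≤ d := by exact_mod_cast hd
  have h1 : (1 : ℝ) ≤ √d := Real.one_le_sqrt.2 hd1
  have h2 : (d : ℝ) ^ (α / 2) ≤ √d := by
    rw [Real.sqrt_eq_rpow]
    exact Real.rpow_le_rpow_of_exponent_le hd1 (by linarith)
  have h3 : max |f 0| (s 0) ≤ |f 0| + s 0 :=
    max_le (by linarith) (by linarith [abs_nonneg (f 0)])
  have h4 : 0 ≤ |f 0| + s 0 := by positivity
  unfold holderBound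
  calc _ ≤ 1 * (|f 0| + s 0) + M * √d := by
        rw [one_mul]; gcongr
    _ ≤ √d * (|f 0| + s 0) + M * √d := by gcongr
    _ = _ := by ring

theorem sqrt_holderBound_le :
    √(1 + 3 * b + 4 * holderBound f s M α ^ 2) ≤
      √d * √(1 + 3 * b + 4 * (|f 0| + s 0 + M) ^ 2) := by
  have hd1 : (1 : ℝ) ≤ d := by exact_mod_cast hd
  have hb := hν.b_pos
  rw [← Real.sqrt_mul (by positivity)]
  refine Real.sqrt_le_sqrt ?_
  have h1 := pow_le_pow_left₀ (holderBound_nonneg hd one_pos hα hs hfM hsM hν)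
    (holderBound_le_sqrt_mul hd hα hα1 hs hfM hsM hν) 2
  rw [mul_pow, Real.sq_sqrt (by positivity)] at h1
  nlinarith

variable {Ω : Type u} [MeasurableSpace Ω] {P : Measure Ω} {n : ℕ} (hn : 1 ≤ n)
  (hKn : 2 * sideCount d α n ^ d ≤ n)
  {U : (Fin d → Fin (sideCount d α n)) → ℕ → Ω → Space d × ℝ}
  {a : ℕ → Ω → (Fin d → Fin (sideCount d α n))}
  (hmod : MCUCBModel f s ν (cubeStratum d (sideCount d α n)) b (holderBound f s M α)
    (1 / (n : ℝ) ^ 2) n P U a)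
include hn hKn hmod

/-- The regret of MC-UCB with respect to the best static allocation on its partition. -/
theorem regret_le :
    ∫ ω, pseudoRisk f s ν (cubeStratum d (sideCount d α n))
      (fun k => pulls (fun t => a t ω) k n) ∂P ≤
    totalStd f s ν (cubeStratum d (sideCount d α n)) ^ 2 / n +
      52 * (totalStd f s ν (cubeStratum d (sideCount d α n)) *
        (√(1 + 3 * b + 4 * holderBound f s M α ^ 2) * √(Real.log n))) *
      ((n : ℝ) ^ (-(α / ((d : ℝ) + 3 * α))) / n) := by
  have hl := sideCount_pos hd hα hn
  have hKq := sideCount_pow_le (d := d) (n := n) (α := α)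
  rw [rpow_eq_mul_cube hd hα hn] at hKq
  have hq1 := rpow_neg_le_one hd hα hn
  have hn0 : (0 : ℝ) < n := by exact_mod_cast hn
  have hq0 : 0 < (n : ℝ) ^ (-(α / ((d : ℝ) + 3 * α))) := by positivity
  have hK : 1 ≤ sideCount d α n ^ d := Nat.one_le_pow _ _ hl
  have hn2 : 2 ≤ n := by omega
  have hT : 4 / 5 ≤ √(Real.log n) := by
    refine Real.le_sqrt_of_sq_le ?_
    linarith [log_two_le_log hn2, Real.log_two_gt_d9]
  have hS : 0 ≤ totalStd f s ν (cubeStratum d (sideCount d α n)) :=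
    (integral_le_totalStd hd hl hα hs hfM hsM hν).1.trans
      (integral_le_totalStd hd hl hα hs hfM hsM hν).2
  have hF := holderBound_nonneg hd hl hα hs hfM hsM hν
  have hFG := two_mul_holderBound_le_sqrt hd hα hs hfM hsM hν
  have hSF := totalStd_le_holderBound hd hl hα hs hfM hsM hν
  obtain ⟨hQ0, hQ⟩ := sum_sq_weight_mul_var_le hd hα hs hfM hsM hν hl
  have hK1 : (1 : ℝ) ≤ ((sideCount d α n ^ d : ℕ) : ℝ) := by exact_mod_cast hK
  -- For small budgets `n - 2K` may be small or zero, and the pathwise bound is useless.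
  rcases le_total (8 * sideCount d α n ^ d) n with h8 | h8
  · have h8' : 8 * ((sideCount d α n ^ d : ℕ) : ℝ) ≤ n := by exact_mod_cast h8
    obtain ⟨c, hc, hcK⟩ := exists_cube_root
      (u := ((sideCount d α n ^ d : ℕ) : ℝ) / ((n : ℝ) - 2 * (sideCount d α n ^ d : ℕ)))
      (div_nonneg (Nat.cast_nonneg _) (by linarith))
    refine (integral_pseudoRisk_le hd hl hα hs hfM hsM hν hmod (by omega) hc hcK).trans ?_
    exact risk_numerics hS hF hFG hT (ucbA_le hν.b_pos hn2 hK hKn) hn0 hK1 h8' hq0 hq1 hKq hc hcK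
      (mul_exp_neg_logTerm_le hd hα hn hα1 hn2 hK) hSF
      (hQ.trans (div_le_self (by positivity) hK1)) hQ0
  · have h8' : (n : ℝ) ≤ 8 * ((sideCount d α n ^ d : ℕ) : ℝ) := by exact_mod_cast h8
    have hP := hmod.isProbability
    have h1 := integral_mono_ae (integrable_pseudoRisk hd hl hα hs hfM hsM hν hmod hKn)
      (integrable_const _) (ae_pseudoRisk_le hd hl hα hs hfM hsM hν hmod hKn)
    rw [integral_const, probReal_univ, one_smul] at h1
    have h2 := small_budget_numerics hS hF hFG hT hn0 hK1 h8' hq0 hKq hQ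
    have h3 : 0 ≤ totalStd f s ν (cubeStratum d (sideCount d α n)) ^ 2 / n := by positivity
    linarith

theorem risk_sub_le :
    (∫ ω, pseudoRisk f s ν (cubeStratum d (sideCount d α n))
        (fun k => pulls (fun t => a t ω) k n) ∂P)
      - 1 / (n : ℝ) * (∫ x in unitCube d, s x) ^ 2
    ≤ tradeoffConst f s M b (totalStd f s ν (cubeStratum d (sideCount d α n)))
      * (d : ℝ) ^ (2 * α / (3 * d) + 1 / 2) * √(Real.log n)
      * (n : ℝ) ^ (-(((d : ℝ) + 4 * α) / (d + 3 * α)))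
      * (1 + (d : ℝ) ^ α * (n : ℝ) ^ (-(α / ((d : ℝ) + 3 * α)))) := by
  have hreg := regret_le hd hα hα1 hs hfM hsM hν hn hKn hmod
  have hM := hfM.nonneg hd
  have hl := sideCount_pos hd hα hn
  have hK : 1 ≤ sideCount d α n ^ d := Nat.one_le_pow _ _ hl
  have hn2 : 2 ≤ n := by omega
  have hosc := oscBound_sideCount_le hd hα hn hα1 hM
  obtain ⟨hI0, hIS⟩ := integral_le_totalStd hd hl hα hs hfM hsM hν
  have hSI := totalStd_le hd hl hα hs hfM hsM hν
  have hGG := sqrt_holderBound_le hd hα hα1 hs hfM hsM hν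
  have hn0 : (0 : ℝ) < n := by exact_mod_cast hn
  have hs0 := hs 0 zero_mem_unitCube
  have hd1 : (1 : ℝ) ≤ d := by exact_mod_cast hd
  have hb := hν.b_pos
  have hT : 4 / 5 ≤ √(Real.log n) := by
    refine Real.le_sqrt_of_sq_le ?_
    linarith [log_two_le_log hn2, Real.log_two_gt_d9]
  rw [rate_eq hd hα hn]
  set q := (n : ℝ) ^ (-(α / ((d : ℝ) + 3 * α))) with hq
  have hq0 : 0 < q := by positivity
  set S := totalStd f s ν (cubeStratum d (sideCount d α n))
  set I := ∫ x in unitCube d, s x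
  set G := √(1 + 3 * b + 4 * holderBound f s M α ^ 2)
  set G' := √(1 + 3 * b + 4 * (|f 0| + s 0 + M) ^ 2) with hG'
  set T := √(Real.log n)
  set R := oscBound d (sideCount d α n) M α
  have hG1 : 1 ≤ G' := Real.one_le_sqrt.2 (by nlinarith [sq_nonneg (|f 0| + s 0 + M)])
  have hS0 : 0 ≤ S := hI0.trans hIS
  have hp0 : 0 < q / n := by positivity
  have hsd : 0 ≤ √(d : ℝ) := Real.sqrt_nonneg _
  -- the bias and the regret
  have hbias : S ^ 2 / n - 1 / (n : ℝ) * I ^ 2 ≤ 4 * (S * (M * √d)) * (q / n) := by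
    have h1 : S ^ 2 - I ^ 2 ≤ (M * √d * (2 * q)) * (2 * S) := by
      have h2 : (S - I) * (S + I) ≤ (M * √d * (2 * q)) * (2 * S) :=
        mul_le_mul (by linarith) (by linarith) (by linarith) (by positivity)
      linarith
    calc S ^ 2 / n - 1 / (n : ℝ) * I ^ 2 = (S ^ 2 - I ^ 2) / n := by ring
      _ ≤ (M * √d * (2 * q)) * (2 * S) / n := by gcongr
      _ = _ := by ring
  -- As `G' ≥ 1` and `T ≥ 4/5`, the bias term is at most `5 M` times `S √d G' T`, and `52 + 5 M ≤ 70
  -- (1 + M)`.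
  have h70 : 52 * (S * (G * T)) * (q / n) + 4 * (S * (M * √d)) * (q / n) ≤
      70 * (1 + M) * S * G' * √d * T * (q / n) := by
    have h1 : S * (G * T) ≤ S * (√d * G' * T) := by gcongr
    have h2 : M * √d * 1 ≤ M * √d * (5 / 4 * (G' * T)) := by
      gcongr
      nlinarith
    have h3 : S * (M * √d) ≤ S * (M * √d * (5 / 4 * (G' * T))) := by
      rw [mul_one] at h2
      gcongr
    have h4 : 0 ≤ S * (√d * G' * T) := by positivity
    have h5 : 0 ≤ S * (√d * G' * T) * M := by positivity
    have h6 : 52 * (S * (G * T)) + 4 * (S * (M * √d)) ≤ 70 * (1 + M) * S * G' * √d * T := by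
      nlinarith
    nlinarith [mul_le_mul_of_nonneg_right h6 hp0.le]
  -- The remaining factors of the stated bound are at least `1`, and its power of `d` is at least
  -- `√d`.
  refine le_trans (b := 70 * (1 + M) * S * G' * √d * T * (q / n)) (by linarith) ?_
  have hX : √(d : ℝ) ≤ (d : ℝ) ^ (2 * α / (3 * d) + 1 / 2) := by
    rw [Real.sqrt_eq_rpow]
    refine Real.rpow_le_rpow_of_exponent_le hd1 ?_
    have : 0 ≤ 2 * α / (3 * d) := by positivity
    linarith
  have hC : 1 ≤ ((|f 0| + s 0 + M + 4) / 4) ^ ((1 : ℝ) / 3) :=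
    Real.one_le_rpow (by have := abs_nonneg (f 0); linarith) (by norm_num)
  have hD : 1 ≤ 1 + (d : ℝ) ^ α * q := by
    have : 0 ≤ (d : ℝ) ^ α * q := by positivity
    linarith
  unfold tradeoffConst
  rw [← hG']
  calc 70 * (1 + M) * S * G' * √d * T * (q / n)
      = 70 * (1 + M) * S * G' * 1 * √d * T * (q / n) * 1 := by ring
    _ ≤ _ := by gcongr

end Tradeoff

/-! ### The theorem. -/

theorem mainTheorem3 (d : ℕ) (hd : 1 ≤ d) (f s : Space d → ℝ) (ν : Kernel (Space d) ℝ)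
    [IsMarkovKernel ν] (M α b : ℝ) (hα : 0 < α) (hα1 : α ≤ 1)
    (hs : ∀ x ∈ unitCube d, 0 ≤ s x)
    (hfM : IsHolder M α f) (hsM : IsHolder M α s) (hν : NoiseAssumption b ν) :
    -- the number of strata is at most `n^{d/(d+3α)} ≤ n`
    (∀ n : ℕ, ((sideCount d α n ^ d : ℕ) : ℝ) ≤ (n : ℝ) ^ ((d : ℝ) / (d + 3 * α)) ∧
      (n : ℝ) ^ ((d : ℝ) / (d + 3 * α)) ≤ n) ∧
    -- the finite-time bound
    (∀ n : ℕ, 2 * sideCount d α n ^ d ≤ n →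
      ∀ (Ω : Type u) [MeasurableSpace Ω] (P : Measure Ω)
        (U : (Fin d → Fin (sideCount d α n)) → ℕ → Ω → Space d × ℝ)
        (a : ℕ → Ω → (Fin d → Fin (sideCount d α n))),
        MCUCBModel f s ν (cubeStratum d (sideCount d α n)) b (holderBound f s M α)
          (1 / (n : ℝ) ^ 2) n P U a →
        (∫ ω, pseudoRisk f s ν (cubeStratum d (sideCount d α n))
            (fun k => pulls (fun t => a t ω) k n) ∂P)
          - 1 / (n : ℝ) * (∫ x in unitCube d, s x) ^ 2
        ≤ tradeoffConst f s M b (totalStd f s ν (cubeStratum d (sideCount d α n)))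
          * (d : ℝ) ^ (2 * α / (3 * d) + 1 / 2) * √(Real.log n)
          * (n : ℝ) ^ (-(((d : ℝ) + 4 * α) / (d + 3 * α)))
          * (1 + (d : ℝ) ^ α * (n : ℝ) ^ (-(α / ((d : ℝ) + 3 * α))))) ∧
    -- the rate, up to a power of `log n`
    (∃ (C : ℝ) (q : ℕ), ∀ n : ℕ, 2 * sideCount d α n ^ d ≤ n →
      ∀ (Ω : Type u) [MeasurableSpace Ω] (P : Measure Ω)
        (U : (Fin d → Fin (sideCount d α n)) → ℕ → Ω → Space d × ℝ)
        (a : ℕ → Ω → (Fin d → Fin (sideCount d α n))),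
        MCUCBModel f s ν (cubeStratum d (sideCount d α n)) b (holderBound f s M α)
          (1 / (n : ℝ) ^ 2) n P U a →
        |(∫ ω, pseudoRisk f s ν (cubeStratum d (sideCount d α n))
            (fun k => pulls (fun t => a t ω) k n) ∂P)
          - 1 / (n : ℝ) * (∫ x in unitCube d, s x) ^ 2|
        ≤ C * Real.log n ^ q * (n : ℝ) ^ (-(((d : ℝ) + 4 * α) / (d + 3 * α)))) := by
  -- a model without budget would need a choice among no strata
  have hpos : ∀ n : ℕ, ∀ (Ω : Type u) [MeasurableSpace Ω] (P : Measure Ω)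
      (U : (Fin d → Fin (sideCount d α n)) → ℕ → Ω → Space d × ℝ)
      (a : ℕ → Ω → (Fin d → Fin (sideCount d α n))),
      MCUCBModel f s ν (cubeStratum d (sideCount d α n)) b (holderBound f s M α)
        (1 / (n : ℝ) ^ 2) n P U a → 1 ≤ n := by
    intro n Ω _ P U a hmod
    by_contra! h
    obtain rfl : n = 0 := by omega
    have := hmod.isProbability
    obtain ⟨ω⟩ := P.nonempty_of_neZero
    have h0 : sideCount d α 0 = 0 := by
      unfold sideCount
      rw [Nat.cast_zero, Real.zero_rpow (by positivity), Nat.floor_zero]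
    have := (a 0 ω ⟨0, hd⟩).2
    omega
  refine ⟨fun n => ⟨sideCount_pow_le, rpow_div_le_self hd hα⟩, ?_, ?_⟩
  · intro n hKn Ω _ P U a hmod
    exact risk_sub_le hd hα hα1 hs hfM hsM hν (hpos n Ω P U a hmod) hKn hmod
  -- The finite-time bound made uniform in `n`: `Σ ≤ 3/2 F`, `q ≤ 1`, and `√(log n) ≤ 5/4 log n`
  -- because `√(log n) ≥ 4/5`.
  · refine ⟨tradeoffConst f s M b (3 / 2 * holderBound f s M α)
      * (d : ℝ) ^ (2 * α / (3 * d) + 1 / 2) * (5 / 4) * (1 + (d : ℝ) ^ α), 1, ?_⟩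
    intro n hKn Ω _ P U a hmod
    have hn := hpos n Ω P U a hmod
    have hn0 : (0 : ℝ) < n := by exact_mod_cast hn
    have hl := sideCount_pos hd hα hn
    have hK : 1 ≤ sideCount d α n ^ d := Nat.one_le_pow _ _ hl
    have hn2 : 2 ≤ n := by omega
    have hM := hfM.nonneg hd
    have hs0 := hs 0 zero_mem_unitCube
    obtain ⟨hI0, hIS⟩ := integral_le_totalStd hd hl hα hs hfM hsM hν
    -- With `∫ s ≤ Σ` this shows that the difference is nonnegative, so the absolute value can be
    -- dropped.
    have hlow := sq_totalStd_div_le hd hl hα hs hfM hsM hν hmod hKn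
    have hlow2 : 1 / (n : ℝ) * (∫ x in unitCube d, s x) ^ 2 ≤
        totalStd f s ν (cubeStratum d (sideCount d α n)) ^ 2 / n := by
      rw [one_div_mul_eq_div]
      gcongr
    rw [abs_of_nonneg (by linarith)]
    refine (risk_sub_le hd hα hα1 hs hfM hsM hν hn hKn hmod).trans ?_
    have hT : 4 / 5 ≤ √(Real.log n) := by
      refine Real.le_sqrt_of_sq_le ?_
      linarith [log_two_le_log hn2, Real.log_two_gt_d9]
    have hlog : 0 ≤ Real.log n := Real.log_natCast_nonneg n
    have hTlog : √(Real.log n) ≤ 5 / 4 * Real.log n ^ 1 := by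
      have := Real.mul_self_sqrt hlog
      rw [pow_one]
      nlinarith
    have hq1 := rpow_neg_le_one hd hα hn
    have hc : 0 ≤ tradeoffConst f s M b (totalStd f s ν (cubeStratum d (sideCount d α n))) ∧
        tradeoffConst f s M b (totalStd f s ν (cubeStratum d (sideCount d α n))) ≤
        tradeoffConst f s M b (3 / 2 * holderBound f s M α) := by
      have hS := totalStd_le_holderBound hd hl hα hs hfM hsM hν
      have hS0 := hI0.trans hIS
      have habs := abs_nonneg (f 0)
      unfold tradeoffConst
      constructor
      · positivity
      · gcongr
    obtain ⟨hc0, hc1⟩ := hc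
    calc _ ≤ tradeoffConst f s M b (3 / 2 * holderBound f s M α)
        * (d : ℝ) ^ (2 * α / (3 * d) + 1 / 2) * (5 / 4 * Real.log n ^ 1)
        * (n : ℝ) ^ (-(((d : ℝ) + 4 * α) / (d + 3 * α))) * (1 + (d : ℝ) ^ α * 1) := by
          have := hc0.trans hc1
          gcongr
      _ = _ := by ring
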